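/- **Setting.** Let $H$ be a finite-dimensional complex weak Hopf algebra with comultiplication $\Delta$, counit $\varepsilon$ and (bijective) antipode $S$, and let $\hat H=\operatorname{Hom}(H,\mathbb C)$ be its dual, with $\langle\varphi\psi,x\rangle=\sum\varphi(x_{(1)})\psi(x_{(2)})$, $\langle\varphi_{(1)}\otimes\varphi_{(2)},x\otimes y\rangle=\varphi(xy)$ and unit $\varepsilon$. Let $\lambda\in H$ and $\Lambda\in\hat H$ be Haar integrals, i.e. two-sided integrals that are normalized on both sides ($x\lambda=\varepsilon_L(x)\lambda$, $\lambda x=\lambda\varepsilon_R(x)$, $\varepsilon_L(\lambda)=\varepsilon_R(\lambda)=1$, where $\varepsilon_L(x)=\sum\varepsilon(1_{(1)}x)1_{(2)}$, $\varepsilon_R(x)=\sum1_{(1)}\varepsilon(x1_{(2)})$; likewise for $\Lambda$). On $H$ put $$\overrightarrow X_hx=hx,\quad \overleftarrow X_hx=xS(h),\quad \widetilde X_hx=xh,\quad \overrightarrow Z_\psi x=\sum x_{(1)}\psi(x_{(2)}),\quad \overleftarrow Z_\psi x=\sum\psi(S(x_{(1)}))x_{(2)} .$$ *The open chain.* Let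 $m\ge0$. The ladder has vertices $v_0,\dots,v_{m+1}$ on its smooth boundary, horizontal edges $s_j:v_j\to v_{j+1}$ $(0\le j\le m)$ and vertical edges $r_i$ $(0\le i\le m+1)$ leading from $v_i$ to the rough boundary; every edge carries a copy of $H$. For $g\in H$, $\psi\in\hat H$ the vertex and face operators, read counterclockwise, are $$A^g_{v_i}=\sum\overleftarrow X_{g_{(1)}}(s_i)\,\overleftarrow X_{g_{(2)}}(r_i)\,\overrightarrow X_{g_{(3)}}(s_{i-1})\quad(1\le i\le m),$$ $$B^\psi_{f_j}=\sum\overrightarrow Z_{\psi_{(1)}}(r_j)\,\overleftarrow Z_{\psi_{(2)}}(s_j)\,\overleftarrow Z_{\psi_{(3)}}(r_{j+1})\quad(0\le j\le m).$$ The weak Hopf cluster state model has the stabilizers $A_{v_i}=A^\lambda_{v_i}$, $B_{f_j}=B^\Lambda_{f_j}$ and the Hamiltonian $-\sum_iA_{v_i}-\sum_jB_{f_j}$. A *symmetry* is an operator that commutes with every stabilizer and with the Hamiltonian. *Ribbon operators.* Let $\rho$ be the ribbon that runs from left to right through the whole chain, between its smooth and its rough boundary: the dual triangle across $r_0$, the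 direct triangle along $s_0$, the dual triangle across $r_1$, …, the direct triangle along $s_m$, the dual triangle across $r_{m+1}$. For $h\in H$, $\varphi\in\hat H$, the operator of the dual triangle across $r_i$ is $\varphi(1)\,\widetilde X_h(r_i)$, that of the direct triangle along $s_j$ is $\varepsilon(h)\,\overleftarrow Z_\varphi(s_j)$, and for a ribbon composed of a first triangle $\rho_1$ and the remaining ribbon $\rho_2$ $$F^{h,\varphi}(\rho)=\sum_k\sum F^{h_{(1)},\hat k}(\rho_1)\,F^{S^{-1}(k_{(3)})h_{(2)}k_{(1)},\,\varphi(k_{(2)}\,\bullet)}(\rho_2),$$ where $k$ runs through a basis of $H$ and $\hat k$ through the dual basis. The ribbons that consist only of dual triangles along the rough boundary, resp. only of direct triangles along the smooth boundary (counterclockwise around the exterior face), have the operators $$S_h=\bigotimes_{i=0}^{m+1}\overrightarrow X_{h_{(i+1)}}(r_i),\qquad T_\varphi=\bigotimes_{j=0}^{m}\overrightarrow Z_{\varphi_{(m+1-j)}}(s_j).$$ **Theorem.** For every $m\ge0$: 1. For all $h\in H$, $\varphi\in\hat H$, $F^{h,\varphi}(\rho)$ commutes with all vertex operators $A^g_{v_i}$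 $(g\in H)$ and all face operators $B^\psi_{f_j}$ $(\psi\in\hat H)$. In particular it is a symmetry of the cluster state model. 2. $S_{gh}=S_gS_h$, $T_{\varphi\psi}=T_\varphi T_\psi$ and $S_hT_\varphi=T_\varphi S_h$ for all $g,h\in H$, $\varphi,\psi\in\hat H$, and the linear map $H\otimes\hat H\to\operatorname{End}\big(\bigotimes_eH\big)$, $h\otimes\varphi\mapsto S_hT_\varphi$, is injective. Every $S_h$ commutes with all $A^g_{v_i}$, and every $T_\varphi$ commutes with all $B^\psi_{f_j}$. 3. If $\lambda$ and $\Lambda$ are cocommutative, then all $S_h$ $(h\in H)$ and all $T_\varphi$ $(\varphi\in\hat H)$ are symmetries, so that the model has the full symmetry $H\times\hat H$. In that case also $A_{v_i}=\sum\overrightarrow X_{\lambda_{(1)}}(s_{i-1})\,\overleftarrow X'_{\lambda_{(2)}}(s_i)\,\overleftarrow X'_{\lambda_{(3)}}(r_i)$ with $\overleftarrow X'_hx=xS^{-1}(h)$. 4. The symmetry contains $H\times\mathsf{Rep}(H)$: for finite-dimensional representations $V,W$ of $H$ with characters $\chi_V,\chi_W\in\hat H$, all $F^{h,\chi_V}(\rho)$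 $(h\in H)$ are symmetries; $H$ acts through $\Delta$ on $V\boxtimes W=\{x\in V\otimes W\mid\Delta(1)x=x\}$, and $T_{\chi_{V\boxtimes W}}=T_{\chi_V}T_{\chi_W}$. -/

import Mathlib

open scoped TensorProduct

noncomputable section

namespace WeakHopfCluster

/-! ### Convolution of linear maps along a comultiplication -/

section Convolution

variable {C A : Type*} [AddCommGroup C] [Module ℂ C] [Ring A] [Algebra ℂ A]

/-- `(f ⋆ g)(c) = ∑ f(c⁽¹⁾) g(c⁽²⁾)`, where `D c = ∑ c⁽¹⁾ ⊗ c⁽²⁾`. -/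
def conv (D : C →ₗ[ℂ] C ⊗[ℂ] C) (f g : C →ₗ[ℂ] A) : C →ₗ[ℂ] A :=
  LinearMap.mul' ℂ A ∘ₗ TensorProduct.map f g ∘ₗ D

/-- The list `[f₁, …, f_k]` is sent to `c ↦ ∑ f₁(c⁽¹⁾) f₂(c⁽²⁾) ⋯ f_k(c⁽ᵏ⁾)`
(the empty list, which never occurs below, is sent to `0`). -/
def convAlong (D : C →ₗ[ℂ] C ⊗[ℂ] C) : List (C →ₗ[ℂ] A) → (C →ₗ[ℂ] A)
  | [] => 0
  | [f] => f
  | f :: g :: l => conv D f (convAlong D (g :: l))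

end Convolution

/-! ### Weak Hopf algebras and their duals -/

section WeakHopf

section CounitalMaps

variable {H : Type*} [Ring H] [Algebra ℂ H] [Coalgebra ℂ H]

/-- The left counital map `ε_L(x) = ∑ ε(1⁽¹⁾ x) 1⁽²⁾`. -/
def epsL (x : H) : H :=
  TensorProduct.lid ℂ H
    (TensorProduct.map (Coalgebra.counit ∘ₗ LinearMap.mulRight ℂ x) LinearMap.id
      (Coalgebra.comul (R := ℂ) (1 : H)))

/-- The right counital map `ε_R(x) = ∑ 1⁽¹⁾ ε(x 1⁽²⁾)`. -/
def epsR (x : H) : H :=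
  TensorProduct.rid ℂ H
    (TensorProduct.map LinearMap.id (Coalgebra.counit ∘ₗ LinearMap.mulLeft ℂ x)
      (Coalgebra.comul (R := ℂ) (1 : H)))

end CounitalMaps

/-- A complex weak Hopf algebra (with bijective antipode, which is automatic in finite
dimension): an algebra and a coalgebra, with the compatibility axioms below. -/
class WeakHopfAlgebra (H : Type*) [Ring H] [Algebra ℂ H] extends Coalgebra ℂ H where
  /-- `Δ(xy) = Δ(x) Δ(y)`. -/
  comul_mul : ∀ x y : H, comul (x * y) = comul x * comul y
  /-- `(Δ ⊗ id) Δ(1) = (Δ(1) ⊗ 1)(1 ⊗ Δ(1))`. -/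
  comul_one_left : TensorProduct.map comul LinearMap.id (comul (1 : H)) =
    (comul (1 : H) ⊗ₜ[ℂ] (1 : H)) *
      (TensorProduct.assoc ℂ H H H).symm ((1 : H) ⊗ₜ[ℂ] comul (1 : H))
  /-- `(Δ ⊗ id) Δ(1) = (1 ⊗ Δ(1))(Δ(1) ⊗ 1)`. -/
  comul_one_right : TensorProduct.map comul LinearMap.id (comul (1 : H)) =
    (TensorProduct.assoc ℂ H H H).symm ((1 : H) ⊗ₜ[ℂ] comul (1 : H)) *
      (comul (1 : H) ⊗ₜ[ℂ] (1 : H))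
  /-- `ε(xyz) = ∑ ε(x y⁽¹⁾) ε(y⁽²⁾ z)`. -/
  counit_mul_left : ∀ x y z : H, counit (x * y * z) =
    LinearMap.mul' ℂ ℂ (TensorProduct.map (counit ∘ₗ LinearMap.mulLeft ℂ x)
      (counit ∘ₗ LinearMap.mulRight ℂ z) (comul y))
  /-- `ε(xyz) = ∑ ε(x y⁽²⁾) ε(y⁽¹⁾ z)`. -/
  counit_mul_right : ∀ x y z : H, counit (x * y * z) =
    LinearMap.mul' ℂ ℂ (TensorProduct.map (counit ∘ₗ LinearMap.mulRight ℂ z)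
      (counit ∘ₗ LinearMap.mulLeft ℂ x) (comul y))
  /-- The antipode `S`. -/
  antipode : H ≃ₗ[ℂ] H
  /-- `∑ x⁽¹⁾ S(x⁽²⁾) = ε_L(x)`. -/
  conv_id_antipode : ∀ x : H, conv comul LinearMap.id antipode.toLinearMap x = epsL x
  /-- `∑ S(x⁽¹⁾) x⁽²⁾ = ε_R(x)`. -/
  conv_antipode_id : ∀ x : H, conv comul antipode.toLinearMap LinearMap.id x = epsR x
  /-- `∑ S(x⁽¹⁾) x⁽²⁾ S(x⁽³⁾) = S(x)`. -/
  antipode_conv : ∀ x : H,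
    convAlong comul [antipode.toLinearMap, LinearMap.id, antipode.toLinearMap] x = antipode x

variable (H : Type*) [Ring H] [Algebra ℂ H] [WeakHopfAlgebra H]

/-- The comultiplication `Δ` of `H`. -/
def Δ : H →ₗ[ℂ] H ⊗[ℂ] H := Coalgebra.comul

/-- The counit `ε` of `H`; it is the unit of the dual algebra. -/
def ε : Module.Dual ℂ H := Coalgebra.counit

/-- The antipode `S` of `H`. -/
def S : H →ₗ[ℂ] H := (WeakHopfAlgebra.antipode : H ≃ₗ[ℂ] H).toLinearMap

/-- The inverse `S⁻¹` of the antipode of `H`. -/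
def Sinv : H →ₗ[ℂ] H := (WeakHopfAlgebra.antipode : H ≃ₗ[ℂ] H).symm.toLinearMap

variable {H}

/-- A Haar integral: a two-sided integral that is normalized on both sides. -/
structure IsHaarIntegral (l : H) : Prop where
  left : ∀ x : H, x * l = epsL x * l
  right : ∀ x : H, l * x = l * epsR x
  epsL_eq : epsL l = 1
  epsR_eq : epsR l = 1

/-- Cocommutative elements of `H`. -/
def IsCocomm (h : H) : Prop := TensorProduct.comm ℂ H H (Δ H h) = Δ H h

/-- Product of the dual: `⟨φψ, x⟩ = ∑ φ(x⁽¹⁾) ψ(x⁽²⁾)`. -/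
def dualMul : Module.Dual ℂ H →ₗ[ℂ] Module.Dual ℂ H →ₗ[ℂ] Module.Dual ℂ H :=
  TensorProduct.curry ((Δ H).dualMap ∘ₗ TensorProduct.dualDistrib ℂ H H)

variable (H) in
/-- The counit `φ ↦ φ(1)` of the dual. -/
def dualε : Module.Dual ℂ (Module.Dual ℂ H) := Module.Dual.eval ℂ H 1

variable (H) in
/-- Comultiplication of the dual: `⟨φ⁽¹⁾ ⊗ φ⁽²⁾, x ⊗ y⟩ = φ(xy)`. -/
def dualΔ [FiniteDimensional ℂ H] :
    Module.Dual ℂ H →ₗ[ℂ] Module.Dual ℂ H ⊗[ℂ] Module.Dual ℂ H :=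
  (TensorProduct.dualDistribEquiv ℂ H H).symm.toLinearMap ∘ₗ (LinearMap.mul' ℂ H).dualMap

/-- The left counital map of the dual. -/
def dualEpsL [FiniteDimensional ℂ H] (φ : Module.Dual ℂ H) : Module.Dual ℂ H :=
  TensorProduct.lid ℂ _
    (TensorProduct.map (dualε H ∘ₗ dualMul.flip φ) LinearMap.id (dualΔ H (ε H)))

/-- The right counital map of the dual. -/
def dualEpsR [FiniteDimensional ℂ H] (φ : Module.Dual ℂ H) : Module.Dual ℂ H :=
  TensorProduct.rid ℂ _
    (TensorProduct.map LinearMap.id (dualε H ∘ₗ dualMul φ) (dualΔ H (ε H)))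

/-- A Haar integral of the dual (the unit of the dual is `ε`). -/
structure IsDualHaarIntegral [FiniteDimensional ℂ H] (L : Module.Dual ℂ H) : Prop where
  left : ∀ φ : Module.Dual ℂ H, dualMul φ L = dualMul (dualEpsL φ) L
  right : ∀ φ : Module.Dual ℂ H, dualMul L φ = dualMul L (dualEpsR φ)
  epsL_eq : dualEpsL L = ε H
  epsR_eq : dualEpsR L = ε H

/-- Cocommutative elements of the dual: `φ(xy) = φ(yx)`. -/
def IsDualCocomm (φ : Module.Dual ℂ H) : Prop := ∀ x y : H, φ (x * y) = φ (y * x)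

/-! ### Generalized Pauli operators on one weak Hopf qudit -/

variable (H) in
/-- `X→_h x = h x`. -/
def Xr : H →ₗ[ℂ] Module.End ℂ H := LinearMap.mul ℂ H

variable (H) in
/-- `X←_h x = x S(h)`. -/
def Xl : H →ₗ[ℂ] Module.End ℂ H := (LinearMap.mul ℂ H).flip ∘ₗ S H

variable (H) in
/-- `x ↦ x S⁻¹(h)`. -/
def XlInv : H →ₗ[ℂ] Module.End ℂ H := (LinearMap.mul ℂ H).flip ∘ₗ Sinv H

variable (H) in
/-- `X̃←_h x = x h`. -/
def Xt : H →ₗ[ℂ] Module.End ℂ H := (LinearMap.mul ℂ H).flip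

variable (H) in
/-- `Z→_ψ x = ∑ x⁽¹⁾ ψ(x⁽²⁾)`. -/
def Zr : Module.Dual ℂ H →ₗ[ℂ] Module.End ℂ H where
  toFun ψ := (TensorProduct.rid ℂ H).toLinearMap ∘ₗ TensorProduct.map LinearMap.id ψ ∘ₗ Δ H
  map_add' ψ χ := by
    rw [TensorProduct.map_add_right, LinearMap.add_comp, LinearMap.comp_add]
  map_smul' c ψ := by
    rw [TensorProduct.map_smul_right, LinearMap.smul_comp, LinearMap.comp_smul]; rfl

variable (H) in
/-- `Z←_ψ x = ∑ ψ(S(x⁽¹⁾)) x⁽²⁾`. -/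
def Zl : Module.Dual ℂ H →ₗ[ℂ] Module.End ℂ H where
  toFun ψ := (TensorProduct.lid ℂ H).toLinearMap ∘ₗ
    TensorProduct.map (ψ ∘ₗ S H) LinearMap.id ∘ₗ Δ H
  map_add' ψ χ := by
    rw [LinearMap.add_comp, TensorProduct.map_add_left, LinearMap.add_comp, LinearMap.comp_add]
  map_smul' c ψ := by
    rw [LinearMap.smul_comp, TensorProduct.map_smul_left, LinearMap.smul_comp,
      LinearMap.comp_smul]; rfl

/-! ### The open ladder

The open chain has the smooth-boundary vertices `v_0, …, v_{m+1}`, the horizontal edges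
`s_j : v_j → v_{j+1}` for `j ≤ m`, and the vertical edges `r_i` for `i ≤ m+1`, which leave `v_i`
and end on the rough boundary.  The plaquette `f_j` is bounded by `r_j`, `s_j`, `r_{j+1}`.  The
vertices that meet two horizontal edges and a vertical one are `v_1, …, v_m`. -/

/-- `Sum.inl i` is the vertical edge `r_i`, `Sum.inr j` is the horizontal edge `s_j`. -/
abbrev Edge (m : ℕ) := Fin (m + 2) ⊕ Fin (m + 1)

variable (H) in
/-- The total Hilbert space `⨂_e H`. -/
abbrev Tot (m : ℕ) := ⨂[ℂ] _e : Edge m, H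

variable {m : ℕ}

/-- The operator that acts as `a` on the edge `e` and as the identity on the other edges. -/
def onEdge (e : Edge m) : Module.End ℂ H →ₗ[ℂ] Module.End ℂ (Tot H m) :=
  (PiTensorProduct.mapMultilinear ℂ (fun _ : Edge m => H) (fun _ : Edge m => H)).toLinearMap
    (fun _ => LinearMap.id) e

variable (H) in
/-- The vertical edge operators. -/
def onVert {C : Type*} [AddCommGroup C] [Module ℂ C] (f : C →ₗ[ℂ] Module.End ℂ H)
    (i : Fin (m + 2)) : C →ₗ[ℂ] Module.End ℂ (Tot H m) := onEdge (Sum.inl i) ∘ₗ f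

variable (H) in
/-- The horizontal edge operators. -/
def onHoriz {C : Type*} [AddCommGroup C] [Module ℂ C] (f : C →ₗ[ℂ] Module.End ℂ H)
    (j : Fin (m + 1)) : C →ₗ[ℂ] Module.End ℂ (Tot H m) := onEdge (Sum.inr j) ∘ₗ f

/-- The vertex operator `A^g` at `v_{i+1}`, for `i < m`: counterclockwise around the vertex,
starting below the smooth boundary,
`∑ X←_{g⁽¹⁾}(s_{i+1}) X←_{g⁽²⁾}(r_{i+1}) X→_{g⁽³⁾}(s_i)`. -/
def vertexOp (i : Fin m) : H →ₗ[ℂ] Module.End ℂ (Tot H m) :=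
  convAlong (Δ H) [onHoriz H (Xl H) i.succ, onVert H (Xl H) i.succ.castSucc,
    onHoriz H (Xr H) i.castSucc]

/-- The vertex operator at `v_{i+1}` in the convention in which one starts above the smooth
boundary, to the left of `r_{i+1}`, and in which `S⁻¹` replaces `S`: the operator
`∑ X→_{g⁽¹⁾}(s_i) X←_{g⁽²⁾}(s_{i+1}) X←_{g⁽³⁾}(r_{i+1})` with `X←_h x = x S⁻¹(h)`. -/
def vertexOpAbove (i : Fin m) : H →ₗ[ℂ] Module.End ℂ (Tot H m) :=
  convAlong (Δ H) [onHoriz H (Xr H) i.castSucc, onHoriz H (XlInv H) i.succ,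
    onVert H (XlInv H) i.succ.castSucc]

/-- The face operator `B^ψ` at the plaquette `f_j`: counterclockwise, starting at the rough
boundary, `∑ Z→_{ψ⁽¹⁾}(r_j) Z←_{ψ⁽²⁾}(s_j) Z←_{ψ⁽³⁾}(r_{j+1})`. -/
def faceOp [FiniteDimensional ℂ H] (j : Fin (m + 1)) :
    Module.Dual ℂ H →ₗ[ℂ] Module.End ℂ (Tot H m) :=
  convAlong (dualΔ H) [onVert H (Zr H) j.castSucc, onHoriz H (Zl H) j, onVert H (Zl H) j.succ]

variable (m) in
/-- The Hamiltonian `-∑_v A_v - ∑_f B_f`, with `A_v = A_v^l` and `B_f = B_f^L`. -/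
def hamiltonian [FiniteDimensional ℂ H] (l : H) (L : Module.Dual ℂ H) :
    Module.End ℂ (Tot H m) :=
  -∑ i : Fin m, vertexOp i l - ∑ j : Fin (m + 1), faceOp j L

/-- `U` commutes with every vertex stabilizer `A_v^l`, every face stabilizer `B_f^L`, and the
Hamiltonian. -/
structure IsSymmetry [FiniteDimensional ℂ H] (l : H) (L : Module.Dual ℂ H)
    (U : Module.End ℂ (Tot H m)) : Prop where
  vertex : ∀ i : Fin m, Commute U (vertexOp i l)
  face : ∀ j : Fin (m + 1), Commute U (faceOp j L)
  hamiltonian : Commute U (hamiltonian m l L)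

/-! ### Ribbon operators -/

variable (m) in
/-- The ribbon along the rough boundary, which consists of dual triangles only:
`S_h = ∑ X→_{h⁽¹⁾}(r_0) ⊗ X→_{h⁽²⁾}(r_1) ⊗ ⋯ ⊗ X→_{h⁽ᵐ⁺²⁾}(r_{m+1})`. -/
def roughOp : H →ₗ[ℂ] Module.End ℂ (Tot H m) :=
  convAlong (Δ H) ((List.finRange (m + 2)).map (onVert H (Xr H)))

variable (m) in
/-- The ribbon along the smooth boundary, which consists of direct triangles only and runs below
the boundary, counterclockwise around the exterior face:
`T_φ = ∑ Z→_{φ⁽¹⁾}(s_m) ⊗ Z→_{φ⁽²⁾}(s_{m-1}) ⊗ ⋯ ⊗ Z→_{φ⁽ᵐ⁺¹⁾}(s_0)`. -/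
def smoothOp [FiniteDimensional ℂ H] : Module.Dual ℂ H →ₗ[ℂ] Module.End ℂ (Tot H m) :=
  convAlong (dualΔ H) ((List.finRange (m + 1)).reverse.map (onHoriz H (Zr H)))

/-- The operator `x ⊗ φ ↦ ∑ S⁻¹(k⁽³⁾) x k⁽¹⁾ ⊗ φ(k⁽²⁾ •)` on `H ⊗ Ĥ`. -/
def twist : H →ₗ[ℂ] Module.End ℂ (H ⊗[ℂ] Module.Dual ℂ H) :=
  convAlong (A := Module.End ℂ (H ⊗[ℂ] Module.Dual ℂ H)) (Δ H)
    [(LinearMap.rTensorHom (Module.Dual ℂ H) : Module.End ℂ H →ₗ[ℂ] _) ∘ₗ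
        (LinearMap.mul ℂ H).flip,
     (LinearMap.lTensorHom H : Module.End ℂ (Module.Dual ℂ H) →ₗ[ℂ] _) ∘ₗ
        Module.Dual.transpose ∘ₗ LinearMap.mul ℂ H,
     (LinearMap.rTensorHom (Module.Dual ℂ H) : Module.End ℂ H →ₗ[ℂ] _) ∘ₗ
        LinearMap.mul ℂ H ∘ₗ Sinv H]

variable (H) in
/-- The comultiplication dual to the product of the quantum double: for a basis `k` of `H` with
dual basis `k̂`,
`h ⊗ φ ↦ ∑_k ∑ (h⁽¹⁾ ⊗ k̂) ⊗ (S⁻¹(k⁽³⁾) h⁽²⁾ k⁽¹⁾ ⊗ φ(k⁽²⁾ •))`. -/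
def doubleΔ [FiniteDimensional ℂ H] : (H ⊗[ℂ] Module.Dual ℂ H) →ₗ[ℂ]
    (H ⊗[ℂ] Module.Dual ℂ H) ⊗[ℂ] (H ⊗[ℂ] Module.Dual ℂ H) :=
  (∑ a, TensorProduct.map
      ((TensorProduct.mk ℂ H (Module.Dual ℂ H)).flip ((Module.finBasis ℂ H).coord a))
      (twist (Module.finBasis ℂ H a))) ∘ₗ
    (TensorProduct.assoc ℂ H H (Module.Dual ℂ H)).toLinearMap ∘ₗ
    TensorProduct.map (Δ H) LinearMap.id

/-- The dual triangle at the smooth-boundary vertex `v_i`, which crosses `r_i`: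
`h ⊗ φ ↦ φ(1) X̃←_h(r_i)`. -/
def dualTriangle (i : Fin (m + 2)) :
    (H ⊗[ℂ] Module.Dual ℂ H) →ₗ[ℂ] Module.End ℂ (Tot H m) :=
  onVert H (Xt H) i ∘ₗ (TensorProduct.rid ℂ H).toLinearMap ∘ₗ
    TensorProduct.map LinearMap.id (dualε H)

/-- The direct triangle along `s_j`, on the upper (left) side of `s_j`:
`h ⊗ φ ↦ ε(h) Z←_φ(s_j)`. -/
def directTriangle (j : Fin (m + 1)) :
    (H ⊗[ℂ] Module.Dual ℂ H) →ₗ[ℂ] Module.End ℂ (Tot H m) :=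
  onHoriz H (Zl H) j ∘ₗ (TensorProduct.lid ℂ (Module.Dual ℂ H)).toLinearMap ∘ₗ
    TensorProduct.map (ε H) LinearMap.id

variable (H m) in
/-- The triangles of the ribbon that runs from left to right through the whole open ladder,
between its smooth and its rough boundary: the dual triangle across `r_0`, the direct triangle
along `s_0`, the dual triangle across `r_1`, …, the dual triangle across `r_{m+1}`. -/
def ribbonTriangles : List ((H ⊗[ℂ] Module.Dual ℂ H) →ₗ[ℂ] Module.End ℂ (Tot H m)) :=
  dualTriangle 0 ::
    (List.finRange (m + 1)).flatMap fun j => [directTriangle j, dualTriangle j.succ]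

variable (m) in
/-- The ribbon operator `F^{h,φ}`. -/
def ribbonOp [FiniteDimensional ℂ H] (h : H) (φ : Module.Dual ℂ H) :
    Module.End ℂ (Tot H m) :=
  convAlong (doubleΔ H) (ribbonTriangles H m) (h ⊗ₜ[ℂ] φ)

/-! ### Representations of `H` -/

section Rep

variable {V W : Type*} [AddCommGroup V] [Module ℂ V] [AddCommGroup W] [Module ℂ W]

/-- The character of a representation, an element of the dual. -/
def character (ρ : H →ₐ[ℂ] Module.End ℂ V) : Module.Dual ℂ H :=
  LinearMap.trace ℂ V ∘ₗ ρ.toLinearMap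

/-- The action of `H` on `V ⊗ W` through `Δ`; in general `1` does not act as the identity. -/
def tensorAction (ρ : H →ₐ[ℂ] Module.End ℂ V) (σ : H →ₐ[ℂ] Module.End ℂ W) :
    H →ₗ[ℂ] Module.End ℂ (V ⊗[ℂ] W) :=
  TensorProduct.homTensorHomMap (RingHom.id ℂ) V W V W ∘ₗ
    TensorProduct.map ρ.toLinearMap σ.toLinearMap ∘ₗ Δ H

/-- The tensor product of representations, `{x ∈ V ⊗ W | Δ(1) x = x}`. -/
def tensorRep (ρ : H →ₐ[ℂ] Module.End ℂ V) (σ : H →ₐ[ℂ] Module.End ℂ W) :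
    Submodule ℂ (V ⊗[ℂ] W) :=
  LinearMap.eqLocus (tensorAction ρ σ 1) LinearMap.id

end Rep

end WeakHopf

end WeakHopfCluster

end

/-! Ribbons. The recursion for F^{h,φ} is a transfer matrix. The pair h ⊗ φ is the state of an
auxiliary label system H ⊗ Ĥ, each triangle is one operator on ladder ⊗ labels (`dualOp`,
`directOp`), and F^{h,φ} is the matrix element of their product between h ⊗ φ and the functional ε ⊗
(evaluation at 1) (`ribbonOp_eq_evLabel`). Taking this matrix element is linear over the ladder
operators, so it suffices that each stabilizer commutes with the product of triangles before the
labels are evaluated (`commute_evLabel`). Every triangle is built from controlled operators x ⊗ v ↦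
x⁽²⁾ ⊗ f(x⁽¹⁾)v (`ctrl`). A dual triangle is controlled by the label h and multiplies the edge from
the right. A direct triangle is controlled by the edge element x and, with k = S(x), changes the
labels by h ↦ x⁽¹⁾ h S(x⁽³⁾), φ ↦ φ(S(x⁽²⁾) •). The convolution ring hides the Sweedler legs of g
and ψ, and there the exchange relations between Pauli and controlled operators become relations
between letters. In `vertex_word`, the factor X→ on the incoming horizontal edge deposits operators
on the labels, the dual triangle converts them, and the outgoing edge absorbs them. In `face_word`,
the right vertical edge deposits a Z on the label h, which the direct triangle transports and the
left vertical edge absorbs. The weak axioms intervene because Δ(1) need not be 1 ⊗ 1: a pair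
S(x⁽¹⁾)x⁽²⁾ or x⁽¹⁾S(x⁽²⁾) contracts only to ε_R(x) or ε_L(x). Such a remainder is moved onto the
legs of Δ(1) (`sum_eR_tail`, `sum_eL_tail`, `sum_eR_head`) and swallowed by the exchange relation at
g = 1, which is not a tautology here. Boundary operators. They are multiplicative because the two
comultiplications are, and because distinct edges commute. Injectivity follows by sandwiching with
rank-one operators, which contract all edges but r_0 and s_m by counits; matrix elements then return
χ(h)φ(x) (`exists_functional_boundary`). Cocommutative integrals. A Haar integral Λ with Λ(xy) =
Λ(yx) forces S² = id (`IsDualHaarIntegral.S_S`). Then legs can be rotated cyclically in Λ and λ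
until an antipode contraction appears, and the remainder is swallowed as before. Representations. H
acts on V ⊗ W with image in the fixed space of Δ(1), so the trace on that subspace is the trace on V
⊗ W, which is the dual product of the characters. -/

open WithConv

noncomputable section

set_option linter.unusedSectionVars false

namespace WeakHopfCluster

/-! ### Sweedler sums and the convolution ring -/

section Sweedler

variable {C : Type*} [AddCommGroup C] [Module ℂ C] [Coalgebra ℂ C]
variable {A : Type*} [Ring A] [Algebra ℂ A]
variable {M : Type*} [AddCommGroup M] [Module ℂ M]

/-- A finite set of pairs `(c⁽¹⁾, c⁽²⁾)` that represents the comultiplication of `c`. -/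
def sw (c : C) : Finset (C × C) :=
  (TensorProduct.exists_finset (Coalgebra.comul (R := ℂ) c)).choose

lemma comul_eq_sum (c : C) :
    Coalgebra.comul (R := ℂ) c = ∑ p ∈ sw c, p.1 ⊗ₜ[ℂ] p.2 :=
  (TensorProduct.exists_finset (Coalgebra.comul (R := ℂ) c)).choose_spec

lemma sum_sw (B : C ⊗[ℂ] C →ₗ[ℂ] M) (c : C) :
    ∑ p ∈ sw c, B (p.1 ⊗ₜ p.2) = B (Coalgebra.comul (R := ℂ) c) := by
  rw [comul_eq_sum, map_sum]

lemma sum_sw_counit_left (c : C) :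
    ∑ p ∈ sw c, Coalgebra.counit (R := ℂ) p.1 • p.2 = c := by
  have h := congrArg (TensorProduct.lid ℂ C) (Coalgebra.rTensor_counit_comul (R := ℂ) c)
  rw [comul_eq_sum] at h
  simpa using h

lemma sum_sw_counit_right (c : C) :
    ∑ p ∈ sw c, Coalgebra.counit (R := ℂ) p.2 • p.1 = c := by
  have h := congrArg (TensorProduct.rid ℂ C) (Coalgebra.lTensor_counit_comul (R := ℂ) c)
  rw [comul_eq_sum] at h
  simpa using h

/-- The chosen representatives of Δ are not coassociative term by term; only their values under maps
that are linear on the triple tensor product agree. Later proofs therefore package their expressions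
into such a map T first. -/
lemma sum_sw_assoc (T : C ⊗[ℂ] (C ⊗[ℂ] C) →ₗ[ℂ] M) (c : C) :
    ∑ p ∈ sw c, ∑ q ∈ sw p.1, T (q.1 ⊗ₜ (q.2 ⊗ₜ p.2)) =
      ∑ p ∈ sw c, ∑ q ∈ sw p.2, T (p.1 ⊗ₜ (q.1 ⊗ₜ q.2)) := by
  have h := congrArg T (Coalgebra.coassoc_apply (R := ℂ) c)
  rw [comul_eq_sum c] at h
  simpa [comul_eq_sum, TensorProduct.sum_tmul, TensorProduct.tmul_sum] using h

lemma convMul_eq_sum (f g : WithConv (C →ₗ[ℂ] A)) (c : C) :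
    (f * g) c = ∑ p ∈ sw c, f p.1 * g p.2 := by
  rw [LinearMap.convMul_apply, comul_eq_sum]
  simp

/-- The constant `a` of the convolution ring. -/
def cst (a : A) : WithConv (C →ₗ[ℂ] A) :=
  toConv ((LinearMap.toSpanSingleton ℂ A a) ∘ₗ Coalgebra.counit)

lemma cst_apply (a : A) (c : C) : (cst a : WithConv (C →ₗ[ℂ] A)) c =
    Coalgebra.counit (R := ℂ) c • a := rfl

lemma cst_mul_apply (a : A) (f : WithConv (C →ₗ[ℂ] A)) (c : C) :
    (cst a * f : WithConv (C →ₗ[ℂ] A)) c = a * f c := by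
  rw [convMul_eq_sum]
  conv_rhs => rw [← sum_sw_counit_left c]
  simp [cst_apply, Finset.mul_sum]

lemma mul_cst_apply (a : A) (f : WithConv (C →ₗ[ℂ] A)) (c : C) :
    (f * cst a : WithConv (C →ₗ[ℂ] A)) c = f c * a := by
  rw [convMul_eq_sum]
  conv_rhs => rw [← sum_sw_counit_right c]
  simp [cst_apply, Finset.sum_mul]

lemma cst_mul (a b : A) : (cst (a * b) : WithConv (C →ₗ[ℂ] A)) = cst a * cst b := by
  ext c
  rw [cst_mul_apply, cst_apply, cst_apply, mul_smul_comm]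

/-- Convolution with a constant on either side is pointwise multiplication by it. Commuting with all
values of a map is thus the same as commuting with the map in the convolution ring, where products
of Sweedler sums are plain words. -/
lemma commute_cst {a : A} {f : WithConv (C →ₗ[ℂ] A)} (h : ∀ c, Commute a (f c)) :
    Commute (cst a) f := by
  ext c
  rw [cst_mul_apply, mul_cst_apply, (h c).eq]

lemma commute_apply {a : A} {f : WithConv (C →ₗ[ℂ] A)} (h : Commute (cst a) f) (c : C) :
    Commute a (f c) := by
  have := congrArg (fun F : WithConv (C →ₗ[ℂ] A) => F c) h.eq
  simp only [cst_mul_apply, mul_cst_apply] at this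
  exact this

lemma commute_convMul_apply {a : A} {f g : WithConv (C →ₗ[ℂ] A)}
    (hf : ∀ c, Commute a (f c)) (hg : ∀ c, Commute a (g c)) (c : C) : Commute a ((f * g) c) :=
  commute_apply ((commute_cst hf).mul_right (commute_cst hg)) c

end Sweedler

end WeakHopfCluster

namespace WeakHopfCluster

/-! ### Elementary theory of weak Hopf algebras -/

section WeakHopfTheory

variable {H : Type*} [Ring H] [Algebra ℂ H] [WeakHopfAlgebra H]
variable {M : Type*} [AddCommGroup M] [Module ℂ M]

lemma Δ_eq_sum (x : H) : Δ H x = ∑ p ∈ sw x, p.1 ⊗ₜ[ℂ] p.2 := comul_eq_sum x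

lemma Δ_mul (x y : H) : Δ H (x * y) = Δ H x * Δ H y := WeakHopfAlgebra.comul_mul x y

lemma Δ_one_mul (x : H) : Δ H 1 * Δ H x = Δ H x := by rw [← Δ_mul, one_mul]

lemma Δ_mul_one (x : H) : Δ H x * Δ H 1 = Δ H x := by rw [← Δ_mul, mul_one]

lemma sum_sw_mul (B : H ⊗[ℂ] H →ₗ[ℂ] M) (x y : H) :
    ∑ p ∈ sw (x * y), B (p.1 ⊗ₜ p.2) =
      ∑ p ∈ sw x, ∑ q ∈ sw y, B ((p.1 * q.1) ⊗ₜ (p.2 * q.2)) := by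
  have h := congrArg B (Δ_mul x y)
  simp only [Δ_eq_sum, Finset.sum_mul, Finset.mul_sum, map_sum,
    Algebra.TensorProduct.tmul_mul_tmul] at h
  rw [h, Finset.sum_comm]

lemma Δ_one_left : ∑ q ∈ sw (1 : H), Δ H q.1 ⊗ₜ[ℂ] q.2 =
    ∑ q ∈ sw (1 : H), (Δ H 1 * ((1 : H) ⊗ₜ[ℂ] q.1)) ⊗ₜ[ℂ] q.2 := by
  have h := WeakHopfAlgebra.comul_one_left (H := H)
  simp only [comul_eq_sum, map_sum, TensorProduct.map_tmul, LinearMap.id_apply,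
    TensorProduct.sum_tmul, TensorProduct.tmul_sum, Finset.sum_mul, Finset.mul_sum,
    Algebra.TensorProduct.tmul_mul_tmul, TensorProduct.assoc_symm_tmul, mul_one, one_mul] at h
  simp only [Δ_eq_sum, TensorProduct.sum_tmul, Finset.sum_mul,
    Algebra.TensorProduct.tmul_mul_tmul, mul_one]
  exact h

lemma Δ_one_right : ∑ q ∈ sw (1 : H), Δ H q.1 ⊗ₜ[ℂ] q.2 =
    ∑ q ∈ sw (1 : H), (((1 : H) ⊗ₜ[ℂ] q.1) * Δ H 1) ⊗ₜ[ℂ] q.2 := by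
  have h := WeakHopfAlgebra.comul_one_right (H := H)
  simp only [comul_eq_sum, map_sum, TensorProduct.map_tmul, LinearMap.id_apply,
    TensorProduct.sum_tmul, TensorProduct.tmul_sum, Finset.sum_mul, Finset.mul_sum,
    Algebra.TensorProduct.tmul_mul_tmul, TensorProduct.assoc_symm_tmul, mul_one, one_mul] at h
  simp only [Δ_eq_sum, TensorProduct.sum_tmul, Finset.mul_sum,
    Algebra.TensorProduct.tmul_mul_tmul, one_mul]
  exact h.trans Finset.sum_comm

lemma epsL_eq_sum (x : H) : epsL x = ∑ q ∈ sw (1 : H), ε H (q.1 * x) • q.2 := by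
  rw [epsL, comul_eq_sum]
  simp [ε]

lemma epsR_eq_sum (x : H) : epsR x = ∑ q ∈ sw (1 : H), ε H (x * q.2) • q.1 := by
  rw [epsR, comul_eq_sum]
  simp [ε]

/-- Multiply the first two legs of (Δ ⊗ id)Δ(1) by Δ(x) from the right and apply ε to the second.
One form of the result collapses by the counit axiom, the other by Δ(1)Δ(x) = Δ(x). -/
lemma Δ_eq_sum_epsL_tail (x : H) :
    ∑ p ∈ sw x, p.1 ⊗ₜ[ℂ] epsL p.2 = ∑ q ∈ sw (1 : H), (q.1 * x) ⊗ₜ[ℂ] q.2 := by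
  let T : H ⊗[ℂ] H →ₗ[ℂ] H :=
    (TensorProduct.rid ℂ H).toLinearMap ∘ₗ (ε H).lTensor H ∘ₗ LinearMap.mulRight ℂ (Δ H x)
  have h := congrArg (T.rTensor H) (Δ_one_right (H := H))
  have h1 (y : H) : T (Δ H y) = y * x := by
    simp only [T, LinearMap.comp_apply, LinearMap.mulRight_apply, ← Δ_mul]
    have := Coalgebra.lTensor_counit_comul (R := ℂ) (y * x)
    simp [ε, Δ, this]
  have h2 (y : H) : T (((1 : H) ⊗ₜ[ℂ] y) * Δ H 1) = ∑ p ∈ sw x, ε H (y * p.2) • p.1 := by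
    simp only [T, LinearMap.comp_apply, LinearMap.mulRight_apply, mul_assoc, Δ_one_mul]
    simp [Δ_eq_sum, Finset.mul_sum]
  simp only [map_sum, LinearMap.rTensor_tmul, h1, h2] at h
  rw [h]
  simp only [epsL_eq_sum, TensorProduct.tmul_sum, TensorProduct.sum_tmul, TensorProduct.smul_tmul]
  exact Finset.sum_comm

lemma Δ_one_left' : ∑ q ∈ sw (1 : H), q.1 ⊗ₜ[ℂ] Δ H q.2 =
    ∑ q ∈ sw (1 : H), q.1 ⊗ₜ[ℂ] ((q.2 ⊗ₜ[ℂ] (1 : H)) * Δ H 1) := by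
  have h := congrArg (TensorProduct.assoc ℂ H H H) (Δ_one_left (H := H))
  have h' := sum_sw_assoc (LinearMap.id (R := ℂ) (M := H ⊗[ℂ] (H ⊗[ℂ] H))) (1 : H)
  simp only [Δ_eq_sum, TensorProduct.sum_tmul, TensorProduct.tmul_sum, Finset.mul_sum,
    Finset.sum_mul, map_sum, Algebra.TensorProduct.tmul_mul_tmul, TensorProduct.assoc_tmul,
    LinearMap.id_apply, mul_one, one_mul] at h h' ⊢
  rw [← h', h]
  exact Finset.sum_comm

lemma Δ_one_right' : ∑ q ∈ sw (1 : H), q.1 ⊗ₜ[ℂ] Δ H q.2 =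
    ∑ q ∈ sw (1 : H), q.1 ⊗ₜ[ℂ] (Δ H 1 * (q.2 ⊗ₜ[ℂ] (1 : H))) := by
  have h := congrArg (TensorProduct.assoc ℂ H H H) (Δ_one_right (H := H))
  have h' := sum_sw_assoc (LinearMap.id (R := ℂ) (M := H ⊗[ℂ] (H ⊗[ℂ] H))) (1 : H)
  simp only [Δ_eq_sum, TensorProduct.sum_tmul, TensorProduct.tmul_sum, Finset.mul_sum,
    Finset.sum_mul, map_sum, Algebra.TensorProduct.tmul_mul_tmul, TensorProduct.assoc_tmul,
    LinearMap.id_apply, mul_one, one_mul] at h h' ⊢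
  rw [← h', h]
  exact Finset.sum_comm

lemma Δ_eq_sum_epsR_head (x : H) :
    ∑ p ∈ sw x, epsR p.1 ⊗ₜ[ℂ] p.2 = ∑ q ∈ sw (1 : H), q.1 ⊗ₜ[ℂ] (x * q.2) := by
  let T : H ⊗[ℂ] H →ₗ[ℂ] H :=
    (TensorProduct.lid ℂ H).toLinearMap ∘ₗ (ε H).rTensor H ∘ₗ LinearMap.mulLeft ℂ (Δ H x)
  have h := congrArg (T.lTensor H) (Δ_one_right' (H := H))
  have h1 (y : H) : T (Δ H y) = x * y := by
    simp only [T, LinearMap.comp_apply, LinearMap.mulLeft_apply, ← Δ_mul]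
    have := Coalgebra.rTensor_counit_comul (R := ℂ) (x * y)
    simp [ε, Δ, this]
  have h2 (y : H) : T (Δ H 1 * (y ⊗ₜ[ℂ] (1 : H))) = ∑ p ∈ sw x, ε H (p.1 * y) • p.2 := by
    simp only [T, LinearMap.comp_apply, LinearMap.mulLeft_apply, ← mul_assoc, Δ_mul_one]
    simp [Δ_eq_sum, Finset.sum_mul]
  simp only [map_sum, LinearMap.lTensor_tmul, h1, h2] at h
  rw [h]
  simp only [epsR_eq_sum, TensorProduct.tmul_sum, TensorProduct.sum_tmul, TensorProduct.smul_tmul]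
  exact Finset.sum_comm

lemma counit_mul_eq_sum_left (x y z : H) :
    ε H (x * y * z) = ∑ p ∈ sw y, ε H (x * p.1) * ε H (p.2 * z) := by
  have := WeakHopfAlgebra.counit_mul_left x y z
  rw [comul_eq_sum, map_sum, map_sum] at this
  exact this

lemma counit_mul_eq_sum_right (x y z : H) :
    ε H (x * y * z) = ∑ p ∈ sw y, ε H (x * p.2) * ε H (p.1 * z) := by
  have := WeakHopfAlgebra.counit_mul_right x y z
  rw [comul_eq_sum, map_sum, map_sum] at this
  simp only [mul_comm (ε H (x * _))]
  exact this

variable (H) in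
/-- The left counital map as a linear map. -/
def eL : H →ₗ[ℂ] H := conv (Δ H) LinearMap.id (S H)

variable (H) in
/-- The right counital map as a linear map. -/
def eR : H →ₗ[ℂ] H := conv (Δ H) (S H) LinearMap.id

lemma eL_apply (x : H) : eL H x = epsL x := WeakHopfAlgebra.conv_id_antipode x

lemma eR_apply (x : H) : eR H x = epsR x := WeakHopfAlgebra.conv_antipode_id x

lemma eL_eq_sum (x : H) : eL H x = ∑ q ∈ sw (1 : H), ε H (q.1 * x) • q.2 := by
  rw [eL_apply, epsL_eq_sum]

lemma eR_eq_sum (x : H) : eR H x = ∑ q ∈ sw (1 : H), ε H (x * q.2) • q.1 := by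
  rw [eR_apply, epsR_eq_sum]

lemma sum_eL_tail (B : H ⊗[ℂ] H →ₗ[ℂ] M) (x : H) :
    ∑ p ∈ sw x, B (p.1 ⊗ₜ eL H p.2) = ∑ q ∈ sw (1 : H), B ((q.1 * x) ⊗ₜ q.2) := by
  simpa [eL_apply] using congrArg B (Δ_eq_sum_epsL_tail x)

lemma sum_eR_head (B : H ⊗[ℂ] H →ₗ[ℂ] M) (x : H) :
    ∑ p ∈ sw x, B (eR H p.1 ⊗ₜ p.2) = ∑ q ∈ sw (1 : H), B (q.1 ⊗ₜ (x * q.2)) := by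
  simpa [eR_apply] using congrArg B (Δ_eq_sum_epsR_head x)

lemma sum_mul_S (x : H) : ∑ p ∈ sw x, p.1 * S H p.2 = eL H x := by
  rw [eL, conv, LinearMap.comp_apply, LinearMap.comp_apply, Δ_eq_sum]
  simp

lemma sum_S_mul (x : H) : ∑ p ∈ sw x, S H p.1 * p.2 = eR H x := by
  rw [eR, conv, LinearMap.comp_apply, LinearMap.comp_apply, Δ_eq_sum]
  simp

lemma sum_S_mul_eL (x : H) : ∑ p ∈ sw x, S H p.1 * eL H p.2 = S H x := by
  have h := WeakHopfAlgebra.antipode_conv x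
  simp only [convAlong] at h
  rw [conv, LinearMap.comp_apply, LinearMap.comp_apply, comul_eq_sum, map_sum, map_sum] at h
  exact h

lemma sum_eR_mul_S (x : H) : ∑ p ∈ sw x, eR H p.1 * S H p.2 = S H x := by
  rw [← sum_S_mul_eL x]
  have h := sum_sw_assoc (LinearMap.mul' ℂ H ∘ₗ TensorProduct.map (S H)
    (LinearMap.mul' ℂ H ∘ₗ (S H).lTensor H)) x
  simp only [LinearMap.comp_apply, TensorProduct.map_tmul, LinearMap.lTensor_tmul,
    LinearMap.mul'_apply, ← Finset.mul_sum, sum_mul_S] at h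
  rw [← h]
  simp only [← mul_assoc, ← Finset.sum_mul, sum_S_mul]

/-- `1⁽¹⁾ ⊗ ε_R(1⁽²⁾) = 1⁽¹⁾ ⊗ S(1⁽²⁾)`. -/
lemma sum_one_eR (B : H ⊗[ℂ] H →ₗ[ℂ] M) :
    ∑ p ∈ sw (1 : H), B (p.1 ⊗ₜ eR H p.2) = ∑ p ∈ sw (1 : H), B (p.1 ⊗ₜ S H p.2) := by
  let D : H ⊗[ℂ] H →ₗ[ℂ] M := B ∘ₗ (LinearMap.mul' ℂ H ∘ₗ (S H).rTensor H).lTensor H ∘ₗ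
    (TensorProduct.assoc ℂ H H H).toLinearMap ∘ₗ (Δ H).rTensor H
  have hD (a b : H) : D (a ⊗ₜ b) = ∑ q ∈ sw a, B (q.1 ⊗ₜ (S H q.2 * b)) := by
    simp [D, Δ_eq_sum, TensorProduct.sum_tmul]
  have h1 (f : H →ₗ[ℂ] H) := sum_sw_assoc (B ∘ₗ (LinearMap.mul' ℂ H ∘ₗ
    TensorProduct.map (S H) f).lTensor H) (1 : H)
  simp only [LinearMap.comp_apply, LinearMap.lTensor_tmul, TensorProduct.map_tmul,
    LinearMap.mul'_apply] at h1
  -- At x = 1 the tail identity reads 1⁽¹⁾ ⊗ ε_L(1⁽²⁾) = Δ(1). Hence ε_L may be inserted on the last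
  -- leg of S(1⁽²⁾)1⁽³⁾, where S(x⁽¹⁾)ε_L(x⁽²⁾) = S(x) removes the product.
  have h2 := sum_eL_tail D (1 : H)
  simp only [hD, mul_one] at h2
  calc _ = ∑ p ∈ sw (1 : H), ∑ q ∈ sw p.2, B (p.1 ⊗ₜ (S H q.1 * q.2)) := by
        simp only [← sum_S_mul, TensorProduct.tmul_sum, map_sum]
    _ = ∑ p ∈ sw (1 : H), ∑ q ∈ sw p.2, B (p.1 ⊗ₜ (S H q.1 * eL H q.2)) :=
        (h1 LinearMap.id).symm.trans (h2.symm.trans (h1 (eL H)))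
    _ = _ := Finset.sum_congr rfl fun p _ => by
        rw [← sum_S_mul_eL p.2, TensorProduct.tmul_sum, map_sum]

/-- `ε_L(1⁽¹⁾) ⊗ 1⁽²⁾ = S(1⁽¹⁾) ⊗ 1⁽²⁾`. -/
lemma sum_one_eL (B : H ⊗[ℂ] H →ₗ[ℂ] M) :
    ∑ p ∈ sw (1 : H), B (eL H p.1 ⊗ₜ p.2) = ∑ p ∈ sw (1 : H), B (S H p.1 ⊗ₜ p.2) := by
  let D : H ⊗[ℂ] H →ₗ[ℂ] M := B ∘ₗ (LinearMap.mul' ℂ H ∘ₗ (S H).lTensor H).rTensor H ∘ₗ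
    (TensorProduct.assoc ℂ H H H).symm.toLinearMap ∘ₗ (Δ H).lTensor H
  have hD (a b : H) : D (a ⊗ₜ b) = ∑ q ∈ sw b, B ((a * S H q.1) ⊗ₜ q.2) := by
    simp [D, Δ_eq_sum, TensorProduct.tmul_sum]
  have h1 (f : H →ₗ[ℂ] H) := sum_sw_assoc (B ∘ₗ (LinearMap.mul' ℂ H ∘ₗ
    TensorProduct.map f (S H)).rTensor H ∘ₗ (TensorProduct.assoc ℂ H H H).symm.toLinearMap) (1 : H)
  simp only [LinearMap.comp_apply, LinearMap.rTensor_tmul, TensorProduct.map_tmul,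
    LinearMap.mul'_apply, LinearEquiv.coe_coe, TensorProduct.assoc_symm_tmul] at h1
  have h2 := sum_eR_head D (1 : H)
  simp only [hD, one_mul] at h2
  calc _ = ∑ p ∈ sw (1 : H), ∑ q ∈ sw p.1, B ((q.1 * S H q.2) ⊗ₜ p.2) := by
        simp only [← sum_mul_S, TensorProduct.sum_tmul, map_sum]
    _ = ∑ p ∈ sw (1 : H), ∑ q ∈ sw p.1, B ((eR H q.1 * S H q.2) ⊗ₜ p.2) :=
        (h1 LinearMap.id).trans (h2.symm.trans (h1 (eR H)).symm)
    _ = _ := Finset.sum_congr rfl fun p _ => by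
        rw [← sum_eR_mul_S p.1, TensorProduct.sum_tmul, map_sum]

lemma eR_mul (x y : H) : eR H (x * y) = ∑ p ∈ sw y, ε H (x * p.1) • eR H p.2 := by
  simp only [eR_eq_sum, counit_mul_eq_sum_left x y, Finset.smul_sum, Finset.sum_smul, mul_smul]
  exact Finset.sum_comm

lemma eL_mul (x y : H) : eL H (x * y) = ∑ p ∈ sw x, ε H (p.2 * y) • eL H p.1 := by
  simp only [eL_eq_sum, ← mul_assoc, counit_mul_eq_sum_left _ x y, Finset.smul_sum,
    Finset.sum_smul, mul_comm (ε H (_ * _)) (ε H (_ * y)), mul_smul]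
  exact Finset.sum_comm

/-- `x⁽¹⁾ ⊗ ε_R(x⁽²⁾) = x 1⁽¹⁾ ⊗ S(1⁽²⁾)`. -/
lemma sum_eR_tail (B : H ⊗[ℂ] H →ₗ[ℂ] M) (x : H) :
    ∑ p ∈ sw x, B (p.1 ⊗ₜ eR H p.2) = ∑ q ∈ sw (1 : H), B ((x * q.1) ⊗ₜ S H q.2) := by
  -- Writing x as x·1 lets weak multiplicativity of ε push ε_R onto the legs of Δ(1).
  -- Coassociativity of Δ(1) and the counit then reassemble x 1⁽¹⁾.
  have h1 := sum_sw_mul (B ∘ₗ (eR H).lTensor H) x 1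
  simp only [LinearMap.comp_apply, LinearMap.lTensor_tmul, mul_one] at h1
  have h2 (p : H × H) := sum_sw_assoc (B ∘ₗ TensorProduct.map (LinearMap.mulLeft ℂ p.1)
    ((TensorProduct.lid ℂ H).toLinearMap ∘ₗ
      TensorProduct.map (ε H ∘ₗ LinearMap.mulLeft ℂ p.2) (eR H))) (1 : H)
  simp only [LinearMap.comp_apply, TensorProduct.map_tmul, LinearMap.mulLeft_apply,
    LinearEquiv.coe_coe, TensorProduct.lid_tmul] at h2
  have h3 (y : H) : ∑ p ∈ sw x, ∑ r ∈ sw y, ε H (p.2 * r.2) • (p.1 * r.1) = x * y := by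
    have := sum_sw_mul ((TensorProduct.rid ℂ H).toLinearMap ∘ₗ (ε H).lTensor H) x y
    simp only [LinearMap.comp_apply, LinearMap.lTensor_tmul, LinearEquiv.coe_coe,
      TensorProduct.rid_tmul] at this
    exact this.symm.trans (sum_sw_counit_right (x * y))
  have h4 := sum_one_eR (B ∘ₗ (LinearMap.mulLeft ℂ x).rTensor H)
  simp only [LinearMap.comp_apply, LinearMap.rTensor_tmul, LinearMap.mulLeft_apply] at h4
  rw [h1, ← h4]
  simp only [eR_mul, TensorProduct.tmul_sum, map_sum, ← h3, TensorProduct.sum_tmul,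
    TensorProduct.tmul_smul, ← TensorProduct.smul_tmul'] at h2 ⊢
  simp only [← h2]
  exact Finset.sum_comm

/-- `ε_L(x⁽¹⁾) ⊗ x⁽²⁾ = S(1⁽¹⁾) ⊗ 1⁽²⁾ x`. -/
lemma sum_eL_head (B : H ⊗[ℂ] H →ₗ[ℂ] M) (x : H) :
    ∑ p ∈ sw x, B (eL H p.1 ⊗ₜ p.2) = ∑ q ∈ sw (1 : H), B (S H q.1 ⊗ₜ (q.2 * x)) := by
  have h1 := sum_sw_mul (B ∘ₗ (eL H).rTensor H) 1 x
  simp only [LinearMap.comp_apply, LinearMap.rTensor_tmul, one_mul] at h1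
  have h2 (p : H × H) := sum_sw_assoc (B ∘ₗ TensorProduct.map (eL H)
    ((TensorProduct.lid ℂ H).toLinearMap ∘ₗ
      TensorProduct.map (ε H ∘ₗ LinearMap.mulRight ℂ p.1) (LinearMap.mulRight ℂ p.2))) (1 : H)
  simp only [LinearMap.comp_apply, TensorProduct.map_tmul, LinearMap.mulRight_apply,
    LinearEquiv.coe_coe, TensorProduct.lid_tmul] at h2
  have h3 (y : H) : ∑ r ∈ sw y, ∑ p ∈ sw x, ε H (r.1 * p.1) • (r.2 * p.2) = y * x := by
    have := sum_sw_mul ((TensorProduct.lid ℂ H).toLinearMap ∘ₗ (ε H).rTensor H) y x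
    simp only [LinearMap.comp_apply, LinearMap.rTensor_tmul, LinearEquiv.coe_coe,
      TensorProduct.lid_tmul] at this
    exact this.symm.trans (sum_sw_counit_left (y * x))
  have h4 := sum_one_eL (B ∘ₗ (LinearMap.mulRight ℂ x).lTensor H)
  simp only [LinearMap.comp_apply, LinearMap.lTensor_tmul, LinearMap.mulRight_apply] at h4
  rw [h1, ← h4, Finset.sum_comm]
  simp only [eL_mul, TensorProduct.tmul_sum, map_sum, ← h3, TensorProduct.sum_tmul,
    TensorProduct.tmul_smul, ← TensorProduct.smul_tmul'] at h2 ⊢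
  simp only [h2]
  rw [Finset.sum_comm]
  exact Finset.sum_congr rfl fun _ _ => Finset.sum_comm

/-- The two factorizations of (id ⊗ Δ)Δ(1) differ by the order of the middle product; applying ε(•
x) and ε(y •) to the outer legs leaves exactly the two orders of ε_L(x) and ε_R(y). -/
lemma eL_mul_eR_comm (x y : H) : eL H x * eR H y = eR H y * eL H x := by
  have h := (Δ_one_left' (H := H)).symm.trans Δ_one_right'
  have h1 := congrArg ((TensorProduct.lid ℂ H).toLinearMap ∘ₗ
    TensorProduct.map (ε H ∘ₗ LinearMap.mulRight ℂ x) ((TensorProduct.rid ℂ H).toLinearMap ∘ₗ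
      (ε H ∘ₗ LinearMap.mulLeft ℂ y).lTensor H)) h
  simp only [Δ_eq_sum, Finset.sum_mul, Finset.mul_sum, map_sum, LinearMap.comp_apply,
    TensorProduct.map_tmul, LinearMap.lTensor_tmul, Algebra.TensorProduct.tmul_mul_tmul, one_mul,
    mul_one, LinearMap.mulRight_apply, LinearMap.mulLeft_apply, LinearEquiv.coe_coe,
    TensorProduct.lid_tmul, TensorProduct.rid_tmul, TensorProduct.tmul_sum] at h1
  simp only [eL_eq_sum x, eR_eq_sum y, Finset.sum_mul, Finset.mul_sum, smul_mul_assoc,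
    mul_smul_comm, Finset.smul_sum] at h1 ⊢
  rw [← h1, Finset.sum_comm]
  exact Finset.sum_congr rfl fun _ _ => Finset.sum_congr rfl fun _ _ => smul_comm _ _ _

lemma eR_one : eR H 1 = 1 := by
  rw [eR_eq_sum]
  simp only [one_mul]
  exact sum_sw_counit_right (1 : H)

lemma S_one : S H 1 = 1 := by
  have h := sum_eL_tail (LinearMap.mul' ℂ H ∘ₗ (S H).rTensor H) (1 : H)
  simp only [LinearMap.comp_apply, LinearMap.rTensor_tmul, LinearMap.mul'_apply, mul_one,
    sum_S_mul_eL, sum_S_mul, eR_one] at h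
  exact h

lemma Δ_eL (x : H) : Δ H (eL H x) = Δ H 1 * (eL H x ⊗ₜ[ℂ] (1 : H)) := by
  have h := congrArg ((TensorProduct.lid ℂ (H ⊗[ℂ] H)).toLinearMap ∘ₗ
    (ε H ∘ₗ LinearMap.mulRight ℂ x).rTensor (H ⊗[ℂ] H)) (Δ_one_right' (H := H))
  simp only [map_sum, LinearMap.comp_apply, LinearMap.rTensor_tmul, LinearMap.mulRight_apply,
    LinearEquiv.coe_coe, TensorProduct.lid_tmul] at h
  rw [eL_eq_sum, map_sum, TensorProduct.sum_tmul, Finset.mul_sum]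
  simpa only [map_smul, ← TensorProduct.smul_tmul', mul_smul_comm] using h

lemma Δ_eR (x : H) : Δ H (eR H x) = ((1 : H) ⊗ₜ[ℂ] eR H x) * Δ H 1 := by
  have h := congrArg ((TensorProduct.rid ℂ (H ⊗[ℂ] H)).toLinearMap ∘ₗ
    (ε H ∘ₗ LinearMap.mulLeft ℂ x).lTensor (H ⊗[ℂ] H)) (Δ_one_right (H := H))
  simp only [map_sum, LinearMap.comp_apply, LinearMap.lTensor_tmul, LinearMap.mulLeft_apply,
    LinearEquiv.coe_coe, TensorProduct.rid_tmul] at h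
  rw [eR_eq_sum, map_sum, TensorProduct.tmul_sum, Finset.sum_mul]
  simpa only [map_smul, TensorProduct.tmul_smul, smul_mul_assoc] using h

lemma counit_mul_eL (x y : H) : ε H (x * eL H y) = ε H (x * y) := by
  have := counit_mul_eq_sum_right x 1 y
  rw [mul_one] at this
  rw [this, eL_eq_sum, Finset.mul_sum, map_sum]
  exact Finset.sum_congr rfl fun p _ => by rw [mul_smul_comm, map_smul, smul_eq_mul, mul_comm]

lemma counit_eR_mul (x y : H) : ε H (eR H x * y) = ε H (x * y) := by
  have := counit_mul_eq_sum_right x 1 y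
  rw [mul_one] at this
  rw [this, eR_eq_sum, Finset.sum_mul, map_sum]
  exact Finset.sum_congr rfl fun p _ => by rw [smul_mul_assoc, map_smul, smul_eq_mul]

lemma eL_mul_eL (x y : H) : eL H (x * eL H y) = eL H (x * y) := by
  simp only [eL_eq_sum (x * _), ← mul_assoc, counit_mul_eL]

lemma eR_eR_mul (x y : H) : eR H (eR H x * y) = eR H (x * y) := by
  simp only [eR_eq_sum (_ * y), mul_assoc, counit_eR_mul]

end WeakHopfTheory

end WeakHopfCluster

namespace WeakHopfCluster

/-! ### The antipode reverses products and coproducts -/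

section Antipode

variable {H : Type*} [Ring H] [Algebra ℂ H] [WeakHopfAlgebra H]
variable {M : Type*} [AddCommGroup M] [Module ℂ M]
variable {A : Type*} [Ring A] [Algebra ℂ A]

/-- Uniqueness of generalized inverses. In the weak setting S is not a convolution inverse, since S
⋆ id and id ⋆ S are the counital maps, so both one-sided products have to be compared. -/
lemma eq_of_conv_inverse {R : Type*} [Semigroup R] {a b c : R} (hb : b * a * b = b)
    (hc : c * a * c = c) (h1 : b * a = c * a) (h2 : a * b = a * c) : b = c := by
  rw [← hb, h1, mul_assoc, h2, ← mul_assoc, hc]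

/-- The elements ε_L(y) satisfy Δ(x ε_L(y)) = Δ(x)(ε_L(y) ⊗ 1), so the inner factor is absorbed into
the first leg. -/
lemma sum_mul_eL_mul_S (x y : H) : ∑ p ∈ sw x, p.1 * eL H y * S H p.2 = eL H (x * y) := by
  have h : Δ H (x * eL H y) = Δ H x * (eL H y ⊗ₜ[ℂ] (1 : H)) := by
    rw [Δ_mul, Δ_eL, ← mul_assoc, Δ_mul_one]
  have h1 := congrArg (LinearMap.mul' ℂ H ∘ₗ (S H).lTensor H) h
  simp only [Δ_eq_sum, Finset.sum_mul, map_sum, LinearMap.comp_apply, LinearMap.lTensor_tmul,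
    Algebra.TensorProduct.tmul_mul_tmul, LinearMap.mul'_apply, mul_one, sum_mul_S] at h1
  rw [← h1, eL_mul_eL]

lemma sum_S_mul_eR_mul (x y : H) : ∑ p ∈ sw y, S H p.1 * (eR H x * p.2) = eR H (x * y) := by
  have h : Δ H (eR H x * y) = ((1 : H) ⊗ₜ[ℂ] eR H x) * Δ H y := by
    rw [Δ_mul, Δ_eR, mul_assoc, Δ_one_mul]
  have h1 := congrArg (LinearMap.mul' ℂ H ∘ₗ (S H).rTensor H) h
  simp only [Δ_eq_sum, Finset.mul_sum, map_sum, LinearMap.comp_apply, LinearMap.rTensor_tmul,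
    Algebra.TensorProduct.tmul_mul_tmul, LinearMap.mul'_apply, one_mul, sum_S_mul] at h1
  rw [← h1, eR_eR_mul]

/-- S(x⁽¹⁾)x⁽²⁾ contracts to ε_R(x⁽¹⁾), past which z can be moved to the left; then ε_R(x⁽¹⁾)S(x⁽²⁾)
= S(x). -/
lemma sum_S_mul_mul_S (x : H) (z : H) (hz : ∀ y, eR H y * z = z * eR H y) :
    ∑ p ∈ sw x, S H p.1 * ∑ q ∈ sw p.2, q.1 * z * S H q.2 = z * S H x := by
  have h := sum_sw_assoc (LinearMap.mul' ℂ H ∘ₗ TensorProduct.map (S H)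
    (LinearMap.mul' ℂ H ∘ₗ TensorProduct.map (LinearMap.mulRight ℂ z) (S H))) x
  simp only [LinearMap.comp_apply, TensorProduct.map_tmul, LinearMap.mul'_apply,
    LinearMap.mulRight_apply, ← mul_assoc, ← Finset.sum_mul, sum_S_mul, hz] at h
  simp only [Finset.mul_sum, ← mul_assoc, ← h]
  simp only [mul_assoc, ← Finset.mul_sum, sum_eR_mul_S]

lemma convMul_tmul_apply (f g : WithConv (H ⊗[ℂ] H →ₗ[ℂ] A)) (x y : H) :
    (f * g) (x ⊗ₜ y) = ∑ p ∈ sw x, ∑ q ∈ sw y, f (p.1 ⊗ₜ q.1) * g (p.2 ⊗ₜ q.2) := by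
  rw [LinearMap.convMul_apply, TensorProduct.comul_tmul, comul_eq_sum x, comul_eq_sum y]
  simp only [TensorProduct.sum_tmul, TensorProduct.tmul_sum, map_sum]
  rw [Finset.sum_comm]
  simp

/-- The antipode is an algebra antihomomorphism. -/
lemma S_mul (x y : H) : S H (x * y) = S H y * S H x := by
  let a : WithConv (H ⊗[ℂ] H →ₗ[ℂ] H) := toConv (LinearMap.mul' ℂ H)
  let b : WithConv (H ⊗[ℂ] H →ₗ[ℂ] H) := toConv (S H ∘ₗ LinearMap.mul' ℂ H)
  let c : WithConv (H ⊗[ℂ] H →ₗ[ℂ] H) := toConv (LinearMap.mul' ℂ H ∘ₗ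
    (TensorProduct.comm ℂ H H).toLinearMap ∘ₗ TensorProduct.map (S H) (S H))
  have ha (x y : H) : a (x ⊗ₜ y) = x * y := rfl
  have hb (x y : H) : b (x ⊗ₜ y) = S H (x * y) := rfl
  have hc (x y : H) : c (x ⊗ₜ y) = S H y * S H x := rfl
  have hba (x y : H) : (b * a) (x ⊗ₜ y) = eR H (x * y) := by
    have := sum_sw_mul (LinearMap.mul' ℂ H ∘ₗ (S H).rTensor H) x y
    simp only [LinearMap.comp_apply, LinearMap.rTensor_tmul, LinearMap.mul'_apply,
      sum_S_mul] at this
    rw [convMul_tmul_apply, this]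
    simp only [ha, hb]
  have hab (x y : H) : (a * b) (x ⊗ₜ y) = eL H (x * y) := by
    have := sum_sw_mul (LinearMap.mul' ℂ H ∘ₗ (S H).lTensor H) x y
    simp only [LinearMap.comp_apply, LinearMap.lTensor_tmul, LinearMap.mul'_apply,
      sum_mul_S] at this
    rw [convMul_tmul_apply, this]
    simp only [ha, hb]
  have hca (x y : H) : (c * a) (x ⊗ₜ y) = eR H (x * y) := by
    rw [convMul_tmul_apply, ← sum_S_mul_eR_mul, Finset.sum_comm]
    simp only [ha, hc, ← sum_S_mul x, Finset.sum_mul, Finset.mul_sum, mul_assoc]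
  have hac (x y : H) : (a * c) (x ⊗ₜ y) = eL H (x * y) := by
    rw [convMul_tmul_apply, ← sum_mul_eL_mul_S]
    simp only [ha, hc, ← sum_mul_S y, Finset.sum_mul, Finset.mul_sum, mul_assoc]
  -- S∘μ and μ∘τ∘(S ⊗ S), with τ the flip, are both generalized inverses of the multiplication μ in
  -- Hom(H ⊗ H, H), with common one-sided products ε_R∘μ and ε_L∘μ.
  have key : b = c := by
    apply eq_of_conv_inverse (a := a)
    · rw [mul_assoc]
      ext x y
      change (b * (a * b)) (x ⊗ₜ y) = b (x ⊗ₜ y)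
      have := sum_sw_mul (LinearMap.mul' ℂ H ∘ₗ TensorProduct.map (S H) (eL H)) x y
      simp only [LinearMap.comp_apply, TensorProduct.map_tmul, LinearMap.mul'_apply,
        sum_S_mul_eL] at this
      rw [convMul_tmul_apply, hb, this]
      simp only [hab, hb]
    · rw [mul_assoc]
      ext x y
      change (c * (a * c)) (x ⊗ₜ y) = c (x ⊗ₜ y)
      rw [convMul_tmul_apply, Finset.sum_comm]
      simp only [hac, hc, ← sum_mul_eL_mul_S, mul_assoc, ← Finset.mul_sum]
      have h1 (q : H) := sum_S_mul_mul_S x (eL H q) fun y => (eL_mul_eR_comm q y).symm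
      simp only [mul_assoc] at h1
      simp only [h1]
      rw [← sum_S_mul_eL y]
      simp only [Finset.sum_mul, mul_assoc]
    · ext x y
      exact (hba x y).trans (hca x y).symm
    · ext x y
      exact (hab x y).trans (hac x y).symm
  exact congrArg (fun f : WithConv (H ⊗[ℂ] H →ₗ[ℂ] H) => f (x ⊗ₜ y)) key

/-- `S(1⁽²⁾) ⊗ S(1⁽¹⁾) = 1⁽¹⁾ ⊗ 1⁽²⁾`. -/
lemma sum_S_one : ∑ p ∈ sw (1 : H), S H p.2 ⊗ₜ[ℂ] S H p.1 = Δ H 1 := by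
  -- On Δ(1) the antipodes may be replaced by counital maps, giving ε_R(1⁽²⁾) ⊗ ε_L(1⁽¹⁾). When both
  -- are expanded over further copies of Δ(1), weak multiplicativity of ε removes the original copy
  -- and 1⁽¹⁾ ⊗ ε_L(1⁽²⁾) remains.
  have h1 := sum_one_eL ((TensorProduct.comm ℂ H H).toLinearMap ∘ₗ (S H).lTensor H)
  have h2 := sum_one_eR ((TensorProduct.comm ℂ H H).toLinearMap ∘ₗ (eL H).rTensor H)
  have h3 := sum_eL_tail (LinearMap.id (R := ℂ) (M := H ⊗[ℂ] H)) 1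
  simp only [LinearMap.comp_apply, LinearMap.lTensor_tmul, LinearMap.rTensor_tmul,
    LinearEquiv.coe_coe, TensorProduct.comm_tmul, LinearMap.id_apply, mul_one] at h1 h2 h3
  rw [← h1, ← h2, Δ_eq_sum, ← h3]
  have h4 (u q : H × H) : ∑ p ∈ sw (1 : H), ε H (p.2 * u.2) • ε H (q.1 * p.1) =
      ε H (q.1 * u.2) := by
    have := counit_mul_eq_sum_left q.1 1 u.2
    rw [mul_one] at this
    rw [this]
    exact Finset.sum_congr rfl fun _ _ => by rw [smul_eq_mul, mul_comm]
  have h5 (p : H × H) : eR H p.2 ⊗ₜ[ℂ] eL H p.1 = ∑ u ∈ sw (1 : H), ∑ q ∈ sw (1 : H),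
      (ε H (p.2 * u.2) • ε H (q.1 * p.1)) • u.1 ⊗ₜ[ℂ] q.2 := by
    simp only [eR_eq_sum, eL_eq_sum, TensorProduct.tmul_sum, TensorProduct.sum_tmul,
      TensorProduct.smul_tmul_smul, smul_eq_mul]
    exact Finset.sum_comm
  have h6 (u : H × H) : u.1 ⊗ₜ[ℂ] eL H u.2 = ∑ q ∈ sw (1 : H), ∑ p ∈ sw (1 : H),
      (ε H (p.2 * u.2) • ε H (q.1 * p.1)) • u.1 ⊗ₜ[ℂ] q.2 := by
    simp only [eL_eq_sum, TensorProduct.tmul_sum, TensorProduct.tmul_smul, ← h4, Finset.sum_smul]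
  simp only [h5, h6]
  rw [Finset.sum_comm]
  exact Finset.sum_congr rfl fun _ _ => Finset.sum_comm

/-- Both sides are generalized inverses of Δ in Hom(H, H ⊗ H). To multiply them, Δ is factored as j₁
⋆ j₂ through the two embeddings of H, and the flipped (S ⊗ S)Δ as k₂ ⋆ k₁. -/
lemma Δ_S (x : H) : Δ H (S H x) = ∑ p ∈ sw x, S H p.2 ⊗ₜ[ℂ] S H p.1 := by
  let i₁ : H →ₐ[ℂ] H ⊗[ℂ] H := Algebra.TensorProduct.includeLeft
  let i₂ : H →ₐ[ℂ] H ⊗[ℂ] H := Algebra.TensorProduct.includeRight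
  have e (x y : H) : x ⊗ₜ[ℂ] y = i₁ x * i₂ y := by simp [i₁, i₂]
  have e' (x y : H) : x ⊗ₜ[ℂ] y = i₂ y * i₁ x := by simp [i₁, i₂]
  let a : WithConv (H →ₗ[ℂ] H ⊗[ℂ] H) := toConv (Δ H)
  let b : WithConv (H →ₗ[ℂ] H ⊗[ℂ] H) := toConv (Δ H ∘ₗ S H)
  let j₁ : WithConv (H →ₗ[ℂ] H ⊗[ℂ] H) := toConv i₁.toLinearMap
  let j₂ : WithConv (H →ₗ[ℂ] H ⊗[ℂ] H) := toConv i₂.toLinearMap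
  let k₁ : WithConv (H →ₗ[ℂ] H ⊗[ℂ] H) := toConv (i₁.toLinearMap ∘ₗ S H)
  let k₂ : WithConv (H →ₗ[ℂ] H ⊗[ℂ] H) := toConv (i₂.toLinearMap ∘ₗ S H)
  have aeq : a = j₁ * j₂ := by
    ext x
    rw [convMul_eq_sum]
    exact (Δ_eq_sum x).trans (Finset.sum_congr rfl fun _ _ => e _ _)
  have hab (x : H) : (a * b) x = Δ H (eL H x) := by
    rw [convMul_eq_sum, ← sum_mul_S, map_sum]
    exact Finset.sum_congr rfl fun _ _ => (Δ_mul _ _).symm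
  have hba (x : H) : (b * a) x = Δ H (eR H x) := by
    rw [convMul_eq_sum, ← sum_S_mul, map_sum]
    exact Finset.sum_congr rfl fun _ _ => (Δ_mul _ _).symm
  have jk₂ (x : H) : (j₂ * k₂) x = i₂ (eL H x) := by
    rw [convMul_eq_sum, ← sum_mul_S, map_sum]
    exact Finset.sum_congr rfl fun _ _ => (map_mul i₂ _ _).symm
  have jk₁ (x : H) : (j₁ * k₁) x = i₁ (eL H x) := by
    rw [convMul_eq_sum, ← sum_mul_S, map_sum]
    exact Finset.sum_congr rfl fun _ _ => (map_mul i₁ _ _).symm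
  have kj₁ (x : H) : (k₁ * j₁) x = i₁ (eR H x) := by
    rw [convMul_eq_sum, ← sum_S_mul, map_sum]
    exact Finset.sum_congr rfl fun _ _ => (map_mul i₁ _ _).symm
  have kj₂ (x : H) : (k₂ * j₂) x = i₂ (eR H x) := by
    rw [convMul_eq_sum, ← sum_S_mul, map_sum]
    exact Finset.sum_congr rfl fun _ _ => (map_mul i₂ _ _).symm
  -- In a Hopf algebra j₂ ⋆ k₂ would be the unit. Here x⁽¹⁾ ⊗ ε_L(x⁽²⁾) = 1⁽¹⁾x ⊗ 1⁽²⁾ leaves the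
  -- constant Δ(1).
  have h1 : j₁ * (j₂ * k₂) = cst (Δ H 1) * j₁ := by
    ext x
    rw [cst_mul_apply, convMul_eq_sum]
    have := sum_eL_tail (LinearMap.id (R := ℂ) (M := H ⊗[ℂ] H)) x
    simp only [LinearMap.id_apply] at this
    change ∑ p ∈ sw x, i₁ p.1 * (j₂ * k₂) p.2 = Δ H 1 * i₁ x
    simp only [jk₂, ← e, this]
    simp [Δ_eq_sum, Finset.sum_mul, i₁]
  have h2 : (k₁ * j₁) * j₂ = j₂ * cst (Δ H 1) := by
    ext x
    rw [mul_cst_apply, convMul_eq_sum]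
    have := sum_eR_head (LinearMap.id (R := ℂ) (M := H ⊗[ℂ] H)) x
    simp only [LinearMap.id_apply] at this
    change ∑ p ∈ sw x, (k₁ * j₁) p.1 * i₂ p.2 = i₂ x * Δ H 1
    simp only [kj₁, ← e, this]
    simp [Δ_eq_sum, Finset.mul_sum, i₂]
  have hac (x : H) : (a * (k₂ * k₁)) x = Δ H (eL H x) := by
    have : a * (k₂ * k₁) = j₁ * (j₂ * k₂) * k₁ := by rw [aeq]; simp only [mul_assoc]
    rw [this, h1, mul_assoc, cst_mul_apply, jk₁, Δ_eL]
    rfl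
  have hca (x : H) : (k₂ * k₁ * a) x = Δ H (eR H x) := by
    have : k₂ * k₁ * a = k₂ * ((k₁ * j₁) * j₂) := by rw [aeq]; simp only [mul_assoc]
    rw [this, h2, ← mul_assoc, mul_cst_apply, kj₂, Δ_eR]
    rfl
  have hc (x : H) : (k₂ * k₁) x = ∑ p ∈ sw x, S H p.2 ⊗ₜ[ℂ] S H p.1 := by
    rw [convMul_eq_sum]
    exact Finset.sum_congr rfl fun _ _ => (e' _ _).symm
  -- Since Δ(1) = S(1⁽²⁾) ⊗ S(1⁽¹⁾) and S reverses products, this is Δ(x·1) = Δ(x)Δ(1) seen through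
  -- the flipped S ⊗ S.
  have hc' : cst (Δ H 1) * (k₂ * k₁) = k₂ * k₁ := by
    ext x
    rw [cst_mul_apply, hc]
    conv_lhs => rw [← sum_S_one]
    have := sum_sw_mul ((TensorProduct.comm ℂ H H).toLinearMap ∘ₗ TensorProduct.map (S H) (S H)) x 1
    simp only [LinearMap.comp_apply, TensorProduct.map_tmul, LinearEquiv.coe_coe,
      TensorProduct.comm_tmul, S_mul, mul_one] at this
    conv_rhs => rw [this]
    simp only [Finset.sum_mul, Finset.mul_sum, Algebra.TensorProduct.tmul_mul_tmul]
  have key : b = k₂ * k₁ := by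
    apply eq_of_conv_inverse (a := a)
    · rw [mul_assoc]
      ext x
      rw [convMul_eq_sum]
      simp only [hab]
      change ∑ p ∈ sw x, Δ H (S H p.1) * Δ H (eL H p.2) = Δ H (S H x)
      simp only [← Δ_mul, ← map_sum, sum_S_mul_eL]
    · have h3 : k₂ * k₁ * a = k₂ * j₂ * cst (Δ H 1) := by
        rw [aeq, mul_assoc k₂, ← mul_assoc k₁, h2, mul_assoc]
      rw [h3, mul_assoc, hc', ← mul_assoc]
      congr 1
      ext x
      rw [convMul_eq_sum]
      simp only [kj₂]
      change ∑ p ∈ sw x, i₂ (eR H p.1) * i₂ (S H p.2) = i₂ (S H x)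
      simp only [← map_mul, ← map_sum, sum_eR_mul_S]
    · ext x
      exact (hba x).trans (hca x).symm
    · ext x
      exact (hab x).trans (hac x).symm
  rw [← hc, ← key]
  rfl

lemma sum_sw_S (B : H ⊗[ℂ] H →ₗ[ℂ] M) (x : H) :
    ∑ p ∈ sw (S H x), B (p.1 ⊗ₜ p.2) = ∑ p ∈ sw x, B (S H p.2 ⊗ₜ S H p.1) := by
  have := congrArg B (Δ_S x)
  simpa [Δ_eq_sum] using this

end Antipode

end WeakHopfCluster

namespace WeakHopfCluster

/-! ### The dual coalgebra and dual bases -/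

section DualCoalgebra

variable {H : Type*} [Ring H] [Algebra ℂ H]
variable {M : Type*} [AddCommGroup M] [Module ℂ M]

/-- `k ↦ ψ(k •)`. -/
def lact (ψ : Module.Dual ℂ H) : H →ₗ[ℂ] Module.Dual ℂ H := (LinearMap.mul ℂ H).compr₂ ψ

/-- `k ↦ ψ(• k)`. -/
def ract (ψ : Module.Dual ℂ H) : H →ₗ[ℂ] Module.Dual ℂ H := (LinearMap.mul ℂ H).flip.compr₂ ψ

lemma lact_apply (ψ : Module.Dual ℂ H) (k x : H) : lact ψ k x = ψ (k * x) := rfl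

lemma ract_apply (ψ : Module.Dual ℂ H) (k x : H) : ract ψ k x = ψ (x * k) := rfl

lemma lact_lact (ψ : Module.Dual ℂ H) (k l : H) : lact (lact ψ k) l = lact ψ (k * l) := by
  ext x; simp only [lact_apply, mul_assoc]

lemma ract_ract (ψ : Module.Dual ℂ H) (k l : H) : ract (ract ψ k) l = ract ψ (l * k) := by
  ext x; simp only [ract_apply, mul_assoc]

lemma lact_ract (ψ : Module.Dual ℂ H) (k l : H) : lact (ract ψ k) l = ract (lact ψ l) k := by
  ext x; simp only [ract_apply, lact_apply, mul_assoc]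

lemma lact_one (ψ : Module.Dual ℂ H) : lact ψ 1 = ψ := by
  ext x; rw [lact_apply, one_mul]

lemma ract_one (ψ : Module.Dual ℂ H) : ract ψ 1 = ψ := by
  ext x; rw [ract_apply, mul_one]

variable [FiniteDimensional ℂ H]

variable (H) in
/-- A basis of `H`. -/
abbrev bas : Module.Basis (Fin (Module.finrank ℂ H)) ℂ H := Module.finBasis ℂ H

lemma sum_coord (ψ : Module.Dual ℂ H) : ∑ i, ψ (bas H i) • (bas H).coord i = ψ := by
  refine (bas H).ext fun j => ?_
  simp

/-- Canonical-element calculus: a map on the basis leg is its transpose on the dual leg. -/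
lemma sum_coord_comp (B : Module.Dual ℂ H ⊗[ℂ] H →ₗ[ℂ] M) (T : H →ₗ[ℂ] H) :
    ∑ i, B (((bas H).coord i ∘ₗ T) ⊗ₜ bas H i) = ∑ i, B ((bas H).coord i ⊗ₜ T (bas H i)) := by
  have h (i) : (bas H).coord i ∘ₗ T = ∑ j, (bas H).coord i (T (bas H j)) • (bas H).coord j :=
    (sum_coord ((bas H).coord i ∘ₗ T)).symm
  simp only [h, TensorProduct.sum_tmul, map_sum]
  rw [Finset.sum_comm]
  refine Finset.sum_congr rfl fun j _ => ?_
  conv_rhs => rw [← (bas H).sum_repr (T (bas H j))]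
  simp only [TensorProduct.tmul_sum, map_sum, Module.Basis.coord_apply,
    TensorProduct.smul_tmul]

lemma dualDistribEquiv_apply_tmul (φ ψ : Module.Dual ℂ H) (x y : H) :
    TensorProduct.dualDistribEquiv ℂ H H (φ ⊗ₜ ψ) (x ⊗ₜ y) = φ x * ψ y := rfl

lemma dualΔ_eq_sum_lact (ψ : Module.Dual ℂ H) :
    dualΔ H ψ = ∑ i, (bas H).coord i ⊗ₜ[ℂ] lact ψ (bas H i) := by
  rw [dualΔ, LinearMap.comp_apply, LinearEquiv.coe_coe, LinearEquiv.symm_apply_eq, map_sum]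
  ext x y
  simp only [TensorProduct.AlgebraTensorModule.curry_apply, LinearMap.restrictScalars_self,
    TensorProduct.curry_apply, LinearMap.sum_apply, dualDistribEquiv_apply_tmul]
  change ψ (x * y) = _
  conv_lhs => rw [← (bas H).sum_repr x]
  simp only [Finset.sum_mul, lact_apply, map_sum, smul_mul_assoc, map_smul, smul_eq_mul,
    Module.Basis.coord_apply]

lemma dualΔ_eq_sum_ract (ψ : Module.Dual ℂ H) :
    dualΔ H ψ = ∑ i, ract ψ (bas H i) ⊗ₜ[ℂ] (bas H).coord i := by
  rw [dualΔ, LinearMap.comp_apply, LinearEquiv.coe_coe, LinearEquiv.symm_apply_eq, map_sum]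
  ext x y
  simp only [TensorProduct.AlgebraTensorModule.curry_apply, LinearMap.restrictScalars_self,
    TensorProduct.curry_apply, LinearMap.sum_apply, dualDistribEquiv_apply_tmul]
  change ψ (x * y) = _
  conv_lhs => rw [← (bas H).sum_repr y]
  simp only [Finset.mul_sum, ract_apply, map_sum, mul_smul_comm, map_smul, smul_eq_mul,
    Module.Basis.coord_apply, mul_comm]

variable (H) in
/-- The coalgebra dual to a finite-dimensional algebra. -/
instance dualCoalgebra : Coalgebra ℂ (Module.Dual ℂ H) where
  comul := dualΔ H
  counit := dualε H
  coassoc := by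
    ext1 ψ
    simp only [LinearMap.comp_apply, LinearEquiv.coe_coe]
    -- With the right expansion on one side and the left expansion on the other, coassociativity
    -- reduces to the commutation of left and right translations of ψ.
    conv_lhs => rw [dualΔ_eq_sum_ract ψ]
    conv_rhs => rw [dualΔ_eq_sum_lact ψ]
    simp only [map_sum, LinearMap.rTensor_tmul, LinearMap.lTensor_tmul]
    simp only [dualΔ_eq_sum_lact (ract _ _), dualΔ_eq_sum_ract (lact _ _),
      TensorProduct.sum_tmul, TensorProduct.tmul_sum, map_sum, TensorProduct.assoc_tmul, lact_ract]
    exact Finset.sum_comm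
  rTensor_counit_comp_comul := by
    ext1 ψ
    simp only [LinearMap.comp_apply, dualΔ_eq_sum_lact ψ, map_sum, LinearMap.rTensor_tmul]
    rw [← lact_one ψ]
    conv_rhs => rw [← (bas H).sum_repr 1]
    simp only [lact_lact, one_mul, map_sum, map_smul, TensorProduct.mk_apply,
      TensorProduct.smul_tmul']
    refine Finset.sum_congr rfl fun i _ => ?_
    simp [dualε]
  lTensor_counit_comp_comul := by
    ext1 ψ
    simp only [LinearMap.comp_apply, dualΔ_eq_sum_ract ψ, map_sum, LinearMap.lTensor_tmul]
    rw [← ract_one ψ]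
    conv_rhs => rw [← (bas H).sum_repr 1]
    simp only [ract_ract, mul_one, map_sum, map_smul, LinearMap.flip_apply, TensorProduct.mk_apply,
      ← TensorProduct.tmul_smul]
    refine Finset.sum_congr rfl fun i _ => ?_
    simp [dualε]

lemma sum_sw_dual_lact (B : Module.Dual ℂ H ⊗[ℂ] Module.Dual ℂ H →ₗ[ℂ] M) (ψ : Module.Dual ℂ H) :
    ∑ p ∈ sw ψ, B (p.1 ⊗ₜ p.2) = ∑ i, B ((bas H).coord i ⊗ₜ lact ψ (bas H i)) := by
  rw [sum_sw]
  exact (congrArg B (dualΔ_eq_sum_lact ψ)).trans (map_sum _ _ _)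

lemma sum_sw_dual_ract (B : Module.Dual ℂ H ⊗[ℂ] Module.Dual ℂ H →ₗ[ℂ] M) (ψ : Module.Dual ℂ H) :
    ∑ p ∈ sw ψ, B (p.1 ⊗ₜ p.2) = ∑ i, B (ract ψ (bas H i) ⊗ₜ (bas H).coord i) := by
  rw [sum_sw]
  exact (congrArg B (dualΔ_eq_sum_ract ψ)).trans (map_sum _ _ _)

end DualCoalgebra

section DualMul

variable {H : Type*} [Ring H] [Algebra ℂ H] [WeakHopfAlgebra H]
variable {M : Type*} [AddCommGroup M] [Module ℂ M]

lemma dualMul_apply (φ ψ : Module.Dual ℂ H) (x : H) :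
    dualMul φ ψ x = ∑ p ∈ sw x, φ p.1 * ψ p.2 := by
  change TensorProduct.dualDistrib ℂ H H (φ ⊗ₜ ψ) (Δ H x) = _
  simp [Δ_eq_sum]

variable [FiniteDimensional ℂ H]

/-- Comultiplying the basis leg of the canonical element is the same as taking two canonical
elements and multiplying their dual legs, because the product of Ĥ is dual to Δ. -/
lemma sum_coord_sw (T : Module.Dual ℂ H ⊗[ℂ] (H ⊗[ℂ] H) →ₗ[ℂ] M) :
    ∑ i, ∑ p ∈ sw (bas H i), T ((bas H).coord i ⊗ₜ (p.1 ⊗ₜ p.2)) =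
      ∑ i, ∑ j, T (dualMul ((bas H).coord i) ((bas H).coord j) ⊗ₜ (bas H i ⊗ₜ bas H j)) := by
  have h (i j) := (sum_coord (dualMul ((bas H).coord i) ((bas H).coord j))).symm
  have h1 (p : H × H) : p.1 ⊗ₜ[ℂ] p.2 = ∑ i, ∑ j,
      ((bas H).coord i p.1 * (bas H).coord j p.2) • (bas H i ⊗ₜ[ℂ] bas H j) := by
    conv_lhs => rw [← (bas H).sum_repr p.1, ← (bas H).sum_repr p.2]
    simp only [TensorProduct.sum_tmul, TensorProduct.tmul_sum, TensorProduct.smul_tmul_smul,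
      Module.Basis.coord_apply]
    exact Finset.sum_comm
  have h2 (k) : ∑ p ∈ sw (bas H k), p.1 ⊗ₜ[ℂ] p.2 = ∑ i, ∑ j,
      (dualMul ((bas H).coord i) ((bas H).coord j) (bas H k)) • (bas H i ⊗ₜ[ℂ] bas H j) := by
    simp only [h1, dualMul_apply, Finset.sum_smul]
    rw [Finset.sum_comm]
    exact Finset.sum_congr rfl fun _ _ => Finset.sum_comm
  simp only [← map_sum, ← TensorProduct.tmul_sum, h2]
  congr 1
  simp only [TensorProduct.tmul_sum]
  rw [Finset.sum_comm]
  refine Finset.sum_congr rfl fun i _ => ?_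
  rw [Finset.sum_comm]
  refine Finset.sum_congr rfl fun j _ => ?_
  conv_rhs => rw [h i j, TensorProduct.sum_tmul]
  simp only [TensorProduct.smul_tmul]

end DualMul

end WeakHopfCluster

namespace WeakHopfCluster

/-! ### Exchange relations between the generalized Pauli operators -/

section Pauli

variable {H : Type*} [Ring H] [Algebra ℂ H] [WeakHopfAlgebra H]

variable (H) in
/-- `ψ ↦ (x ↦ ∑ ψ(x⁽¹⁾) x⁽²⁾)`. -/
def Zs : Module.Dual ℂ H →ₗ[ℂ] Module.End ℂ H where
  toFun ψ := (TensorProduct.lid ℂ H).toLinearMap ∘ₗ TensorProduct.map ψ LinearMap.id ∘ₗ Δ H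
  map_add' ψ χ := by
    rw [TensorProduct.map_add_left, LinearMap.add_comp, LinearMap.comp_add]
  map_smul' c ψ := by
    rw [TensorProduct.map_smul_left, LinearMap.smul_comp, LinearMap.comp_smul]; rfl

lemma Zs_eq_sum (ψ : Module.Dual ℂ H) (x : H) : Zs H ψ x = ∑ p ∈ sw x, ψ p.1 • p.2 := by
  change TensorProduct.lid ℂ H (TensorProduct.map ψ LinearMap.id (Δ H x)) = _
  simp [Δ_eq_sum]

lemma Zr_eq_sum (ψ : Module.Dual ℂ H) (x : H) : Zr H ψ x = ∑ p ∈ sw x, ψ p.2 • p.1 := by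
  change TensorProduct.rid ℂ H (TensorProduct.map LinearMap.id ψ (Δ H x)) = _
  simp [Δ_eq_sum]

lemma Zl_eq_Zs (ψ : Module.Dual ℂ H) : Zl H ψ = Zs H (ψ ∘ₗ S H) := rfl

lemma Xr_apply (g x : H) : Xr H g x = g * x := rfl
lemma Xl_apply (g x : H) : Xl H g x = x * S H g := rfl
lemma Xt_apply (g x : H) : Xt H g x = x * g := rfl

lemma Xr_mul (g h : H) : Xr H (g * h) = Xr H g * Xr H h := by
  ext x; exact mul_assoc _ _ _

lemma Xt_mul (g h : H) : Xt H (g * h) = Xt H h * Xt H g := by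
  ext x; exact (mul_assoc _ _ _).symm

lemma Xl_mul (g h : H) : Xl H (g * h) = Xl H g * Xl H h := by
  ext x; simp [Xl_apply, S_mul, mul_assoc]

lemma Xr_one : Xr H 1 = 1 := by ext x; exact one_mul _
lemma Xt_one : Xt H 1 = 1 := by ext x; exact mul_one _
lemma Xl_one : Xl H 1 = 1 := by ext x; simp [Xl_apply, S_one]

lemma Xl_eq_Xt (g : H) : Xl H g = Xt H (S H g) := rfl

lemma Xr_commute_Xt (g h : H) : Commute (Xr H g) (Xt H h) := by
  ext x; exact (mul_assoc _ _ _).symm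

/-- Multiplicativity of Δ splits g between the leg that the functional reads and the leg that
survives. All exchange relations below have this source; `Zs` reads first legs and `Zr` second ones,
and an antipode in the multiplier reverses the two legs of g. -/
lemma Zs_mul_Xr (ψ : Module.Dual ℂ H) (g : H) :
    Zs H ψ * Xr H g = ∑ p ∈ sw g, Xr H p.2 * Zs H (lact ψ p.1) := by
  ext x
  have := sum_sw_mul ((TensorProduct.lid ℂ H).toLinearMap ∘ₗ ψ.rTensor H) g x
  simp only [LinearMap.comp_apply, LinearMap.rTensor_tmul, LinearEquiv.coe_coe,
    TensorProduct.lid_tmul] at this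
  simpa [Zs_eq_sum, Xr_apply, Finset.mul_sum, lact_apply] using this

lemma Zs_mul_Xt (ψ : Module.Dual ℂ H) (g : H) :
    Zs H ψ * Xt H g = ∑ p ∈ sw g, Xt H p.2 * Zs H (ract ψ p.1) := by
  ext x
  have := sum_sw_mul ((TensorProduct.lid ℂ H).toLinearMap ∘ₗ ψ.rTensor H) x g
  simp only [LinearMap.comp_apply, LinearMap.rTensor_tmul, LinearEquiv.coe_coe,
    TensorProduct.lid_tmul] at this
  simpa [Zs_eq_sum, Xt_apply, Finset.sum_mul, ract_apply] using this.trans Finset.sum_comm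

lemma Zr_mul_Xr (ψ : Module.Dual ℂ H) (g : H) :
    Zr H ψ * Xr H g = ∑ p ∈ sw g, Xr H p.1 * Zr H (lact ψ p.2) := by
  ext x
  have := sum_sw_mul ((TensorProduct.rid ℂ H).toLinearMap ∘ₗ ψ.lTensor H) g x
  simp only [LinearMap.comp_apply, LinearMap.lTensor_tmul, LinearEquiv.coe_coe,
    TensorProduct.rid_tmul] at this
  simpa [Zr_eq_sum, Xr_apply, Finset.mul_sum, lact_apply] using this

lemma Zr_mul_Xt (ψ : Module.Dual ℂ H) (g : H) :
    Zr H ψ * Xt H g = ∑ p ∈ sw g, Xt H p.1 * Zr H (ract ψ p.2) := by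
  ext x
  have := sum_sw_mul ((TensorProduct.rid ℂ H).toLinearMap ∘ₗ ψ.lTensor H) x g
  simp only [LinearMap.comp_apply, LinearMap.lTensor_tmul, LinearEquiv.coe_coe,
    TensorProduct.rid_tmul] at this
  simpa [Zr_eq_sum, Xt_apply, Finset.sum_mul, ract_apply] using this.trans Finset.sum_comm

lemma Zs_mul_Xl (ψ : Module.Dual ℂ H) (g : H) :
    Zs H ψ * Xl H g = ∑ p ∈ sw g, Xl H p.1 * Zs H (ract ψ (S H p.2)) := by
  have := sum_sw_S (LinearMap.mul' ℂ (Module.End ℂ H) ∘ₗ (TensorProduct.comm ℂ _ _).toLinearMap ∘ₗ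
    TensorProduct.map (Zs H ∘ₗ ract ψ) (Xt H)) g
  simpa only [Xl_eq_Xt, Zs_mul_Xt, LinearMap.comp_apply, TensorProduct.map_tmul,
    LinearEquiv.coe_coe, TensorProduct.comm_tmul, LinearMap.mul'_apply] using this

lemma Zr_mul_Xl (ψ : Module.Dual ℂ H) (g : H) :
    Zr H ψ * Xl H g = ∑ p ∈ sw g, Xl H p.2 * Zr H (ract ψ (S H p.1)) := by
  have := sum_sw_S (LinearMap.mul' ℂ (Module.End ℂ H) ∘ₗ
    TensorProduct.map (Xt H) (Zr H ∘ₗ ract ψ)) g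
  simpa only [Xl_eq_Xt, Zr_mul_Xt, LinearMap.comp_apply, TensorProduct.map_tmul,
    LinearMap.mul'_apply] using this

lemma ract_comp_S (ψ : Module.Dual ℂ H) (k : H) :
    ract (ψ ∘ₗ S H) k = lact ψ (S H k) ∘ₗ S H := by
  ext x; simp [ract_apply, lact_apply, S_mul]

lemma lact_comp_S (ψ : Module.Dual ℂ H) (k : H) :
    lact (ψ ∘ₗ S H) k = ract ψ (S H k) ∘ₗ S H := by
  ext x; simp [ract_apply, lact_apply, S_mul]

lemma Zl_mul_Xr (ψ : Module.Dual ℂ H) (g : H) :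
    Zl H ψ * Xr H g = ∑ p ∈ sw g, Xr H p.2 * Zl H (ract ψ (S H p.1)) := by
  simp only [Zl_eq_Zs, Zs_mul_Xr, lact_comp_S]

lemma Zl_mul_Xt (ψ : Module.Dual ℂ H) (g : H) :
    Zl H ψ * Xt H g = ∑ p ∈ sw g, Xt H p.2 * Zl H (lact ψ (S H p.1)) := by
  simp only [Zl_eq_Zs, Zs_mul_Xt, ract_comp_S]

lemma Zl_mul_Xl (ψ : Module.Dual ℂ H) (g : H) :
    Zl H ψ * Xl H g = ∑ p ∈ sw g, Xl H p.1 * Zl H (lact ψ (S H (S H p.2))) := by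
  simp only [Zl_eq_Zs, Zs_mul_Xl, ract_comp_S]

/-- The operator applied first consumes the first leg, so the order of the functionals is reversed.
This reversal fixes the order of the controls in `sum_Zs_sw`. -/
lemma Zs_mul_Zs (φ ψ : Module.Dual ℂ H) : Zs H φ * Zs H ψ = Zs H (dualMul ψ φ) := by
  ext x
  have := sum_sw_assoc ((TensorProduct.lid ℂ H).toLinearMap ∘ₗ TensorProduct.map ψ
    ((TensorProduct.lid ℂ H).toLinearMap ∘ₗ φ.rTensor H)) x
  simp only [LinearMap.comp_apply, TensorProduct.map_tmul, LinearMap.rTensor_tmul,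
    LinearEquiv.coe_coe, TensorProduct.lid_tmul] at this
  rw [Module.End.mul_apply, Zs_eq_sum ψ, map_sum]
  simp only [map_smul]
  simp only [Zs_eq_sum φ, Zs_eq_sum (dualMul ψ φ), dualMul_apply, Finset.sum_smul, mul_smul, Finset.smul_sum, this]

lemma Zr_mul_Zr (φ ψ : Module.Dual ℂ H) : Zr H φ * Zr H ψ = Zr H (dualMul φ ψ) := by
  ext x
  have := sum_sw_assoc ((TensorProduct.rid ℂ H).toLinearMap ∘ₗ TensorProduct.map LinearMap.id
    ((TensorProduct.rid ℂ ℂ).toLinearMap ∘ₗ TensorProduct.map φ ψ)) x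
  simp only [LinearMap.comp_apply, TensorProduct.map_tmul, LinearMap.id_apply,
    LinearEquiv.coe_coe, TensorProduct.rid_tmul] at this
  rw [Module.End.mul_apply, Zr_eq_sum ψ, map_sum]
  simp only [map_smul]
  simp only [Zr_eq_sum φ, Zr_eq_sum (dualMul φ ψ), dualMul_apply, Finset.sum_smul, Finset.smul_sum]
  simpa only [smul_eq_mul, mul_smul, mul_comm (φ _)] using this

lemma Zs_commute_Zr (φ ψ : Module.Dual ℂ H) : Commute (Zs H φ) (Zr H ψ) := by
  ext x
  have := sum_sw_assoc ((TensorProduct.lid ℂ H).toLinearMap ∘ₗ TensorProduct.map φ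
    ((TensorProduct.rid ℂ H).toLinearMap ∘ₗ ψ.lTensor H)) x
  simp only [LinearMap.comp_apply, TensorProduct.map_tmul, LinearMap.lTensor_tmul,
    LinearEquiv.coe_coe, TensorProduct.lid_tmul, TensorProduct.rid_tmul] at this
  have h1 : Zs H φ (Zr H ψ x) = ∑ p ∈ sw x, ∑ q ∈ sw p.1, φ q.1 • ψ p.2 • q.2 := by
    rw [Zr_eq_sum, map_sum]
    simp only [map_smul]
    simp only [Zs_eq_sum, Finset.smul_sum, smul_comm (φ _)]
  have h2 : Zr H ψ (Zs H φ x) = ∑ p ∈ sw x, ∑ q ∈ sw p.2, φ p.1 • ψ q.2 • q.1 := by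
    rw [Zs_eq_sum, map_sum]
    simp only [map_smul]
    simp only [Zr_eq_sum, Finset.smul_sum]
  exact h1.trans (this.trans h2.symm)

end Pauli

/-! ### Controlled operators -/

section Controlled

variable {H : Type*} [Ring H] [Algebra ℂ H] [WeakHopfAlgebra H] [FiniteDimensional ℂ H]
variable {A : Type*} [Ring A] [Algebra ℂ A]

/-- The operator `x ⊗ v ↦ ∑ x⁽²⁾ ⊗ f(x⁽¹⁾) v`, where the operators on the factor of `x` are
embedded through `ι`. -/
def ctrl (ι : Module.End ℂ H →ₐ[ℂ] A) (f : H →ₗ[ℂ] A) : A :=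
  ∑ i, ι (Zs H ((bas H).coord i)) * f (bas H i)

variable (ι : Module.End ℂ H →ₐ[ℂ] A)

/-- Convolution form of the operators embedded through `ι`. -/
abbrev emb {C : Type*} [AddCommGroup C] [Module ℂ C] (u : C →ₗ[ℂ] Module.End ℂ H) :
    WithConv (C →ₗ[ℂ] A) := toConv (ι.toLinearMap ∘ₗ u)

lemma emb_apply {C : Type*} [AddCommGroup C] [Module ℂ C] (u : C →ₗ[ℂ] Module.End ℂ H) (c : C) :
    emb ι u c = ι (u c) := rfl

variable {ι} {f : H →ₗ[ℂ] A}

/-- Reparametrizing the control can be done either on the functional or on the argument of f. With T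
= S it turns `Zs` into `Zl`; with T a translation it describes multiplication of the controlling
element. -/
lemma ctrl_comp (f : H →ₗ[ℂ] A) (T : H →ₗ[ℂ] H) (a : A) :
    ∑ i, ι (Zs H ((bas H).coord i ∘ₗ T)) * a * f (bas H i) =
      ∑ i, ι (Zs H ((bas H).coord i)) * a * f (T (bas H i)) := by
  have := sum_coord_comp (LinearMap.mul' ℂ A ∘ₗ
    TensorProduct.map (LinearMap.mulRight ℂ a ∘ₗ ι.toLinearMap ∘ₗ Zs H) f) T
  simpa using this

lemma ctrl_mul_Xr (hf : ∀ a x, Commute (ι a) (f x)) (g : H) :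
    ctrl ι f * ι (Xr H g) =
      ∑ p ∈ sw g, ι (Xr H p.2) * ctrl ι (f ∘ₗ LinearMap.mulLeft ℂ p.1) := by
  have h1 (i) : ι (Zs H ((bas H).coord i)) * f (bas H i) * ι (Xr H g) =
      ∑ p ∈ sw g, ι (Xr H p.2) *
        (ι (Zs H ((bas H).coord i ∘ₗ LinearMap.mulLeft ℂ p.1)) * f (bas H i)) := by
    rw [mul_assoc, ← (hf _ _).eq, ← mul_assoc, ← map_mul, Zs_mul_Xr, map_sum, Finset.sum_mul]
    exact Finset.sum_congr rfl fun p _ => by rw [map_mul, mul_assoc]; rfl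
  have h2 (T : H →ₗ[ℂ] H) := ctrl_comp (ι := ι) f T 1
  simp only [mul_one] at h2
  simp only [ctrl, Finset.sum_mul, h1]
  rw [Finset.sum_comm]
  simp only [← Finset.mul_sum, h2, LinearMap.comp_apply]

lemma ctrl_mul_Xl (hf : ∀ a x, Commute (ι a) (f x)) (g : H) :
    ctrl ι f * ι (Xl H g) =
      ∑ p ∈ sw g, ι (Xl H p.1) * ctrl ι (f ∘ₗ LinearMap.mulRight ℂ (S H p.2)) := by
  have h1 (i) : ι (Zs H ((bas H).coord i)) * f (bas H i) * ι (Xl H g) =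
      ∑ p ∈ sw g, ι (Xl H p.1) *
        (ι (Zs H ((bas H).coord i ∘ₗ LinearMap.mulRight ℂ (S H p.2))) * f (bas H i)) := by
    rw [mul_assoc, ← (hf _ _).eq, ← mul_assoc, ← map_mul, Zs_mul_Xl, map_sum, Finset.sum_mul]
    exact Finset.sum_congr rfl fun p _ => by rw [map_mul, mul_assoc]; rfl
  have h2 (T : H →ₗ[ℂ] H) := ctrl_comp (ι := ι) f T 1
  simp only [mul_one] at h2
  simp only [ctrl, Finset.sum_mul, h1]
  rw [Finset.sum_comm]
  simp only [← Finset.mul_sum, h2, LinearMap.comp_apply]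

lemma ctrl_commute {a : A} (h1 : ∀ b, Commute a (ι b)) (h2 : ∀ x, Commute a (f x)) :
    Commute a (ctrl ι f) :=
  Commute.sum_right _ _ _ fun _ _ => (h1 _).mul_right (h2 _)

lemma ctrl_mulLeft_left (hf : ∀ a x, Commute (ι a) (f x))
    (hm : ∀ x y, f (x * y) = f x * f y) (u : H) :
    ctrl ι (f ∘ₗ LinearMap.mulLeft ℂ u) = f u * ctrl ι f := by
  simp only [ctrl, Finset.mul_sum, LinearMap.comp_apply, LinearMap.mulLeft_apply, hm]
  exact Finset.sum_congr rfl fun _ _ => by rw [← mul_assoc, (hf _ _).eq, mul_assoc]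

lemma ctrl_mulRight_right (hm : ∀ x y, f (x * y) = f x * f y) (u : H) :
    ctrl ι (f ∘ₗ LinearMap.mulRight ℂ u) = ctrl ι f * f u := by
  simp only [ctrl, Finset.sum_mul, LinearMap.comp_apply, LinearMap.mulRight_apply, hm, mul_assoc]

lemma ctrl_mulRight_left (hf : ∀ a x, Commute (ι a) (f x))
    (hm : ∀ x y, f (x * y) = f y * f x) (u : H) :
    ctrl ι (f ∘ₗ LinearMap.mulRight ℂ u) = f u * ctrl ι f := by
  simp only [ctrl, Finset.mul_sum, LinearMap.comp_apply, LinearMap.mulRight_apply, hm]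
  exact Finset.sum_congr rfl fun _ _ => by rw [← mul_assoc, (hf _ _).eq, mul_assoc]

lemma ctrl_mulLeft_right (hm : ∀ x y, f (x * y) = f y * f x) (u : H) :
    ctrl ι (f ∘ₗ LinearMap.mulLeft ℂ u) = ctrl ι f * f u := by
  simp only [ctrl, Finset.sum_mul, LinearMap.comp_apply, LinearMap.mulLeft_apply, hm, mul_assoc]

lemma cst_ctrl_mul_Xr_of_mul (hf : ∀ a x, Commute (ι a) (f x))
    (hm : ∀ x y, f (x * y) = f x * f y) :
    cst (ctrl ι f) * emb ι (Xr H) = toConv f * emb ι (Xr H) * cst (ctrl ι f) := by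
  ext g
  rw [cst_mul_apply, mul_cst_apply, convMul_eq_sum, emb_apply, ctrl_mul_Xr hf, Finset.sum_mul]
  refine Finset.sum_congr rfl fun p _ => ?_
  rw [ctrl_mulLeft_left hf hm, ← mul_assoc, (hf _ _).eq]
  rfl

/-- Multiplying the control by S(g) on the right multiplies f(x⁽¹⁾) by f(S(g⁽²⁾)). The extra factor
f(g⁽³⁾) contracts with it to f(ε_R(g⁽²⁾)), so the label operator f is absorbed by this edge. -/
lemma cst_ctrl_mul_Xl_mul_of_mul (hf : ∀ a x, Commute (ι a) (f x))
    (hm : ∀ x y, f (x * y) = f x * f y) :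
    cst (ctrl ι f) * emb ι (Xl H) * toConv f = emb ι (Xl H) * cst (ctrl ι f) := by
  have h1 (g : H) : ctrl ι f * ι (Xl H g) =
      ∑ p ∈ sw g, ι (Xl H p.1) * ctrl ι f * f (S H p.2) := by
    rw [ctrl_mul_Xl hf]
    simp only [ctrl_mulRight_right hm, mul_assoc]
  have h1' : cst (ctrl ι f) * emb ι (Xl H) =
      emb ι (Xl H) * (cst (ctrl ι f) * toConv (f ∘ₗ S H)) := by
    ext g
    rw [cst_mul_apply, emb_apply, h1, ← mul_assoc, convMul_eq_sum]
    simp only [mul_cst_apply]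
    rfl
  have h2 : toConv (f ∘ₗ S H) * toConv f = toConv (f ∘ₗ eR H) := by
    ext g
    rw [convMul_eq_sum]
    change ∑ p ∈ sw g, f (S H p.1) * f p.2 = f (eR H g)
    simp only [← hm, ← map_sum, sum_S_mul]
  rw [h1', mul_assoc, mul_assoc, h2, ← mul_assoc]
  ext g
  rw [convMul_eq_sum]
  simp only [mul_cst_apply]
  have h3 := sum_eR_tail (LinearMap.mul' ℂ A ∘ₗ TensorProduct.map
    (LinearMap.mulRight ℂ (ctrl ι f) ∘ₗ ι.toLinearMap ∘ₗ Xl H) f) g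
  simp only [LinearMap.comp_apply, TensorProduct.map_tmul, LinearMap.mulRight_apply,
    LinearMap.mul'_apply, AlgHom.toLinearMap_apply, Xl_mul, map_mul] at h3
  refine h3.trans ?_
  rw [emb_apply]
  -- The contraction leaves 1⁽¹⁾ and S(1⁽²⁾). Precisely these legs occur in the exchange relation at
  -- g = 1, whose left side is the bare controlled operator.
  have h4 := h1 1
  rw [Xl_one, map_one, mul_one] at h4
  conv_rhs => rw [h4, Finset.mul_sum]
  simp only [mul_assoc]

/-- Here the factor f(S(g⁽¹⁾)) is supplied beforehand. Since f reverses products, it combines with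
f(g⁽²⁾), produced by the control, to f(S(g⁽¹⁾)g⁽²⁾) = f(ε_R(g⁽¹⁾)), and the relation at g = 1
swallows the rest. -/
lemma cst_ctrl_mul_Xr_of_antimul (hf : ∀ a x, Commute (ι a) (f x))
    (hm : ∀ x y, f (x * y) = f y * f x) :
    cst (ctrl ι f) * toConv (f ∘ₗ S H) * emb ι (Xr H) = emb ι (Xr H) * cst (ctrl ι f) := by
  have h1 (g : H) : ctrl ι f * ι (Xr H g) =
      ∑ p ∈ sw g, ι (Xr H p.2) * ctrl ι f * f p.1 := by
    rw [ctrl_mul_Xr hf]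
    simp only [ctrl_mulLeft_right hm, mul_assoc]
  ext g
  rw [mul_assoc, cst_mul_apply, mul_cst_apply, convMul_eq_sum, Finset.mul_sum, emb_apply]
  have h2 (p : H × H) : ctrl ι f * (f (S H p.1) * ι (Xr H p.2)) =
      ∑ q ∈ sw p.2, ι (Xr H q.2) * ctrl ι f * f (S H p.1 * q.1) := by
    rw [← (hf _ _).eq, ← mul_assoc, h1, Finset.sum_mul]
    simp only [hm, mul_assoc]
  refine (Finset.sum_congr rfl fun p _ => h2 p).trans ?_
  have h3 := sum_sw_assoc (LinearMap.mul' ℂ A ∘ₗ (TensorProduct.comm ℂ A A).toLinearMap ∘ₗ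
    TensorProduct.map (f ∘ₗ LinearMap.mul' ℂ H ∘ₗ (S H).rTensor H)
      (LinearMap.mulRight ℂ (ctrl ι f) ∘ₗ ι.toLinearMap ∘ₗ Xr H) ∘ₗ
      (TensorProduct.assoc ℂ H H H).symm.toLinearMap) g
  simp only [LinearMap.comp_apply, TensorProduct.map_tmul, LinearMap.mulRight_apply,
    LinearMap.mul'_apply, AlgHom.toLinearMap_apply, LinearEquiv.coe_coe, LinearMap.rTensor_tmul,
    TensorProduct.assoc_symm_tmul, TensorProduct.comm_tmul] at h3
  rw [← h3]
  simp only [← Finset.mul_sum, ← map_sum, sum_S_mul]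
  have h4 := sum_eR_head (LinearMap.mul' ℂ A ∘ₗ (TensorProduct.comm ℂ A A).toLinearMap ∘ₗ
    TensorProduct.map f (LinearMap.mulRight ℂ (ctrl ι f) ∘ₗ ι.toLinearMap ∘ₗ Xr H)) g
  simp only [LinearMap.comp_apply, TensorProduct.map_tmul, LinearMap.mulRight_apply,
    LinearMap.mul'_apply, AlgHom.toLinearMap_apply, LinearEquiv.coe_coe,
    TensorProduct.comm_tmul] at h4
  rw [h4]
  have h5 := h1 1
  rw [Xr_one, map_one, mul_one] at h5
  conv_rhs => rw [h5, Finset.mul_sum]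
  simp only [Xr_mul, map_mul, mul_assoc]

lemma cst_ctrl_mul_Xl_of_antimul (hf : ∀ a x, Commute (ι a) (f x))
    (hm : ∀ x y, f (x * y) = f y * f x) :
    cst (ctrl ι f) * emb ι (Xl H) = emb ι (Xl H) * toConv (f ∘ₗ S H) * cst (ctrl ι f) := by
  ext g
  rw [cst_mul_apply, mul_cst_apply, convMul_eq_sum, emb_apply, ctrl_mul_Xl hf, Finset.sum_mul]
  refine Finset.sum_congr rfl fun p _ => ?_
  rw [ctrl_mulRight_left hf hm, ← mul_assoc]
  rfl

end Controlled

end WeakHopfCluster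

namespace WeakHopfCluster

/-! ### Moving Z-operators past controlled operators -/

section ControlledDual

variable {H : Type*} [Ring H] [Algebra ℂ H] [WeakHopfAlgebra H] [FiniteDimensional ℂ H]
variable {A : Type*} [Ring A] [Algebra ℂ A]
variable {ι : Module.End ℂ H →ₐ[ℂ] A} {f : H →ₗ[ℂ] A} {G : Module.Dual ℂ H →ₗ[ℂ] A}

lemma convMul_dual_lact (F G : Module.Dual ℂ H →ₗ[ℂ] A) (ψ : Module.Dual ℂ H) :
    (toConv F * toConv G) ψ = ∑ i, F ((bas H).coord i) * G (lact ψ (bas H i)) := by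
  rw [convMul_eq_sum]
  have := sum_sw_dual_lact (LinearMap.mul' ℂ A ∘ₗ TensorProduct.map F G) ψ
  simpa using this

lemma convMul_dual_ract (F G : Module.Dual ℂ H →ₗ[ℂ] A) (ψ : Module.Dual ℂ H) :
    (toConv F * toConv G) ψ = ∑ i, F (ract ψ (bas H i)) * G ((bas H).coord i) := by
  rw [convMul_eq_sum]
  have := sum_sw_dual_ract (LinearMap.mul' ℂ A ∘ₗ TensorProduct.map F G) ψ
  simpa using this

/-- A comultiplied control is two controls on the same factor, in reversed order because `Zs` is
antimultiplicative. -/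
lemma sum_Zs_sw (T : H ⊗[ℂ] H →ₗ[ℂ] A) :
    ∑ i, ∑ p ∈ sw (bas H i), ι (Zs H ((bas H).coord i)) * T (p.1 ⊗ₜ p.2) =
      ∑ i, ∑ j, ι (Zs H ((bas H).coord j)) * ι (Zs H ((bas H).coord i)) *
        T (bas H i ⊗ₜ bas H j) := by
  have := sum_coord_sw (LinearMap.mul' ℂ A ∘ₗ TensorProduct.map (ι.toLinearMap ∘ₗ Zs H) T)
  simpa only [LinearMap.comp_apply, TensorProduct.map_tmul, LinearMap.mul'_apply,
    AlgHom.toLinearMap_apply, ← map_mul, Zs_mul_Zs] using this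

/-- Moving an operator past a controlled one, when it picks up the second Sweedler factor. -/
lemma mul_ctrl_of_fst (hG : ∀ a ψ, Commute (ι a) (G ψ)) (N : H →ₗ[ℂ] A) (ψ : Module.Dual ℂ H)
    (h : ∀ k, G ψ * f k = ∑ p ∈ sw k, f p.1 * N p.2) :
    G ψ * ctrl ι f = ∑ j, ι (Zs H ((bas H).coord j)) * ctrl ι f * N (bas H j) := by
  have h1 (i) : G ψ * (ι (Zs H ((bas H).coord i)) * f (bas H i)) =
      ∑ p ∈ sw (bas H i), ι (Zs H ((bas H).coord i)) *
        (LinearMap.mul' ℂ A ∘ₗ TensorProduct.map f N) (p.1 ⊗ₜ p.2) := by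
    rw [← mul_assoc, ← (hG _ _).eq, mul_assoc, h, Finset.mul_sum]
    rfl
  simp only [ctrl, Finset.mul_sum, h1, sum_Zs_sw, Finset.sum_mul]
  rw [Finset.sum_comm]
  simp only [LinearMap.comp_apply, TensorProduct.map_tmul, LinearMap.mul'_apply, mul_assoc]

lemma mul_ctrl_of_snd (hG : ∀ a ψ, Commute (ι a) (G ψ)) (N : H →ₗ[ℂ] A) (ψ : Module.Dual ℂ H)
    (h : ∀ k, G ψ * f k = ∑ p ∈ sw k, f p.2 * N p.1)
    (hf : ∀ a x, Commute (ι a) (f x)) :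
    G ψ * ctrl ι f = ctrl ι f * ∑ i, ι (Zs H ((bas H).coord i)) * N (bas H i) := by
  have h1 (i) : G ψ * (ι (Zs H ((bas H).coord i)) * f (bas H i)) =
      ∑ p ∈ sw (bas H i), ι (Zs H ((bas H).coord i)) *
        (LinearMap.mul' ℂ A ∘ₗ (TensorProduct.comm ℂ A A).toLinearMap ∘ₗ
          TensorProduct.map N f) (p.1 ⊗ₜ p.2) := by
    rw [← mul_assoc, ← (hG _ _).eq, mul_assoc, h, Finset.mul_sum]
    rfl
  simp only [ctrl, Finset.mul_sum, h1, sum_Zs_sw, Finset.sum_mul]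
  refine Finset.sum_congr rfl fun i _ => Finset.sum_congr rfl fun j _ => ?_
  simp only [LinearMap.comp_apply, TensorProduct.map_tmul, LinearMap.mul'_apply,
    LinearEquiv.coe_coe, TensorProduct.comm_tmul]
  rw [mul_assoc, mul_assoc, ← mul_assoc _ (f _), (hf _ _).eq, mul_assoc]

/-- Two consecutive controls merge into one comultiplied control, and the antipode inside `Zl` moves
to the second leg. -/
lemma sum_Zl_mul_Zs (T : H ⊗[ℂ] H →ₗ[ℂ] A) :
    ∑ k, ∑ j, ι (Zl H ((bas H).coord k)) * (ι (Zs H ((bas H).coord j)) *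
        T (bas H j ⊗ₜ bas H k)) =
      ∑ j, ∑ p ∈ sw (bas H j), ι (Zs H ((bas H).coord j)) * T (p.1 ⊗ₜ S H p.2) := by
  have h := sum_Zs_sw (ι := ι) (T ∘ₗ (S H).lTensor H)
  simp only [LinearMap.comp_apply, LinearMap.lTensor_tmul] at h
  rw [h]
  rw [Finset.sum_comm]
  refine Finset.sum_congr rfl fun j _ => ?_
  have h1 := ctrl_comp (ι := ι) (T ∘ₗ TensorProduct.mk ℂ H H (bas H j)) (S H)
    (ι (Zs H ((bas H).coord j)))
  simpa only [Zl_eq_Zs, LinearMap.comp_apply, TensorProduct.mk_apply, mul_assoc] using h1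

lemma sum_Zs_mul_ctrl (N : H →ₗ[ℂ] A) :
    ∑ j, ι (Zs H ((bas H).coord j)) * (ctrl ι f * N (bas H j)) =
      ∑ i, ∑ p ∈ sw (bas H i), ι (Zs H ((bas H).coord i)) * (f p.1 * N p.2) := by
  have h := sum_Zs_sw (ι := ι) (LinearMap.mul' ℂ A ∘ₗ TensorProduct.map f N)
  simp only [LinearMap.comp_apply, TensorProduct.map_tmul, LinearMap.mul'_apply] at h
  rw [h, Finset.sum_comm]
  simp only [ctrl, Finset.sum_mul, Finset.mul_sum, mul_assoc]

/-- Passing f(k) transforms ψ by S(k⁽¹⁾). This dependence on k is itself a control, now through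
`Zl`, and summing over dual bases reproduces Δ̂(ψ). The Z-operator on the target thus deposits a
`Zl` on the control. -/
lemma conv_mul_cst_ctrl_of_lact (hf : ∀ a x, Commute (ι a) (f x)) (hG : ∀ a ψ, Commute (ι a) (G ψ))
    (h : ∀ ψ k, G ψ * f k = ∑ p ∈ sw k, f p.2 * G (lact ψ (S H p.1))) :
    toConv G * cst (ctrl ι f) = cst (ctrl ι f) * (emb ι (Zl H) * toConv G) := by
  ext ψ
  rw [mul_cst_apply, cst_mul_apply, convMul_dual_lact]
  refine (mul_ctrl_of_snd hG (G ∘ₗ lact ψ ∘ₗ S H) ψ (h ψ) hf).trans ?_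
  congr 1
  have := ctrl_comp (ι := ι) (G ∘ₗ lact ψ) (S H) 1
  simp only [mul_one] at this
  exact this.symm

lemma conv_mul_cst_ctrl_of_ract (hf : ∀ a x, Commute (ι a) (f x)) (hG : ∀ a ψ, Commute (ι a) (G ψ))
    (h : ∀ ψ k, G ψ * f k = ∑ p ∈ sw k, f p.2 * G (ract ψ (S H p.1))) :
    toConv G * cst (ctrl ι f) = cst (ctrl ι f) * (toConv G * emb ι (Zl H)) := by
  ext ψ
  rw [mul_cst_apply, cst_mul_apply, convMul_dual_ract]
  refine (mul_ctrl_of_snd hG (G ∘ₗ ract ψ ∘ₗ S H) ψ (h ψ) hf).trans ?_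
  congr 1
  have := ctrl_comp (ι := ι) (G ∘ₗ ract ψ) (S H) 1
  simp only [mul_one] at this
  refine this.symm.trans (Finset.sum_congr rfl fun i _ => ?_)
  exact (hG _ _).eq

/-- The converse of depositing: a `Zl` already present on the control contributes S(k⁽²⁾), which
meets S²(k⁽¹⁾) from the exchange relation and contracts to S(ε_R(k)). -/
lemma emb_Zl_mul_conv_mul_cst_ctrl (hf1 : f 1 = 1)
    (hm : ∀ x y, f (x * y) = f x * f y) (hG : ∀ a ψ, Commute (ι a) (G ψ))
    (h : ∀ ψ k, G ψ * f k = ∑ p ∈ sw k, f p.1 * G (lact ψ (S H (S H p.2)))) :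
    emb ι (Zl H) * toConv G * cst (ctrl ι f) = cst (ctrl ι f) * toConv G := by
  ext ψ
  rw [mul_cst_apply, cst_mul_apply, convMul_dual_lact, Finset.sum_mul]
  let N (ψ : Module.Dual ℂ H) : H →ₗ[ℂ] A := G ∘ₗ lact ψ ∘ₗ S H ∘ₗ S H
  have h1 (ψ : Module.Dual ℂ H) := mul_ctrl_of_fst hG (N ψ) ψ (h ψ)
  have h2 : ∀ k, (ι.toLinearMap ∘ₗ Zl H) ((bas H).coord k) * G (lact ψ (bas H k)) * ctrl ι f =
      ∑ j, ι (Zl H ((bas H).coord k)) * (ι (Zs H ((bas H).coord j)) *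
        (LinearMap.mulLeft ℂ (ctrl ι f) ∘ₗ G ∘ₗ lact ψ ∘ₗ LinearMap.mul' ℂ H ∘ₗ
          (TensorProduct.comm ℂ H H).toLinearMap ∘ₗ (S H ∘ₗ S H).rTensor H)
          (bas H j ⊗ₜ bas H k)) := by
    intro k
    rw [mul_assoc, h1, Finset.mul_sum]
    simp only [N, LinearMap.comp_apply, LinearMap.rTensor_tmul, LinearEquiv.coe_coe,
      TensorProduct.comm_tmul, LinearMap.mul'_apply, LinearMap.mulLeft_apply, lact_lact, mul_assoc,
      AlgHom.toLinearMap_apply]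
  simp only [h2, sum_Zl_mul_Zs]
  have h3 (j) : ∑ p ∈ sw (bas H j), S H p.2 * S H (S H p.1) = S H (eR H (bas H j)) := by
    rw [← sum_S_mul, map_sum]
    simp only [S_mul]
  simp only [LinearMap.comp_apply, LinearMap.rTensor_tmul, LinearEquiv.coe_coe,
    TensorProduct.comm_tmul, LinearMap.mul'_apply, LinearMap.mulLeft_apply]
  simp only [← Finset.mul_sum, ← map_sum, h3]
  have h4 := sum_Zs_mul_ctrl (ι := ι) (f := f) (G ∘ₗ lact ψ ∘ₗ S H ∘ₗ eR H)
  simp only [LinearMap.comp_apply] at h4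
  rw [h4]
  have h5 (x : H) : ∑ p ∈ sw x, f p.1 * G (lact ψ (S H (eR H p.2))) = f x * G ψ := by
    have h6 := sum_eR_tail (LinearMap.mul' ℂ A ∘ₗ TensorProduct.map f (G ∘ₗ lact ψ ∘ₗ S H)) x
    simp only [LinearMap.comp_apply, TensorProduct.map_tmul, LinearMap.mul'_apply, hm] at h6
    -- As f(1) = 1, the hypothesis at k = 1 expresses G ψ through the legs of Δ(1), the form in
    -- which ε_R has been left behind.
    have h7 := h ψ 1
    rw [hf1, mul_one] at h7
    rw [h6, h7, Finset.mul_sum]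
    simp only [mul_assoc]
  simp only [← Finset.mul_sum, h5, ctrl, Finset.sum_mul, mul_assoc]

/-- The same absorption for right translates: the two contributions meet as k⁽¹⁾S(k⁽²⁾) = ε_L(k). -/
lemma conv_mul_emb_Zl_mul_cst_ctrl (hf1 : f 1 = 1)
    (hm : ∀ x y, f (x * y) = f y * f x) (hG : ∀ a ψ, Commute (ι a) (G ψ))
    (h : ∀ ψ k, G ψ * f k = ∑ p ∈ sw k, f p.1 * G (ract ψ p.2)) :
    toConv G * emb ι (Zl H) * cst (ctrl ι f) = cst (ctrl ι f) * toConv G := by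
  ext ψ
  rw [mul_cst_apply, cst_mul_apply, convMul_dual_ract, Finset.sum_mul]
  have h1 (ψ : Module.Dual ℂ H) := mul_ctrl_of_fst hG (G ∘ₗ ract ψ) ψ (h ψ)
  have h2 : ∀ k, G (ract ψ (bas H k)) * (ι.toLinearMap ∘ₗ Zl H) ((bas H).coord k) * ctrl ι f =
      ∑ j, ι (Zl H ((bas H).coord k)) * (ι (Zs H ((bas H).coord j)) *
        (LinearMap.mulLeft ℂ (ctrl ι f) ∘ₗ G ∘ₗ ract ψ ∘ₗ LinearMap.mul' ℂ H)
          (bas H j ⊗ₜ bas H k)) := by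
    intro k
    rw [LinearMap.comp_apply, AlgHom.toLinearMap_apply, ← (hG _ _).eq, mul_assoc, h1,
      Finset.mul_sum]
    simp only [LinearMap.comp_apply, LinearMap.mul'_apply, LinearMap.mulLeft_apply, ract_ract,
      mul_assoc]
  simp only [h2, sum_Zl_mul_Zs]
  simp only [LinearMap.comp_apply, LinearMap.mul'_apply, LinearMap.mulLeft_apply]
  simp only [← Finset.mul_sum, ← map_sum, sum_mul_S]
  have h4 := sum_Zs_mul_ctrl (ι := ι) (f := f) (G ∘ₗ ract ψ ∘ₗ eL H)
  simp only [LinearMap.comp_apply] at h4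
  rw [h4]
  have h5 (x : H) : ∑ p ∈ sw x, f p.1 * G (ract ψ (eL H p.2)) = f x * G ψ := by
    have h6 := sum_eL_tail (LinearMap.mul' ℂ A ∘ₗ TensorProduct.map f (G ∘ₗ ract ψ)) x
    simp only [LinearMap.comp_apply, TensorProduct.map_tmul, LinearMap.mul'_apply, hm] at h6
    have h7 := h ψ 1
    rw [hf1, mul_one] at h7
    rw [h6, h7, Finset.mul_sum]
    simp only [mul_assoc]
  simp only [← Finset.mul_sum, h5, ctrl, Finset.sum_mul, mul_assoc]

end ControlledDual

end WeakHopfCluster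

namespace WeakHopfCluster

/-! ### The local commutation relations of the ribbon -/

section Words

variable {R : Type*} [Monoid R]

/-- Each relation with an arbitrary tail z appended, so that it can rewrite inside right-associated
words. -/
lemma mul_mul_of_mul_eq {a b c : R} (h : a * b = c) (z : R) : a * (b * z) = c * z := by
  rw [← mul_assoc, h]

lemma mul_mul_mul_of_mul_eq {a b b' c : R} (h : a * b * b' = c) (z : R) :
    a * (b * (b' * z)) = c * z := by
  rw [← mul_assoc, ← mul_assoc, h]

/-- x₁x₂x₃ is the direct triangle on the incoming edge, d the dual triangle and y₁y₂y₃ the direct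
triangle on the outgoing edge. Moving XR through the x's creates HR·P·HL on the labels; d consumes
AL before HR and recreates it behind HL; the y's then consume HR, P and HL next to YL. -/
lemma vertex_word {y₁ y₂ y₃ d x₁ x₂ x₃ YL AL XR HR HL P : R}
    (a1 : x₃ * XR = HR * XR * x₃) (a2 : x₂ * XR = P * XR * x₂) (a3 : x₁ * XR = HL * XR * x₁)
    (b1 : Commute x₁ YL) (b2 : Commute x₂ YL) (b3 : Commute x₃ YL)
    (c1 : Commute x₁ AL) (c2 : Commute x₂ AL) (c3 : Commute x₃ AL)
    (e1 : Commute x₁ HR) (e2 : Commute x₂ HR) (e3 : Commute x₁ P)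
    (d1 : d * AL * HR = HR * d) (d2 : d * HL = HL * AL * d) (d3 : Commute d YL)
    (d4 : Commute d P) (d5 : Commute d XR)
    (f1 : y₁ * YL * HL = YL * y₁) (f2 : y₂ * YL * P = YL * y₂) (f3 : y₃ * YL * HR = YL * y₃)
    (g1 : Commute y₃ P) (g2 : Commute y₃ HL) (g3 : Commute y₃ AL) (g4 : Commute y₃ XR)
    (k1 : Commute y₂ HL) (k2 : Commute y₂ AL) (k3 : Commute y₂ XR)
    (l1 : Commute y₁ AL) (l2 : Commute y₁ XR) :
    Commute (y₁ * y₂ * y₃ * d * (x₁ * x₂ * x₃)) (YL * (AL * XR)) := by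
  have key (z : R) : y₁ * y₂ * y₃ * d * (x₁ * x₂ * x₃) * (YL * (AL * XR)) * z =
      YL * (AL * XR) * (y₁ * y₂ * y₃ * d * (x₁ * x₂ * x₃)) * z := by
    simp only [mul_assoc, mul_mul_of_mul_eq a1, mul_mul_of_mul_eq a2, mul_mul_of_mul_eq a3,
      mul_mul_of_mul_eq b1.eq, mul_mul_of_mul_eq b2.eq, mul_mul_of_mul_eq b3.eq,
      mul_mul_of_mul_eq c1.eq, mul_mul_of_mul_eq c2.eq, mul_mul_of_mul_eq c3.eq,
      mul_mul_of_mul_eq e1.eq, mul_mul_of_mul_eq e2.eq, mul_mul_of_mul_eq e3.eq,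
      mul_mul_mul_of_mul_eq d1, mul_mul_of_mul_eq d2, mul_mul_of_mul_eq d3.eq,
      mul_mul_of_mul_eq d4.eq, mul_mul_of_mul_eq d5.eq,
      mul_mul_mul_of_mul_eq f1, mul_mul_mul_of_mul_eq f2, mul_mul_mul_of_mul_eq f3,
      mul_mul_of_mul_eq g1.eq, mul_mul_of_mul_eq g2.eq, mul_mul_of_mul_eq g3.eq,
      mul_mul_of_mul_eq g4.eq, mul_mul_of_mul_eq k1.eq, mul_mul_of_mul_eq k2.eq,
      mul_mul_of_mul_eq k3.eq, mul_mul_of_mul_eq l1.eq, mul_mul_of_mul_eq l2.eq]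
  have := key 1
  rwa [mul_one, mul_one] at this

/-- BL deposits HZ on the label when it passes db. HZ survives the direct triangle, as x₁ consumes
the XL in front of it and x₃ emits a new XL behind it, and da finally consumes HZ next to AR. -/
lemma face_word {db x₁ x₂ x₃ da AR XL BL HZ : R}
    (a1 : BL * db = db * (HZ * BL)) (a2 : Commute XL db) (a3 : Commute AR db)
    (b1 : XL * HZ * x₁ = x₁ * HZ) (b2 : Commute HZ x₂) (b3 : HZ * x₃ = x₃ * (HZ * XL))
    (c1 : Commute BL x₁) (c2 : Commute BL x₂) (c3 : Commute BL x₃)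
    (d1 : Commute AR x₁) (d2 : Commute AR x₂) (d3 : Commute AR x₃)
    (e1 : Commute BL da) (e2 : Commute XL da) (e3 : AR * HZ * da = da * AR) :
    Commute (db * (x₁ * x₂ * x₃) * da) (AR * (XL * BL)) := by
  have key (z : R) : AR * (XL * BL) * (db * (x₁ * x₂ * x₃) * da) * z =
      db * (x₁ * x₂ * x₃) * da * (AR * (XL * BL)) * z := by
    simp only [mul_assoc, mul_mul_of_mul_eq a1, mul_mul_of_mul_eq a2.eq, mul_mul_of_mul_eq a3.eq,
      mul_mul_mul_of_mul_eq b1, mul_mul_of_mul_eq b2.eq, mul_mul_of_mul_eq b3,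
      mul_mul_of_mul_eq c1.eq, mul_mul_of_mul_eq c2.eq, mul_mul_of_mul_eq c3.eq,
      mul_mul_of_mul_eq d1.eq, mul_mul_of_mul_eq d2.eq, mul_mul_of_mul_eq d3.eq,
      mul_mul_of_mul_eq e1.eq, mul_mul_of_mul_eq e2.eq, mul_mul_mul_of_mul_eq e3]
  have := key 1
  rw [mul_one, mul_one] at this
  exact this.symm

end Words

section Local

variable {H : Type*} [Ring H] [Algebra ℂ H] [WeakHopfAlgebra H] [FiniteDimensional ℂ H]
variable {A : Type*} [Ring A] [Algebra ℂ A]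

/-- The operator of the direct triangle along the edge embedded through `ι`, where the operators
on the incoming elements of `H` and `Ĥ` are given by `κ` and `Φ`. -/
def directOp (κ : Module.End ℂ H →ₐ[ℂ] A) (Φ : H →ₗ[ℂ] A) (ι : Module.End ℂ H →ₐ[ℂ] A) : A :=
  ctrl ι (κ.toLinearMap ∘ₗ Xl H) * ctrl ι Φ * ctrl ι (κ.toLinearMap ∘ₗ Xr H)

/-- The operator of the dual triangle across the edge embedded through `ι`. -/
def dualOp (κ : Module.End ℂ H →ₐ[ℂ] A) (ι : Module.End ℂ H →ₐ[ℂ] A) : A :=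
  ctrl κ (ι.toLinearMap ∘ₗ Xt H)

variable {κ ι ι₁ ι₂ ι₃ : Module.End ℂ H →ₐ[ℂ] A} {Φ : H →ₗ[ℂ] A}

lemma directOp_commute {u : A} (h1 : ∀ a, Commute u (κ a)) (h2 : ∀ x, Commute u (Φ x))
    (h3 : ∀ a, Commute u (ι a)) : Commute u (directOp κ Φ ι) :=
  ((ctrl_commute h3 fun _ => h1 _).mul_right (ctrl_commute h3 h2)).mul_right
    (ctrl_commute h3 fun _ => h1 _)

lemma dualOp_commute {u : A} (h1 : ∀ a, Commute u (κ a)) (h2 : ∀ a, Commute u (ι a)) :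
    Commute u (dualOp κ ι) :=
  ctrl_commute h1 fun _ => h2 _

variable (hΦm : ∀ x y, Φ (x * y) = Φ x * Φ y) (hκΦ : ∀ a x, Commute (κ a) (Φ x))

include hΦm hκΦ in
/-- The ribbon commutes with a vertex operator. -/
lemma commute_vertex_conv
    (h1 : ∀ a b, Commute (κ a) (ι₁ b)) (h2 : ∀ a b, Commute (κ a) (ι₂ b))
    (h3 : ∀ a b, Commute (κ a) (ι₃ b)) (h12 : ∀ a b, Commute (ι₁ a) (ι₂ b))
    (h13 : ∀ a b, Commute (ι₁ a) (ι₃ b)) (h23 : ∀ a b, Commute (ι₂ a) (ι₃ b))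
    (hΦ1 : ∀ a x, Commute (ι₁ a) (Φ x)) (hΦ2 : ∀ a x, Commute (ι₂ a) (Φ x))
    (hΦ3 : ∀ a x, Commute (ι₃ a) (Φ x)) :
    Commute (cst (directOp κ Φ ι₃ * dualOp κ ι₂ * directOp κ Φ ι₁))
      (emb ι₃ (Xl H) * (emb ι₂ (Xl H) * emb ι₁ (Xr H))) := by
  have mXr (x y : H) : (κ.toLinearMap ∘ₗ Xr H) (x * y) =
      (κ.toLinearMap ∘ₗ Xr H) x * (κ.toLinearMap ∘ₗ Xr H) y := by
    simp [Xr_mul]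
  have mXl (x y : H) : (κ.toLinearMap ∘ₗ Xl H) (x * y) =
      (κ.toLinearMap ∘ₗ Xl H) x * (κ.toLinearMap ∘ₗ Xl H) y := by
    simp [Xl_mul]
  have mXt (x y : H) : (ι₂.toLinearMap ∘ₗ Xt H) (x * y) =
      (ι₂.toLinearMap ∘ₗ Xt H) y * (ι₂.toLinearMap ∘ₗ Xt H) x := by
    simp [Xt_mul]
  have hrl (x y : H) : Commute (κ (Xr H x)) (κ (Xl H y)) := (Xr_commute_Xt _ _).map κ
  simp only [directOp, dualOp, cst_mul]
  -- HR and HL are left multiplication by g and right multiplication by S(g) on the first label, and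
  -- P is the action on the second. The relations named here are the genuine exchanges; the
  -- remaining goals concern operators on disjoint factors, or left against right multiplication.
  refine vertex_word (HR := emb κ (Xr H)) (HL := emb κ (Xl H)) (P := toConv Φ)
    (cst_ctrl_mul_Xr_of_mul (fun _ _ => (h1 _ _).symm) mXr)
    (cst_ctrl_mul_Xr_of_mul hΦ1 hΦm)
    (cst_ctrl_mul_Xr_of_mul (fun _ _ => (h1 _ _).symm) mXl)
    ?_ ?_ ?_ ?_ ?_ ?_ ?_ ?_ ?_
    (cst_ctrl_mul_Xr_of_antimul (fun _ _ => h2 _ _) mXt)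
    (cst_ctrl_mul_Xl_of_antimul (fun _ _ => h2 _ _) mXt)
    ?_ ?_ ?_
    (cst_ctrl_mul_Xl_mul_of_mul (fun _ _ => (h3 _ _).symm) mXl)
    (cst_ctrl_mul_Xl_mul_of_mul hΦ3 hΦm)
    (cst_ctrl_mul_Xl_mul_of_mul (fun _ _ => (h3 _ _).symm) mXr)
    ?_ ?_ ?_ ?_ ?_ ?_ ?_ ?_ ?_
  · exact commute_cst fun _ => (ctrl_commute (fun _ => (h13 _ _).symm) fun _ => (h3 _ _).symm).symm
  · exact commute_cst fun _ => (ctrl_commute (fun _ => (h13 _ _).symm) fun _ => hΦ3 _ _).symm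
  · exact commute_cst fun _ => (ctrl_commute (fun _ => (h13 _ _).symm) fun _ => (h3 _ _).symm).symm
  · exact commute_cst fun _ => (ctrl_commute (fun _ => (h12 _ _).symm) fun _ => (h2 _ _).symm).symm
  · exact commute_cst fun _ => (ctrl_commute (fun _ => (h12 _ _).symm) fun _ => hΦ2 _ _).symm
  · exact commute_cst fun _ => (ctrl_commute (fun _ => (h12 _ _).symm) fun _ => (h2 _ _).symm).symm
  · exact commute_cst fun _ => (ctrl_commute (fun _ => h1 _ _) fun _ => hrl _ _).symm
  · exact commute_cst fun _ => (ctrl_commute (fun _ => h1 _ _) fun _ => hκΦ _ _).symm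
  · exact commute_cst fun _ => (ctrl_commute (fun _ => (hΦ1 _ _).symm) fun _ => (hκΦ _ _).symm).symm
  · exact commute_cst fun _ => (ctrl_commute (fun _ => (h3 _ _).symm) fun _ => (h23 _ _).symm).symm
  · exact commute_cst fun _ => (ctrl_commute (fun _ => (hκΦ _ _).symm) fun _ => (hΦ2 _ _).symm).symm
  · exact commute_cst fun _ => (ctrl_commute (fun _ => (h1 _ _).symm) fun _ => h12 _ _).symm
  · exact commute_cst fun _ => (ctrl_commute (fun _ => (hΦ3 _ _).symm) fun _ => (hκΦ _ _).symm).symm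
  · exact commute_cst fun _ => (ctrl_commute (fun _ => h3 _ _) fun _ => (hrl _ _).symm).symm
  · exact commute_cst fun _ => (ctrl_commute (fun _ => h23 _ _) fun _ => (h2 _ _).symm).symm
  · exact commute_cst fun _ => (ctrl_commute (fun _ => h13 _ _) fun _ => (h1 _ _).symm).symm
  · exact commute_cst fun _ => (ctrl_commute (fun _ => h3 _ _) fun _ => hκΦ _ _).symm
  · exact commute_cst fun _ => (ctrl_commute (fun _ => h23 _ _) fun _ => hΦ2 _ _).symm
  · exact commute_cst fun _ => (ctrl_commute (fun _ => h13 _ _) fun _ => hΦ1 _ _).symm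
  · exact commute_cst fun _ => (ctrl_commute (fun _ => h23 _ _) fun _ => (h2 _ _).symm).symm
  · exact commute_cst fun _ => (ctrl_commute (fun _ => h13 _ _) fun _ => (h1 _ _).symm).symm

include hκΦ in
/-- The ribbon commutes with a face operator. -/
lemma commute_face_conv
    (h1 : ∀ a b, Commute (κ a) (ι₁ b)) (h2 : ∀ a b, Commute (κ a) (ι₂ b))
    (h3 : ∀ a b, Commute (κ a) (ι₃ b)) (h12 : ∀ a b, Commute (ι₁ a) (ι₂ b))
    (h13 : ∀ a b, Commute (ι₁ a) (ι₃ b)) (h23 : ∀ a b, Commute (ι₂ a) (ι₃ b))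
    (hΦ1 : ∀ a x, Commute (ι₁ a) (Φ x)) (hΦ3 : ∀ a x, Commute (ι₃ a) (Φ x)) :
    Commute (cst (dualOp κ ι₃ * directOp κ Φ ι₂ * dualOp κ ι₁))
      (emb ι₁ (Zr H) * (emb ι₂ (Zl H) * emb ι₃ (Zl H))) := by
  simp only [directOp, dualOp, cst_mul]
  -- The deposited operator is the `Zl` acting on the label h, which is the control of both dual
  -- triangles and a target of the direct one.
  refine face_word (HZ := emb κ (Zl H)) ?_ ?_ ?_ ?_ ?_ ?_ ?_ ?_ ?_ ?_ ?_ ?_ ?_ ?_ ?_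
  · refine conv_mul_cst_ctrl_of_lact (fun _ _ => h3 _ _) (fun _ _ => h3 _ _) fun ψ k => ?_
    simp only [LinearMap.comp_apply, AlgHom.toLinearMap_apply, ← map_mul, ← map_sum, Zl_mul_Xt]
  · exact (commute_cst fun _ => (ctrl_commute (fun _ => (h2 _ _).symm) fun _ => h23 _ _).symm).symm
  · exact (commute_cst fun _ => (ctrl_commute (fun _ => (h1 _ _).symm) fun _ => h13 _ _).symm).symm
  · refine emb_Zl_mul_conv_mul_cst_ctrl (by simp [Xl_one]) (by simp [Xl_mul])
      (fun _ _ => (h2 _ _).symm) fun ψ k => ?_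
    simp only [LinearMap.comp_apply, AlgHom.toLinearMap_apply, ← map_mul, ← map_sum, Zl_mul_Xl]
  · exact (commute_cst fun _ => (ctrl_commute (fun _ => h2 _ _) fun _ => hκΦ _ _).symm).symm
  · refine conv_mul_cst_ctrl_of_ract (fun _ _ => (h2 _ _).symm) (fun _ _ => (h2 _ _).symm)
      fun ψ k => ?_
    simp only [LinearMap.comp_apply, AlgHom.toLinearMap_apply, ← map_mul, ← map_sum, Zl_mul_Xr]
  · exact (commute_cst fun _ =>
      (ctrl_commute (fun _ => (h23 _ _).symm) fun _ => (h3 _ _).symm).symm).symm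
  · exact (commute_cst fun _ => (ctrl_commute (fun _ => (h23 _ _).symm) fun _ => hΦ3 _ _).symm).symm
  · exact (commute_cst fun _ =>
      (ctrl_commute (fun _ => (h23 _ _).symm) fun _ => (h3 _ _).symm).symm).symm
  · exact (commute_cst fun _ => (ctrl_commute (fun _ => h12 _ _) fun _ => (h1 _ _).symm).symm).symm
  · exact (commute_cst fun _ => (ctrl_commute (fun _ => h12 _ _) fun _ => hΦ1 _ _).symm).symm
  · exact (commute_cst fun _ => (ctrl_commute (fun _ => h12 _ _) fun _ => (h1 _ _).symm).symm).symm
  · exact (commute_cst fun _ =>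
      (ctrl_commute (fun _ => (h3 _ _).symm) fun _ => (h13 _ _).symm).symm).symm
  · exact (commute_cst fun _ =>
      (ctrl_commute (fun _ => (h2 _ _).symm) fun _ => (h12 _ _).symm).symm).symm
  · refine conv_mul_emb_Zl_mul_cst_ctrl (by simp [Xt_one]) (by simp [Xt_mul])
      (fun _ _ => h1 _ _) fun ψ k => ?_
    simp only [LinearMap.comp_apply, AlgHom.toLinearMap_apply, ← map_mul, ← map_sum, Zr_mul_Xt]

end Local

end WeakHopfCluster

namespace WeakHopfCluster

/-! ### The ribbon operators through the whole ladder -/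

section Ladder

variable {H : Type*} [Ring H] [Algebra ℂ H] {m : ℕ}

lemma onEdge_eq_map (e : Edge m) (a : Module.End ℂ H) :
    onEdge e a = PiTensorProduct.map (Function.update (fun _ => LinearMap.id) e a) := rfl

lemma onEdge_one (e : Edge m) : onEdge e (1 : Module.End ℂ H) = 1 := by
  rw [onEdge_eq_map]
  have : Function.update (fun _ => LinearMap.id) e (1 : Module.End ℂ H) =
      fun _ : Edge m => LinearMap.id := Function.update_eq_self e _
  rw [this]
  exact PiTensorProduct.map_id

lemma onEdge_mul (e : Edge m) (a b : Module.End ℂ H) :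
    onEdge e (a * b) = onEdge e a * onEdge e b := by
  simp only [onEdge_eq_map, ← PiTensorProduct.map_mul]
  congr 1
  ext1 i
  rcases eq_or_ne i e with rfl | h
  · simp
  · simp only [Function.update_of_ne h]; rfl

lemma onEdge_commute {e e' : Edge m} (h : e ≠ e') (a b : Module.End ℂ H) :
    Commute (onEdge e a) (onEdge e' b) := by
  change _ * _ = _ * _
  simp only [onEdge_eq_map, ← PiTensorProduct.map_mul]
  congr 1
  ext1 i
  rcases eq_or_ne i e with rfl | h1
  · simp only [Function.update_self, Function.update_of_ne h]; rfl
  · simp only [Function.update_of_ne h1]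
    rfl

/-- The embedding of the operators on one edge as a homomorphism of algebras. -/
def edgeHom (e : Edge m) : Module.End ℂ H →ₐ[ℂ] Module.End ℂ (Tot H m) :=
  AlgHom.ofLinearMap (onEdge e) (onEdge_one e) (onEdge_mul e)

end Ladder

/-! ### Operators on the ladder tensored with operators on the labels -/

section Ribbon

lemma includeLeft_mul_includeRight {A B : Type*} [Ring A] [Algebra ℂ A]
    [Ring B] [Algebra ℂ B] (a : A) (b : B) :
    (Algebra.TensorProduct.includeLeft : A →ₐ[ℂ] A ⊗[ℂ] B) a *
      (Algebra.TensorProduct.includeRight : B →ₐ[ℂ] A ⊗[ℂ] B) b =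
      a ⊗ₜ b := by simp

lemma includeLeft_commute_includeRight {A B : Type*} [Ring A] [Algebra ℂ A]
    [Ring B] [Algebra ℂ B] (a : A) (b : B) :
    Commute ((Algebra.TensorProduct.includeLeft : A →ₐ[ℂ] A ⊗[ℂ] B) a)
      ((Algebra.TensorProduct.includeRight : B →ₐ[ℂ] A ⊗[ℂ] B) b) := by
  change _ * _ = _ * _
  simp

variable (H : Type*) [Ring H] [Algebra ℂ H] [WeakHopfAlgebra H] (m : ℕ)

/-- Operators on the ladder, tensored with operators on the labels of a ribbon operator. -/
def RibbonAlg :=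
  Module.End ℂ (Tot H m) ⊗[ℂ] Module.End ℂ (H ⊗[ℂ] Module.Dual ℂ H)

instance : Ring (RibbonAlg H m) :=
  inferInstanceAs (Ring (Module.End ℂ (Tot H m) ⊗[ℂ] Module.End ℂ (H ⊗[ℂ] Module.Dual ℂ H)))

instance : Algebra ℂ (RibbonAlg H m) :=
  inferInstanceAs (Algebra ℂ (Module.End ℂ (Tot H m) ⊗[ℂ] Module.End ℂ (H ⊗[ℂ] Module.Dual ℂ H)))

/-- Operators on the ladder as elements of `RibbonAlg`. -/
def totEmb : Module.End ℂ (Tot H m) →ₐ[ℂ] RibbonAlg H m :=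
  (Algebra.TensorProduct.includeLeft : Module.End ℂ (Tot H m) →ₐ[ℂ]
    Module.End ℂ (Tot H m) ⊗[ℂ] Module.End ℂ (H ⊗[ℂ] Module.Dual ℂ H))

/-- Operators on the labels as elements of `RibbonAlg`. -/
def labelsEmb : Module.End ℂ (H ⊗[ℂ] Module.Dual ℂ H) →ₐ[ℂ] RibbonAlg H m :=
  (Algebra.TensorProduct.includeRight : Module.End ℂ (H ⊗[ℂ] Module.Dual ℂ H) →ₐ[ℂ]
    Module.End ℂ (Tot H m) ⊗[ℂ] Module.End ℂ (H ⊗[ℂ] Module.Dual ℂ H))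

variable {H m}

lemma totEmb_mul_labelsEmb (a : Module.End ℂ (Tot H m))
    (b : Module.End ℂ (H ⊗[ℂ] Module.Dual ℂ H)) :
    totEmb H m a * labelsEmb H m b =
      (a ⊗ₜ[ℂ] b : Module.End ℂ (Tot H m) ⊗[ℂ] Module.End ℂ (H ⊗[ℂ] Module.Dual ℂ H)) :=
  includeLeft_mul_includeRight a b

lemma totEmb_commute_labelsEmb (a : Module.End ℂ (Tot H m))
    (b : Module.End ℂ (H ⊗[ℂ] Module.Dual ℂ H)) : Commute (totEmb H m a) (labelsEmb H m b) :=
  includeLeft_commute_includeRight a b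

lemma RibbonAlg.induction {p : RibbonAlg H m → Prop} (h0 : p 0)
    (hmul : ∀ a b, p (totEmb H m a * labelsEmb H m b)) (hadd : ∀ u v, p u → p v → p (u + v))
    (u : RibbonAlg H m) : p u := by
  refine TensorProduct.induction_on (motive := fun u => p u) u h0 (fun a b => ?_) hadd
  rw [← totEmb_mul_labelsEmb]
  exact hmul a b

/-- Operators on an edge as elements of `RibbonAlg`. -/
def edgeEmb (e : Edge m) : Module.End ℂ H →ₐ[ℂ] RibbonAlg H m :=
  (totEmb H m).comp (edgeHom e)

/-- Operators on the first label as elements of `RibbonAlg`. -/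
def labelEmb : Module.End ℂ H →ₐ[ℂ] RibbonAlg H m :=
  (labelsEmb H m).comp (Module.End.rTensorAlgHom ℂ H (Module.Dual ℂ H))

/-- `x` acts on the second label by `φ ↦ φ(S(x) •)`. -/
def dualLabelEmb : H →ₗ[ℂ] RibbonAlg H m :=
  (labelsEmb H m).toLinearMap ∘ₗ
    (LinearMap.lTensorHom H : Module.End ℂ (Module.Dual ℂ H) →ₗ[ℂ] _) ∘ₗ
        Module.Dual.transpose ∘ₗ LinearMap.mul ℂ H ∘ₗ S H

lemma edgeEmb_apply (e : Edge m) (a : Module.End ℂ H) :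
    edgeEmb e a = totEmb H m (onEdge e a) := rfl

lemma labelEmb_apply (a : Module.End ℂ H) :
    (labelEmb a : RibbonAlg H m) = labelsEmb H m (LinearMap.rTensor _ a) := rfl

lemma dualLabelEmb_apply (x : H) : (dualLabelEmb x : RibbonAlg H m) =
    labelsEmb H m (LinearMap.lTensor _ (Module.Dual.transpose (LinearMap.mul ℂ H (S H x)))) := rfl

lemma edgeEmb_commute {e e' : Edge m} (h : e ≠ e') (a b : Module.End ℂ H) :
    Commute (edgeEmb e a) (edgeEmb e' b) :=
  (onEdge_commute h a b).map (totEmb H m)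

lemma labelEmb_commute_edgeEmb (e : Edge m) (a b : Module.End ℂ H) :
    Commute (labelEmb a) (edgeEmb e b) :=
  (totEmb_commute_labelsEmb _ _).symm

lemma edgeEmb_commute_dualLabelEmb (e : Edge m) (a : Module.End ℂ H) (x : H) :
    Commute (edgeEmb e a) (dualLabelEmb x) :=
  totEmb_commute_labelsEmb _ _

lemma rTensor_commute_lTensor (a : Module.End ℂ H) (b : Module.End ℂ (Module.Dual ℂ H)) :
    Commute (a.rTensor (Module.Dual ℂ H)) (b.lTensor H) :=
  (LinearMap.rTensor_comp_lTensor ..).trans (LinearMap.lTensor_comp_rTensor ..).symm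

lemma labelEmb_commute_dualLabelEmb (a : Module.End ℂ H) (x : H) :
    Commute (labelEmb a : RibbonAlg H m) (dualLabelEmb x) :=
  (rTensor_commute_lTensor _ _).map (labelsEmb H m)

lemma dualLabelEmb_mul (x y : H) :
    (dualLabelEmb (x * y) : RibbonAlg H m) = dualLabelEmb x * dualLabelEmb y := by
  simp only [dualLabelEmb_apply, ← map_mul, ← LinearMap.lTensor_mul]
  congr 2
  ext φ z
  change φ (S H (x * y) * z) = φ (S H y * (S H x * z))
  rw [S_mul, mul_assoc]

/-- Evaluation of the labels. -/
def evLabel (ω : H ⊗[ℂ] Module.Dual ℂ H) : RibbonAlg H m →ₗ[ℂ] Module.End ℂ (Tot H m) :=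
  ((TensorProduct.rid ℂ _).toLinearMap ∘ₗ LinearMap.lTensor _
    ((TensorProduct.lid ℂ ℂ).toLinearMap ∘ₗ TensorProduct.map (ε H) (dualε H) ∘ₗ
      LinearMap.applyₗ ω) :
    Module.End ℂ (Tot H m) ⊗[ℂ] Module.End ℂ (H ⊗[ℂ] Module.Dual ℂ H) →ₗ[ℂ] _)

lemma evLabel_apply (ω : H ⊗[ℂ] Module.Dual ℂ H) (a : Module.End ℂ (Tot H m))
    (b : Module.End ℂ (H ⊗[ℂ] Module.Dual ℂ H)) :
    evLabel ω (totEmb H m a * labelsEmb H m b) =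
      TensorProduct.lid ℂ ℂ (TensorProduct.map (ε H) (dualε H) (b ω)) • a := by
  rw [totEmb_mul_labelsEmb]
  rfl

lemma evLabel_one (h : H) (φ : Module.Dual ℂ H) :
    evLabel (h ⊗ₜ φ) (1 : RibbonAlg H m) = (ε H h * φ 1) • 1 := by
  have := evLabel_apply (m := m) (h ⊗ₜ φ) 1 1
  rwa [map_one, map_one, mul_one] at this

lemma evLabel_edge_mul (ω : H ⊗[ℂ] Module.Dual ℂ H) (a : Module.End ℂ (Tot H m))
    (u : RibbonAlg H m) : evLabel ω (totEmb H m a * u) = a * evLabel ω u := by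
  induction u using RibbonAlg.induction with
  | h0 => simp
  | hadd u v hu hv => rw [mul_add, map_add, map_add, hu, hv, mul_add]
  | hmul b c => rw [← mul_assoc, ← map_mul, evLabel_apply, evLabel_apply, mul_smul_comm]

lemma evLabel_mul_edge (ω : H ⊗[ℂ] Module.Dual ℂ H) (a : Module.End ℂ (Tot H m))
    (u : RibbonAlg H m) : evLabel ω (u * totEmb H m a) = evLabel ω u * a := by
  induction u using RibbonAlg.induction with
  | h0 => simp
  | hadd u v hu hv => rw [add_mul, map_add, map_add, hu, hv, add_mul]
  | hmul b c => rw [mul_assoc, ← (totEmb_commute_labelsEmb _ _).eq, ← mul_assoc, ← map_mul,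
      evLabel_apply, evLabel_apply, smul_mul_assoc]

/-- The rightmost label operator acts on the initial label first, so words of triangles are written
with the first triangle of the ribbon on the right. -/
lemma evLabel_mul_label (ω : H ⊗[ℂ] Module.Dual ℂ H)
    (b : Module.End ℂ (H ⊗[ℂ] Module.Dual ℂ H))
    (u : RibbonAlg H m) : evLabel ω (u * labelsEmb H m b) = evLabel (b ω) u := by
  induction u using RibbonAlg.induction with
  | h0 => simp
  | hadd u v hu hv => rw [add_mul, map_add, map_add, hu, hv]
  | hmul b c => rw [mul_assoc, ← map_mul, evLabel_apply, evLabel_apply, Module.End.mul_apply]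

/-- Label evaluation is a bimodule map over the ladder operators, so commutation with the whole word
descends to all its matrix elements. -/
lemma commute_evLabel {a : Module.End ℂ (Tot H m)} {u : RibbonAlg H m}
    (h : Commute (totEmb H m a) u) (ω : H ⊗[ℂ] Module.Dual ℂ H) : Commute a (evLabel ω u) := by
  change _ * _ = _ * _
  rw [← evLabel_edge_mul, h.eq, evLabel_mul_edge]

lemma evLabel_sum {n : Type*} (s : Finset n) (ω : n → H ⊗[ℂ] Module.Dual ℂ H)
    (u : RibbonAlg H m) : evLabel (∑ i ∈ s, ω i) u = ∑ i ∈ s, evLabel (ω i) u := by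
  induction u using RibbonAlg.induction with
  | h0 => simp
  | hadd u v hu hv => simp only [map_add, hu, hv, Finset.sum_add_distrib]
  | hmul b c => simp only [evLabel_apply, map_sum, Finset.sum_smul]

lemma evLabel_smul (c : ℂ) (ω : H ⊗[ℂ] Module.Dual ℂ H)
    (u : RibbonAlg H m) : evLabel (c • ω) u = c • evLabel ω u := by
  induction u using RibbonAlg.induction with
  | h0 => simp
  | hadd u v hu hv => simp only [map_add, hu, hv, smul_add]
  | hmul b d => simp only [evLabel_apply, map_smul, smul_assoc]

/-! ### Properties of the twist -/

lemma Sinv_S (x : H) : Sinv H (S H x) = x := LinearEquiv.symm_apply_apply _ _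

lemma S_Sinv (x : H) : S H (Sinv H x) = x := LinearEquiv.apply_symm_apply _ _

lemma S_injective : Function.Injective (S H) := LinearEquiv.injective _

lemma Sinv_mul (x y : H) : Sinv H (x * y) = Sinv H y * Sinv H x :=
  S_injective (by rw [S_mul, S_Sinv, S_Sinv, S_Sinv])

section Antimul

variable {A : Type*} [Ring A] [Algebra ℂ A] {F G K : WithConv (H →ₗ[ℂ] A)}

lemma convMul_antimul
    (hF : ∀ x y, F (x * y) = F y * F x) (hG : ∀ x y, G (x * y) = G y * G x)
    (h : ∀ x y, Commute (F x) (G y)) (x y : H) :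
    (F * G : WithConv (H →ₗ[ℂ] A)) (x * y) =
      (F * G : WithConv (H →ₗ[ℂ] A)) y * (F * G : WithConv (H →ₗ[ℂ] A)) x := by
  simp only [convMul_eq_sum, Finset.sum_mul, Finset.mul_sum]
  have := sum_sw_mul (LinearMap.mul' ℂ A ∘ₗ TensorProduct.map F.ofConv G.ofConv) x y
  simp only [LinearMap.comp_apply, TensorProduct.map_tmul, LinearMap.mul'_apply] at this
  rw [this]
  refine Finset.sum_congr rfl fun q _ => Finset.sum_congr rfl fun p _ => ?_
  rw [hF, hG, mul_assoc, ← mul_assoc (F q.1), (h _ _).eq]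
  simp only [mul_assoc]

lemma convMul_convMul_antimul
    (hF : ∀ x y, F (x * y) = F y * F x) (hG : ∀ x y, G (x * y) = G y * G x)
    (hK : ∀ x y, K (x * y) = K y * K x) (h1 : ∀ x y, Commute (F x) (G y))
    (h2 : ∀ x y, Commute (F x) (K y)) (h3 : ∀ x y, Commute (G x) (K y)) (x y : H) :
    (F * (G * K) : WithConv (H →ₗ[ℂ] A)) (x * y) =
      (F * (G * K) : WithConv (H →ₗ[ℂ] A)) y * (F * (G * K) : WithConv (H →ₗ[ℂ] A)) x :=
  convMul_antimul hF (convMul_antimul hG hK h3)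
    (fun x => commute_convMul_apply (h1 x) (h2 x)) x y

lemma convMul_S (F G : WithConv (H →ₗ[ℂ] A)) (x : H) :
    (F * G : WithConv (H →ₗ[ℂ] A)) (S H x) = ∑ q ∈ sw x, F (S H q.2) * G (S H q.1) := by
  rw [convMul_eq_sum]
  exact sum_sw_S (LinearMap.mul' ℂ _ ∘ₗ TensorProduct.map F.ofConv G.ofConv) x

lemma convMul_convMul_S (F G K : WithConv (H →ₗ[ℂ] A)) (x : H) :
    (F * (G * K) : WithConv (H →ₗ[ℂ] A)) (S H x) =
      ∑ p ∈ sw x, F (S H p.2) * ∑ q ∈ sw p.1, G (S H q.2) * K (S H q.1) := by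
  rw [convMul_S]
  simp only [convMul_S]

end Antimul

/-- Right multiplication on the first label. -/
def twistR : H →ₗ[ℂ] Module.End ℂ (H ⊗[ℂ] Module.Dual ℂ H) :=
  (LinearMap.rTensorHom (Module.Dual ℂ H) : Module.End ℂ H →ₗ[ℂ] _) ∘ₗ (LinearMap.mul ℂ H).flip

/-- The operators `φ ↦ φ(x •)` on the second label. -/
def twistM : H →ₗ[ℂ] Module.End ℂ (H ⊗[ℂ] Module.Dual ℂ H) :=
  (LinearMap.lTensorHom H : Module.End ℂ (Module.Dual ℂ H) →ₗ[ℂ] _) ∘ₗ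
    Module.Dual.transpose ∘ₗ LinearMap.mul ℂ H

/-- Left multiplication by `S⁻¹(x)` on the first label. -/
def twistL : H →ₗ[ℂ] Module.End ℂ (H ⊗[ℂ] Module.Dual ℂ H) :=
  (LinearMap.rTensorHom (Module.Dual ℂ H) : Module.End ℂ H →ₗ[ℂ] _) ∘ₗ
    LinearMap.mul ℂ H ∘ₗ Sinv H

lemma twist_eq_convAlong (x : H) : twist x =
    convAlong (A := Module.End ℂ (H ⊗[ℂ] Module.Dual ℂ H)) (Δ H) [twistR, twistM, twistL] x := rfl

lemma twistR_S (x : H) : twistR (S H x) = LinearMap.rTensor (Module.Dual ℂ H) (Xl H x) := rfl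

lemma twistM_S (x : H) : twistM (S H x) =
    LinearMap.lTensor H (Module.Dual.transpose (LinearMap.mul ℂ H (S H x))) := rfl

lemma twistL_S (x : H) : twistL (S H x) = LinearMap.rTensor (Module.Dual ℂ H) (Xr H x) := by
  change LinearMap.rTensor _ (Xr H (Sinv H (S H x))) = _
  rw [Sinv_S]

lemma twistR_mul (x y : H) : twistR (x * y) = twistR y * twistR x := by
  change LinearMap.rTensor _ _ = LinearMap.rTensor _ _ * LinearMap.rTensor _ _
  rw [← LinearMap.rTensor_mul]
  exact congrArg _ (Xt_mul x y)

lemma twistM_mul (x y : H) : twistM (x * y) = twistM y * twistM x := by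
  change LinearMap.lTensor H _ = LinearMap.lTensor H _ * LinearMap.lTensor H _
  rw [← LinearMap.lTensor_mul]
  congr 1
  ext φ z
  exact congrArg φ (mul_assoc _ _ _)

lemma twistL_mul (x y : H) : twistL (x * y) = twistL y * twistL x := by
  change LinearMap.rTensor _ (Xr H _) = LinearMap.rTensor _ (Xr H _) * LinearMap.rTensor _ (Xr H _)
  rw [← LinearMap.rTensor_mul, Sinv_mul, Xr_mul]

lemma twistR_commute_twistL (x y : H) : Commute (twistR x) (twistL y) := by
  change LinearMap.rTensor _ (Xt H _) * LinearMap.rTensor _ (Xr H _) =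
    LinearMap.rTensor _ (Xr H _) * LinearMap.rTensor _ (Xt H _)
  rw [← LinearMap.rTensor_mul, ← LinearMap.rTensor_mul, (Xr_commute_Xt _ _).eq]

lemma convAlong_three_mul {A : Type*} [Ring A] [Algebra ℂ A] {f g k : H →ₗ[ℂ] A}
    (hF : ∀ x y, f (x * y) = f y * f x) (hG : ∀ x y, g (x * y) = g y * g x)
    (hK : ∀ x y, k (x * y) = k y * k x) (h1 : ∀ x y, Commute (f x) (g y))
    (h2 : ∀ x y, Commute (f x) (k y)) (h3 : ∀ x y, Commute (g x) (k y)) (x y : H) :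
    convAlong (Δ H) [f, g, k] (x * y) =
      convAlong (Δ H) [f, g, k] y * convAlong (Δ H) [f, g, k] x :=
  convMul_convMul_antimul (F := toConv f) (G := toConv g) (K := toConv k) hF hG hK h1 h2 h3 x y

lemma convAlong_three_S {A : Type*} [Ring A] [Algebra ℂ A] (f g k : H →ₗ[ℂ] A) (x : H) :
    convAlong (Δ H) [f, g, k] (S H x) =
      ∑ p ∈ sw x, f (S H p.2) * ∑ q ∈ sw p.1, g (S H q.2) * k (S H q.1) :=
  convMul_convMul_S (toConv f) (toConv g) (toConv k) x

/-- The twist is a right action of H, built from three mutually commuting antimultiplicative maps.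
Its use is twist(a) twist(1) = twist(a) although twist(1) need not be the identity. -/
lemma twist_mul (x y : H) : twist (x * y) = twist y * twist x := by
  simp only [twist_eq_convAlong]
  exact convAlong_three_mul twistR_mul twistM_mul twistL_mul
    (fun _ _ => rTensor_commute_lTensor _ _) twistR_commute_twistL
    (fun _ _ => (rTensor_commute_lTensor _ _).symm) x y

lemma twist_S (x : H) : twist (S H x) = ∑ p ∈ sw x, twistR (S H p.2) *
    ∑ q ∈ sw p.1, twistM (S H q.2) * twistL (S H q.1) := by
  rw [twist_eq_convAlong]
  exact convAlong_three_S _ _ _ x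

/-- At k = S(x) the legs are k⁽¹⁾ = S(x⁽³⁾), k⁽²⁾ = S(x⁽²⁾), k⁽³⁾ = S(x⁽¹⁾). The S⁻¹ of the twist
cancels, which leaves ordinary Pauli operators on the labels. -/
lemma labelsEmb_twist_S (x : H) : labelsEmb H m (twist (S H x)) =
    ∑ p ∈ sw x, labelEmb (Xl H p.2) * ∑ q ∈ sw p.1, dualLabelEmb q.2 * labelEmb (Xr H q.1) := by
  have h3 (x : H) : labelsEmb H m (twistR (S H x)) = labelEmb (Xl H x) := by
    rw [labelEmb_apply, twistR_S]
  have h4 (x : H) : labelsEmb H m (twistM (S H x)) = dualLabelEmb x := by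
    rw [dualLabelEmb_apply, twistM_S]
  have h5 (x : H) : labelsEmb H m (twistL (S H x)) = labelEmb (Xr H x) := by
    rw [labelEmb_apply, twistL_S]
  rw [twist_S, map_sum]
  simp only [map_mul, map_sum, h3, h4, h5]

end Ribbon

end WeakHopfCluster

namespace WeakHopfCluster

/-! ### The ribbon operator as a matrix element of a word of triangles -/

section RibbonWord

variable {H : Type*} [Ring H] [Algebra ℂ H] [WeakHopfAlgebra H] [FiniteDimensional ℂ H] {m : ℕ}

/-- Successive controlled operators on the same control read successive Sweedler legs, the right
factor reading the first leg. -/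
lemma ctrl_eq_mul {A : Type*} [Ring A] [Algebra ℂ A] {ι : Module.End ℂ H →ₐ[ℂ] A}
    {f g k : H →ₗ[ℂ] A} (hf : ∀ a x, Commute (ι a) (f x))
    (hk : ∀ x, k x = ∑ p ∈ sw x, f p.2 * g p.1) : ctrl ι k = ctrl ι f * ctrl ι g := by
  have h := sum_Zs_sw (ι := ι)
    (LinearMap.mul' ℂ A ∘ₗ (TensorProduct.comm ℂ A A).toLinearMap ∘ₗ TensorProduct.map g f)
  simp only [LinearMap.comp_apply, TensorProduct.map_tmul, LinearEquiv.coe_coe,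
    TensorProduct.comm_tmul, LinearMap.mul'_apply] at h
  simp only [ctrl, hk, Finset.mul_sum, Finset.sum_mul]
  rw [h]
  refine Finset.sum_congr rfl fun i _ => Finset.sum_congr rfl fun j _ => ?_
  rw [mul_assoc, ← mul_assoc (ι _) (f _), (hf _ _).eq]
  simp only [mul_assoc]

/-- The substitution k = S(x) in the canonical element turns the sum over k of `Zl` and the twist
into a control by x of three label operators, which then splits into the three factors of
`directOp`. -/
lemma directOp_eq_sum_of_antipode {A : Type*} [Ring A] [Algebra ℂ A]
    {κ ι : Module.End ℂ H →ₐ[ℂ] A} {Φ T : H →ₗ[ℂ] A} (hκ : ∀ a b, Commute (ι a) (κ b))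
    (hΦ : ∀ a x, Commute (ι a) (Φ x))
    (hT : ∀ x, T (S H x) = ∑ p ∈ sw x, κ (Xl H p.2) * ∑ q ∈ sw p.1, Φ q.2 * κ (Xr H q.1)) :
    directOp κ Φ ι = ∑ a, ι (Zl H ((bas H).coord a)) * T (bas H a) := by
  let k₂ : H →ₗ[ℂ] A := LinearMap.mul' ℂ _ ∘ₗ (TensorProduct.comm ℂ _ _).toLinearMap ∘ₗ
      TensorProduct.map (κ.toLinearMap ∘ₗ Xr H) Φ ∘ₗ Δ H
  have hk₂ (x : H) : k₂ x = ∑ q ∈ sw x, Φ q.2 * κ (Xr H q.1) := by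
    simp only [k₂, LinearMap.comp_apply, Δ_eq_sum, map_sum, TensorProduct.map_tmul,
      LinearEquiv.coe_coe, TensorProduct.comm_tmul, LinearMap.mul'_apply,
      AlgHom.toLinearMap_apply]
  have h1 := sum_coord_comp (H := H) (LinearMap.mul' ℂ A ∘ₗ
    TensorProduct.map (ι.toLinearMap ∘ₗ Zs H) T) (S H)
  simp only [LinearMap.comp_apply, TensorProduct.map_tmul, LinearMap.mul'_apply,
    AlgHom.toLinearMap_apply] at h1
  rw [directOp, mul_assoc, ← ctrl_eq_mul (k := k₂) hΦ hk₂,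
    ← ctrl_eq_mul (k := T ∘ₗ S H) (fun a x => hκ _ _) fun x => ?_]
  · exact h1.symm
  · simp only [hk₂]
    exact hT x

lemma directOp_eq_sum (e : Edge m) :
    directOp labelEmb dualLabelEmb (edgeEmb e : Module.End ℂ H →ₐ[ℂ] RibbonAlg H m) =
      ∑ a, edgeEmb e (Zl H ((bas H).coord a)) * labelsEmb H m (twist (bas H a)) :=
  directOp_eq_sum_of_antipode (T := (labelsEmb H m).toLinearMap ∘ₗ twist)
    (fun _ _ => (labelEmb_commute_edgeEmb _ _ _).symm)
    (fun _ _ => edgeEmb_commute_dualLabelEmb _ _ _) labelsEmb_twist_S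

lemma directOp_mul_twist_one (e : Edge m) :
    directOp labelEmb dualLabelEmb (edgeEmb e : Module.End ℂ H →ₐ[ℂ] RibbonAlg H m) *
      labelsEmb H m (twist 1) =
    directOp labelEmb dualLabelEmb (edgeEmb e : Module.End ℂ H →ₐ[ℂ] RibbonAlg H m) := by
  rw [directOp_eq_sum, Finset.sum_mul]
  refine Finset.sum_congr rfl fun a _ => ?_
  rw [mul_assoc, ← map_mul, ← twist_mul, one_mul]

lemma conv_doubleΔ {A : Type*} [Ring A] [Algebra ℂ A] (F G : H ⊗[ℂ] Module.Dual ℂ H →ₗ[ℂ] A)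
    (h : H) (φ : Module.Dual ℂ H) : conv (doubleΔ H) F G (h ⊗ₜ φ) =
      ∑ a, ∑ p ∈ sw h, F (p.1 ⊗ₜ (bas H).coord a) * G (twist (bas H a) (p.2 ⊗ₜ φ)) := by
  simp only [conv, doubleΔ, LinearMap.comp_apply, TensorProduct.map_tmul, Δ_eq_sum,
    TensorProduct.sum_tmul, map_sum, LinearEquiv.coe_coe, TensorProduct.assoc_tmul,
    LinearMap.sum_apply, LinearMap.mul'_apply, LinearMap.id_apply]
  rw [Finset.sum_comm]
  rfl

lemma dualTriangle_tmul (i : Fin (m + 2)) (h : H) (φ : Module.Dual ℂ H) :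
    dualTriangle i (h ⊗ₜ φ) = φ 1 • onEdge (Sum.inl i : Edge m) (Xt H h) := by
  simp [dualTriangle, dualε, onVert]

lemma directTriangle_tmul (j : Fin (m + 1)) (h : H) (φ : Module.Dual ℂ H) :
    directTriangle j (h ⊗ₜ φ) = ε H h • onEdge (Sum.inr j : Edge m) (Zl H φ) := by
  simp [directTriangle, onHoriz]

/-- A dual triangle evaluates k̂ at 1, so the sum over k collapses to twist(1). This is not the
identity in a weak Hopf algebra and has to be absorbed by the next direct triangle. -/
lemma conv_dualTriangle (i : Fin (m + 2))
    (G : H ⊗[ℂ] Module.Dual ℂ H →ₗ[ℂ] Module.End ℂ (Tot H m)) (h : H) (φ : Module.Dual ℂ H) :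
    conv (doubleΔ H) (dualTriangle i) G (h ⊗ₜ φ) =
      ∑ p ∈ sw h, onEdge (Sum.inl i : Edge m) (Xt H p.1) * G (twist 1 (p.2 ⊗ₜ φ)) := by
  rw [conv_doubleΔ, Finset.sum_comm]
  refine Finset.sum_congr rfl fun p _ => ?_
  have h1 : (twist (1 : H)) = ∑ a, (bas H).coord a 1 • twist (bas H a) := by
    conv_lhs => rw [← (bas H).sum_repr 1]
    simp only [map_sum, map_smul]
    rfl
  rw [h1]
  simp only [dualTriangle_tmul, LinearMap.sum_apply, LinearMap.smul_apply, map_sum, map_smul,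
    Finset.mul_sum, smul_mul_assoc, mul_smul_comm]

lemma conv_directTriangle (j : Fin (m + 1))
    (G : H ⊗[ℂ] Module.Dual ℂ H →ₗ[ℂ] Module.End ℂ (Tot H m)) (ω : H ⊗[ℂ] Module.Dual ℂ H) :
    conv (doubleΔ H) (directTriangle j) G ω =
      ∑ a, onEdge (Sum.inr j : Edge m) (Zl H ((bas H).coord a)) * G (twist (bas H a) ω) := by
  induction ω using TensorProduct.induction_on with
  | zero => simp
  | add u v hu hv => simp only [map_add, hu, hv, mul_add, Finset.sum_add_distrib]
  | tmul h φ =>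
    rw [conv_doubleΔ]
    refine Finset.sum_congr rfl fun a _ => ?_
    have h1 : h = ∑ p ∈ sw h, ε H p.1 • p.2 := (sum_sw_counit_left h).symm
    conv_rhs => rw [h1]
    simp only [directTriangle_tmul, TensorProduct.sum_tmul, ← TensorProduct.smul_tmul', map_sum,
      map_smul, Finset.mul_sum, smul_mul_assoc, mul_smul_comm]

/-- The dual triangle across an edge. -/
abbrev dualMat (i : Fin (m + 2)) : RibbonAlg H m := dualOp labelEmb (edgeEmb (Sum.inl i))

/-- The direct triangle along an edge. -/
abbrev directMat (j : Fin (m + 1)) : RibbonAlg H m :=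
  directOp labelEmb dualLabelEmb (edgeEmb (Sum.inr j))

lemma evLabel_zero (u : RibbonAlg H m) : evLabel 0 u = 0 := by
  simpa using evLabel_smul 0 0 u

lemma evLabel_add (ω ω' : H ⊗[ℂ] Module.Dual ℂ H) (u : RibbonAlg H m) :
    evLabel (ω + ω') u = evLabel ω u + evLabel ω' u := by
  simpa using evLabel_sum Finset.univ ![ω, ω'] u

/-- A dual triangle reads h⁽¹⁾ onto the edge and passes h⁽²⁾ on. The hypothesis lets the edge
operator be pulled out in front of the later triangles. -/
lemma evLabel_mul_dualMat {i : Fin (m + 2)} {u : RibbonAlg H m}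
    (hu : ∀ a, Commute u (edgeEmb (Sum.inl i) a)) (h : H) (φ : Module.Dual ℂ H) :
    evLabel (h ⊗ₜ φ) (u * dualMat i) =
      ∑ p ∈ sw h, onEdge (Sum.inl i : Edge m) (Xt H p.1) * evLabel (p.2 ⊗ₜ φ) u := by
  have h1 (a) : evLabel (h ⊗ₜ φ)
      (u * (labelEmb (Zs H ((bas H).coord a)) * edgeEmb (Sum.inl i) (Xt H (bas H a)))) =
      ∑ p ∈ sw h, onEdge (Sum.inl i : Edge m) (Xt H ((bas H).coord a p.1 • bas H a)) *
        evLabel (p.2 ⊗ₜ φ) u := by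
    rw [(labelEmb_commute_edgeEmb _ _ _).eq, ← mul_assoc, (hu _).eq, mul_assoc, edgeEmb_apply,
      evLabel_edge_mul, labelEmb_apply, evLabel_mul_label, LinearMap.rTensor_tmul, Zs_eq_sum,
      TensorProduct.sum_tmul, evLabel_sum, Finset.mul_sum]
    refine Finset.sum_congr rfl fun p _ => ?_
    rw [← TensorProduct.smul_tmul', evLabel_smul, map_smul, map_smul, smul_mul_assoc,
      mul_smul_comm]
  rw [dualMat, dualOp, ctrl, Finset.mul_sum, map_sum]
  refine (Finset.sum_congr rfl fun a _ => h1 a).trans ?_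
  rw [Finset.sum_comm]
  refine Finset.sum_congr rfl fun p _ => ?_
  rw [← Finset.sum_mul, ← map_sum, ← map_sum]
  exact congrArg (fun x => onEdge (Sum.inl i : Edge m) (Xt H x) * evLabel (p.2 ⊗ₜ φ) u)
    ((bas H).sum_repr p.1)

lemma evLabel_mul_directMat {j : Fin (m + 1)} {u : RibbonAlg H m}
    (hu : ∀ a, Commute u (edgeEmb (Sum.inr j) a)) (ω : H ⊗[ℂ] Module.Dual ℂ H) :
    evLabel ω (u * directMat j) =
      ∑ a, onEdge (Sum.inr j : Edge m) (Zl H ((bas H).coord a)) *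
        evLabel (twist (bas H a) ω) u := by
  rw [directMat, directOp_eq_sum, Finset.mul_sum, map_sum]
  refine Finset.sum_congr rfl fun a _ => ?_
  rw [← mul_assoc, (hu _).eq, mul_assoc, edgeEmb_apply, evLabel_edge_mul, evLabel_mul_label]

/-- The product of the operators of the triangles `r_{j+1}`, `s_j` with `j` in the list. -/
def ribbonMat (l : List (Fin (m + 1))) : RibbonAlg H m :=
  l.foldr (fun j D => D * (dualMat j.succ * directMat j)) 1

lemma ribbonMat_nil : (ribbonMat [] : RibbonAlg H m) = 1 := rfl

lemma ribbonMat_cons (j : Fin (m + 1)) (l) :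
    (ribbonMat (j :: l) : RibbonAlg H m) = ribbonMat l * (dualMat j.succ * directMat j) := rfl

lemma ribbonMat_append (l l' : List (Fin (m + 1))) :
    (ribbonMat (l ++ l') : RibbonAlg H m) = ribbonMat l' * ribbonMat l := by
  induction l with
  | nil => simp [ribbonMat_nil]
  | cons j l ih => rw [List.cons_append, ribbonMat_cons, ih, ribbonMat_cons, mul_assoc]

lemma commute_dualMat {u : RibbonAlg H m} {i : Fin (m + 2)} (h1 : ∀ a, Commute u (labelEmb a))
    (h2 : ∀ a, Commute u (edgeEmb (Sum.inl i) a)) : Commute u (dualMat i) :=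
  dualOp_commute h1 h2

lemma commute_directMat {u : RibbonAlg H m} {j : Fin (m + 1)} (h1 : ∀ a, Commute u (labelEmb a))
    (h2 : ∀ x, Commute u (dualLabelEmb x))
    (h3 : ∀ a, Commute u (edgeEmb (Sum.inr j) a)) : Commute u (directMat j) :=
  directOp_commute h1 h2 h3

lemma commute_ribbonMat {u : RibbonAlg H m} {l : List (Fin (m + 1))}
    (h1 : ∀ a, Commute u (labelEmb a)) (h2 : ∀ x, Commute u (dualLabelEmb x))
    (h3 : ∀ j ∈ l, ∀ a, Commute u (edgeEmb (Sum.inr j) a))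
    (h4 : ∀ j ∈ l, ∀ a, Commute u (edgeEmb (Sum.inl j.succ) a)) : Commute u (ribbonMat l) := by
  induction l with
  | nil => exact Commute.one_right _
  | cons j l ih =>
    exact (ih (fun j hj => h3 j (List.mem_cons_of_mem _ hj))
      (fun j hj => h4 j (List.mem_cons_of_mem _ hj))).mul_right
      ((commute_dualMat h1 (h4 j List.mem_cons_self)).mul_right
        (commute_directMat h1 h2 (h3 j List.mem_cons_self)))

lemma commute_edgeEmb_ribbonMat {e : Edge m} {l : List (Fin (m + 1))}
    (h1 : ∀ j ∈ l, e ≠ Sum.inr j) (h2 : ∀ j ∈ l, e ≠ Sum.inl j.succ) (a : Module.End ℂ H) :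
    Commute (edgeEmb e a) (ribbonMat l) :=
  commute_ribbonMat (fun _ => (labelEmb_commute_edgeEmb _ _ _).symm)
    (fun _ => edgeEmb_commute_dualLabelEmb _ _ _) (fun j hj _ => edgeEmb_commute (h1 j hj) _ _)
    (fun j hj _ => edgeEmb_commute (h2 j hj) _ _)

/-- One step of the recursion. The dual and the direct triangle are treated together because the
twist(1) of the former disappears only inside the latter. -/
lemma conv_dualTriangle_directTriangle {i : Fin (m + 2)} {j : Fin (m + 1)} {u : RibbonAlg H m}
    (h1 : ∀ a, Commute u (edgeEmb (Sum.inr j) a))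
    (h2 : ∀ a, Commute (u * directMat j) (edgeEmb (Sum.inl i) a))
    {G : H ⊗[ℂ] Module.Dual ℂ H →ₗ[ℂ] Module.End ℂ (Tot H m)} (hG : ∀ ω, G ω = evLabel ω u)
    (ω : H ⊗[ℂ] Module.Dual ℂ H) :
    conv (doubleΔ H) (dualTriangle i) (conv (doubleΔ H) (directTriangle j) G) ω =
      evLabel ω (u * directMat j * dualMat i) := by
  induction ω using TensorProduct.induction_on with
  | zero => rw [map_zero, evLabel_zero]
  | add u v hu hv => rw [map_add, hu, hv, evLabel_add]
  | tmul h φ =>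
    rw [conv_dualTriangle, evLabel_mul_dualMat h2]
    refine Finset.sum_congr rfl fun p _ => ?_
    rw [conv_directTriangle]
    simp only [hG]
    rw [← evLabel_mul_directMat h1, ← evLabel_mul_label, mul_assoc,
      directOp_mul_twist_one]

/-- Peel off pairs of a dual and a direct triangle. The ribbon ends with a dual triangle, so every
twist(1) is followed by a direct triangle. Distinctness of the edges supplies the commutations
needed to extract their operators. -/
lemma convAlong_ribbon (l : List (Fin (m + 1))) (hl : l.Nodup) (i : Fin (m + 2))
    (hi : ∀ j ∈ l, j.succ ≠ i) (ω : H ⊗[ℂ] Module.Dual ℂ H) :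
    convAlong (doubleΔ H)
      (dualTriangle i :: l.flatMap fun j => [directTriangle j, dualTriangle j.succ]) ω =
      evLabel ω (ribbonMat l * dualMat i) := by
  induction l generalizing i ω with
  | nil =>
    induction ω using TensorProduct.induction_on with
    | zero => rw [map_zero, evLabel_zero]
    | add u v hu hv => rw [map_add, hu, hv, evLabel_add]
    | tmul h φ =>
      rw [ribbonMat_nil, evLabel_mul_dualMat fun _ => Commute.one_left _]
      change dualTriangle i (h ⊗ₜ φ) = _
      simp only [evLabel_one, mul_smul_comm, mul_one, dualTriangle_tmul]
      have h2 : h = ∑ p ∈ sw h, ε H p.2 • p.1 := (sum_sw_counit_right h).symm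
      conv_lhs => rw [h2]
      simp only [map_sum, map_smul, Finset.smul_sum, smul_smul, mul_comm]
  | cons j l ih =>
    have hj : j ∉ l := (List.nodup_cons.1 hl).1
    have ih' := ih (List.nodup_cons.1 hl).2 j.succ fun k hk h => by
      rw [Fin.succ_inj] at h
      exact hj (h ▸ hk)
    have hc1 (a : Module.End ℂ H) : Commute (ribbonMat l * dualMat j.succ)
        (edgeEmb (Sum.inr j : Edge m) a) := by
      refine ((commute_edgeEmb_ribbonMat (fun k hk h => ?_) (fun k hk h => ?_) a).mul_right
        (commute_dualMat (fun _ => (labelEmb_commute_edgeEmb _ _ _).symm)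
          fun _ => edgeEmb_commute (by simp) _ _)).symm
      · exact hj (Sum.inr.inj h ▸ hk)
      · exact absurd h (by simp)
    have hc2 (a : Module.End ℂ H) : Commute (ribbonMat l * dualMat j.succ * directMat j)
        (edgeEmb (Sum.inl i : Edge m) a) := by
      have := (commute_edgeEmb_ribbonMat (e := Sum.inl i) (l := j :: l)
        (fun k hk h => absurd h (by simp)) (fun k hk h => hi k hk (Sum.inl.inj h).symm) a).symm
      rwa [ribbonMat_cons, ← mul_assoc] at this
    rw [ribbonMat_cons, ← mul_assoc]
    exact conv_dualTriangle_directTriangle hc1 hc2 ih' ω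

lemma ribbonOp_eq_evLabel (h : H) (φ : Module.Dual ℂ H) :
    ribbonOp m h φ = evLabel (h ⊗ₜ φ) (ribbonMat (List.finRange (m + 1)) * dualMat 0) :=
  convAlong_ribbon _ (List.nodup_finRange _) 0 (fun j _ => Fin.succ_ne_zero j) _

lemma exists_finRange_eq_append (i : Fin m) : ∃ l₁ l₂ : List (Fin (m + 1)),
    List.finRange (m + 1) = l₁ ++ ([i.castSucc, i.succ] ++ l₂) := by
  refine ⟨(List.finRange (m + 1)).take i, (List.finRange (m + 1)).drop (i + 2), ?_⟩
  conv_lhs => rw [← List.take_append_drop (i : ℕ) (List.finRange (m + 1))]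
  have h1 : (i : ℕ) < (List.finRange (m + 1)).length := by
    rw [List.length_finRange]; omega
  have h2 : (i : ℕ) + 1 < (List.finRange (m + 1)).length := by simp
  rw [List.drop_eq_getElem_cons h1, List.drop_eq_getElem_cons h2]
  simp only [List.getElem_finRange, List.cons_append, List.nil_append]
  rfl

lemma notMem_of_finRange_eq {i : Fin m} {l₁ l₂ : List (Fin (m + 1))}
    (h : List.finRange (m + 1) = l₁ ++ ([i.castSucc, i.succ] ++ l₂)) {j : Fin (m + 1)}
    (hj : j ∈ l₁ ∨ j ∈ l₂) : j ≠ i.castSucc ∧ j ≠ i.succ := by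
  have hn := List.nodup_finRange (m + 1)
  rw [h] at hn
  simp only [List.cons_append, List.nil_append, List.nodup_append, List.nodup_cons,
    List.mem_cons] at hn
  constructor
  · rintro rfl
    rcases hj with hj | hj
    · exact hn.2.2 _ hj _ (Or.inl rfl) rfl
    · exact hn.2.1.1 (Or.inr hj)
  · rintro rfl
    rcases hj with hj | hj
    · exact hn.2.2 _ hj _ (Or.inr (Or.inl rfl)) rfl
    · exact hn.2.1.2.1 hj

end RibbonWord

end WeakHopfCluster

namespace WeakHopfCluster

/-! ### The ribbon commutes with all vertex and face operators -/

section RibbonCommute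

lemma algHom_convMul_apply {C A B : Type*} [AddCommGroup C] [Module ℂ C] [Coalgebra ℂ C]
    [Ring A] [Algebra ℂ A] [Ring B] [Algebra ℂ B] (θ : A →ₐ[ℂ] B)
    (f : C →ₗ[ℂ] A) (F : WithConv (C →ₗ[ℂ] A)) (c : C) :
    θ ((toConv f * F : WithConv (C →ₗ[ℂ] A)) c) =
      (toConv (θ.toLinearMap ∘ₗ f) * toConv (θ.toLinearMap ∘ₗ F.ofConv) :
        WithConv (C →ₗ[ℂ] B)) c := by
  rw [convMul_eq_sum, convMul_eq_sum, map_sum]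
  simp only [map_mul]
  rfl

lemma algHom_convMul_convMul_apply {C A B : Type*} [AddCommGroup C] [Module ℂ C] [Coalgebra ℂ C]
    [Ring A] [Algebra ℂ A] [Ring B] [Algebra ℂ B] (θ : A →ₐ[ℂ] B)
    (f g k : C →ₗ[ℂ] A) (c : C) :
    θ ((toConv f * (toConv g * toConv k) : WithConv (C →ₗ[ℂ] A)) c) =
      (toConv (θ.toLinearMap ∘ₗ f) * (toConv (θ.toLinearMap ∘ₗ g) *
        toConv (θ.toLinearMap ∘ₗ k)) : WithConv (C →ₗ[ℂ] B)) c := by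
  rw [algHom_convMul_apply]
  congr 3
  ext c
  exact algHom_convMul_apply θ g (toConv k) c

variable {H : Type*} [Ring H] [Algebra ℂ H] [WeakHopfAlgebra H] {m : ℕ}

lemma vertexOp_apply (i : Fin m) (g : H) : vertexOp i g =
    (toConv (onHoriz H (Xl H) i.succ) * (toConv (onVert H (Xl H) i.succ.castSucc) *
      toConv (onHoriz H (Xr H) i.castSucc)) : WithConv (H →ₗ[ℂ] Module.End ℂ (Tot H m))) g := rfl

lemma totEmb_vertexOp (i : Fin m) (g : H) : totEmb H m (vertexOp i g) =
    (emb (edgeEmb (Sum.inr i.succ)) (Xl H) * (emb (edgeEmb (Sum.inl i.succ.castSucc)) (Xl H) *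
      emb (edgeEmb (Sum.inr i.castSucc)) (Xr H)) : WithConv (H →ₗ[ℂ] RibbonAlg H m)) g := by
  rw [vertexOp_apply, algHom_convMul_convMul_apply]
  rfl

lemma commute_vertexOp {u : Module.End ℂ (Tot H m)} {i : Fin m}
    (h1 : ∀ a, Commute u (onEdge (Sum.inr i.succ) a))
    (h2 : ∀ a, Commute u (onEdge (Sum.inl i.succ.castSucc) a))
    (h3 : ∀ a, Commute u (onEdge (Sum.inr i.castSucc) a)) (g : H) : Commute u (vertexOp i g) := by
  rw [vertexOp_apply]
  exact commute_convMul_apply (fun x => h1 (Xl H x))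
    (fun x => commute_convMul_apply (fun y => h2 (Xl H y)) (fun y => h3 (Xr H y)) x) g

lemma totEmb_vertexOp_commute_edgeEmb {i : Fin m} {e : Edge m} (h1 : e ≠ Sum.inr i.succ)
    (h2 : e ≠ Sum.inl i.succ.castSucc) (h3 : e ≠ Sum.inr i.castSucc) (g : H)
    (a : Module.End ℂ H) : Commute (totEmb H m (vertexOp i g)) (edgeEmb e a) :=
  (commute_vertexOp (fun _ => onEdge_commute h1 _ _) (fun _ => onEdge_commute h2 _ _)
    (fun _ => onEdge_commute h3 _ _) g).symm.map (totEmb H m)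

variable [FiniteDimensional ℂ H]

lemma faceOp_apply (j : Fin (m + 1)) (ψ : Module.Dual ℂ H) : faceOp j ψ =
    (toConv (onVert H (Zr H) j.castSucc) * (toConv (onHoriz H (Zl H) j) *
      toConv (onVert H (Zl H) j.succ)) :
        WithConv (Module.Dual ℂ H →ₗ[ℂ] Module.End ℂ (Tot H m))) ψ := rfl

lemma totEmb_faceOp (j : Fin (m + 1)) (ψ : Module.Dual ℂ H) : totEmb H m (faceOp j ψ) =
    (emb (edgeEmb (Sum.inl j.castSucc)) (Zr H) * (emb (edgeEmb (Sum.inr j)) (Zl H) *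
      emb (edgeEmb (Sum.inl j.succ)) (Zl H)) :
        WithConv (Module.Dual ℂ H →ₗ[ℂ] RibbonAlg H m)) ψ := by
  rw [faceOp_apply, algHom_convMul_convMul_apply]
  rfl

lemma commute_faceOp {u : Module.End ℂ (Tot H m)} {j : Fin (m + 1)}
    (h1 : ∀ a, Commute u (onEdge (Sum.inl j.castSucc) a))
    (h2 : ∀ a, Commute u (onEdge (Sum.inr j) a))
    (h3 : ∀ a, Commute u (onEdge (Sum.inl j.succ) a)) (ψ : Module.Dual ℂ H) :
    Commute u (faceOp j ψ) := by
  rw [faceOp_apply]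
  exact commute_convMul_apply (fun χ => h1 (Zr H χ))
    (fun χ => commute_convMul_apply (fun χ' => h2 (Zl H χ')) (fun χ' => h3 (Zl H χ')) χ) ψ

lemma totEmb_faceOp_commute_edgeEmb {j : Fin (m + 1)} {e : Edge m} (h1 : e ≠ Sum.inl j.castSucc)
    (h2 : e ≠ Sum.inr j) (h3 : e ≠ Sum.inl j.succ) (ψ : Module.Dual ℂ H)
    (a : Module.End ℂ H) : Commute (totEmb H m (faceOp j ψ)) (edgeEmb e a) :=
  (commute_faceOp (fun _ => onEdge_commute h1 _ _) (fun _ => onEdge_commute h2 _ _)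
    (fun _ => onEdge_commute h3 _ _) ψ).symm.map (totEmb H m)

lemma vertexOp_commute_word (i : Fin m) (g : H) :
    Commute (totEmb H m (vertexOp i g))
      (directMat i.succ * dualMat i.succ.castSucc * directMat i.castSucc) := by
  rw [totEmb_vertexOp]
  refine (commute_apply (commute_vertex_conv dualLabelEmb_mul labelEmb_commute_dualLabelEmb
    (labelEmb_commute_edgeEmb _) (labelEmb_commute_edgeEmb _) (labelEmb_commute_edgeEmb _)
    (edgeEmb_commute (by simp)) (edgeEmb_commute ?_) (edgeEmb_commute (by simp))
    (edgeEmb_commute_dualLabelEmb _) (edgeEmb_commute_dualLabelEmb _)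
    (edgeEmb_commute_dualLabelEmb _)) g).symm
  simp only [ne_eq, Sum.inr.injEq]
  exact (Fin.castSucc_lt_succ).ne

lemma faceOp_commute_word (j : Fin (m + 1)) (ψ : Module.Dual ℂ H) :
    Commute (totEmb H m (faceOp j ψ)) (dualMat j.succ * directMat j * dualMat j.castSucc) := by
  rw [totEmb_faceOp]
  refine (commute_apply (commute_face_conv labelEmb_commute_dualLabelEmb
    (labelEmb_commute_edgeEmb _) (labelEmb_commute_edgeEmb _) (labelEmb_commute_edgeEmb _)
    (edgeEmb_commute (by simp)) (edgeEmb_commute ?_) (edgeEmb_commute (by simp))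
    (edgeEmb_commute_dualLabelEmb _) (edgeEmb_commute_dualLabelEmb _)) ψ).symm
  simp only [ne_eq, Sum.inl.injEq]
  exact (Fin.castSucc_lt_succ).ne

lemma totEmb_commute_labelEmb (u : Module.End ℂ (Tot H m)) (a : Module.End ℂ H) :
    Commute (totEmb H m u) (labelEmb a) :=
  totEmb_commute_labelsEmb _ _

lemma totEmb_commute_dualLabelEmb (u : Module.End ℂ (Tot H m)) (x : H) :
    Commute (totEmb H m u) (dualLabelEmb x) :=
  totEmb_commute_labelsEmb _ _

theorem ribbonOp_commute_vertexOp (h : H) (φ : Module.Dual ℂ H) (i : Fin m) (g : H) :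
    Commute (ribbonOp m h φ) (vertexOp i g) := by
  rw [ribbonOp_eq_evLabel]
  refine (commute_evLabel ?_ _).symm
  obtain ⟨l₁, l₂, hl⟩ := exists_finRange_eq_append i
  have hmem {l : List (Fin (m + 1))} (h : ∀ j ∈ l, j ∈ l₁ ∨ j ∈ l₂) :
      Commute (totEmb H m (vertexOp i g)) (ribbonMat l) := by
    refine commute_ribbonMat (totEmb_commute_labelEmb _) (totEmb_commute_dualLabelEmb _)
      (fun j hj => totEmb_vertexOp_commute_edgeEmb ?_ (by simp) ?_ g)
      (fun j hj => totEmb_vertexOp_commute_edgeEmb (by simp) ?_ (by simp) g)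
    · simpa using (notMem_of_finRange_eq hl (h j hj)).2
    · simpa using (notMem_of_finRange_eq hl (h j hj)).1
    · have := (notMem_of_finRange_eq hl (h j hj)).1
      rw [← Fin.succ_castSucc]
      simpa using this
  have hmid : Commute (totEmb H m (vertexOp i g)) (ribbonMat [i.castSucc, i.succ]) := by
    -- Each list entry carries a direct triangle and the dual triangle after it. The window for the
    -- vertex is s_i, r_{i+1}, s_{i+1}, so the dual triangle across r_{i+2} is split off.
    have h1 : (ribbonMat [i.castSucc, i.succ] : RibbonAlg H m) = dualMat i.succ.succ *
        (directMat i.succ * dualMat i.succ.castSucc * directMat i.castSucc) := by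
      simp only [ribbonMat_cons, ribbonMat_nil, one_mul, mul_assoc, Fin.succ_castSucc]
    rw [h1]
    refine (commute_dualMat (totEmb_commute_labelEmb _) ?_).mul_right (vertexOp_commute_word i g)
    refine totEmb_vertexOp_commute_edgeEmb (by simp) ?_ (by simp) g
    simp only [ne_eq, Sum.inl.injEq]
    exact (Fin.castSucc_lt_succ).ne'
  rw [hl, ribbonMat_append, ribbonMat_append]
  refine (((hmem fun j hj => Or.inr hj).mul_right hmid).mul_right
    (hmem fun j hj => Or.inl hj)).mul_right (commute_dualMat (totEmb_commute_labelEmb _) ?_)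
  refine totEmb_vertexOp_commute_edgeEmb (by simp) ?_ (by simp) g
  simp only [ne_eq, Sum.inl.injEq]
  rw [← Fin.succ_castSucc]
  exact (Fin.succ_ne_zero _).symm

theorem ribbonOp_commute_faceOp (h : H) (φ : Module.Dual ℂ H) (j : Fin (m + 1))
    (ψ : Module.Dual ℂ H) : Commute (ribbonOp m h φ) (faceOp j ψ) := by
  rw [ribbonOp_eq_evLabel]
  refine (commute_evLabel ?_ _).symm
  have hmem {l : List (Fin (m + 1))} (h1 : ∀ k ∈ l, k ≠ j) (h2 : ∀ k ∈ l, k.succ ≠ j.castSucc) :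
      Commute (totEmb H m (faceOp j ψ)) (ribbonMat l) := by
    refine commute_ribbonMat (totEmb_commute_labelEmb _) (totEmb_commute_dualLabelEmb _)
      (fun k hk => totEmb_faceOp_commute_edgeEmb (by simp) ?_ (by simp) ψ)
      (fun k hk => totEmb_faceOp_commute_edgeEmb ?_ (by simp) ?_ ψ)
    · simpa using h1 k hk
    · simpa using h2 k hk
    · simpa using h1 k hk
  -- The left vertical edge of the face belongs to the preceding list entry, except for the first
  -- face, where it is the initial dual triangle outside the list.
  rcases Fin.eq_zero_or_eq_succ j with rfl | ⟨i, rfl⟩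
  · have hz : List.finRange (m + 1) = 0 :: (List.finRange m).map Fin.succ := List.finRange_succ
    have h3 : (ribbonMat (List.finRange (m + 1)) * dualMat 0 : RibbonAlg H m) =
        ribbonMat ((List.finRange m).map Fin.succ) *
          (dualMat (0 : Fin (m + 1)).succ * directMat 0 * dualMat (0 : Fin (m + 1)).castSucc) := by
      rw [hz, ribbonMat_cons]
      simp only [mul_assoc, Fin.castSucc_zero]
    rw [h3]
    refine (hmem ?_ ?_).mul_right (faceOp_commute_word 0 ψ)
    · simp
    · simp [Fin.succ_ne_zero]
  · obtain ⟨l₁, l₂, hl⟩ := exists_finRange_eq_append i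
    have hmem' {l : List (Fin (m + 1))} (h : ∀ j ∈ l, j ∈ l₁ ∨ j ∈ l₂) :
        Commute (totEmb H m (faceOp i.succ ψ)) (ribbonMat l) := by
      refine hmem (fun k hk => (notMem_of_finRange_eq hl (h k hk)).2) fun k hk => ?_
      rw [← Fin.succ_castSucc]
      simpa using (notMem_of_finRange_eq hl (h k hk)).1
    have hmid : Commute (totEmb H m (faceOp i.succ ψ)) (ribbonMat [i.castSucc, i.succ]) := by
      have h1 : (ribbonMat [i.castSucc, i.succ] : RibbonAlg H m) =
          (dualMat i.succ.succ * directMat i.succ * dualMat i.succ.castSucc) *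
            directMat i.castSucc := by
        simp only [ribbonMat_cons, ribbonMat_nil, one_mul, mul_assoc, Fin.succ_castSucc]
      rw [h1]
      refine (faceOp_commute_word i.succ ψ).mul_right
        (commute_directMat (totEmb_commute_labelEmb _) (totEmb_commute_dualLabelEmb _)
          (totEmb_faceOp_commute_edgeEmb (by simp) ?_ (by simp) ψ))
      simp only [ne_eq, Sum.inr.injEq]
      exact (Fin.castSucc_lt_succ).ne
    rw [hl, ribbonMat_append, ribbonMat_append]
    refine (((hmem' fun j hj => Or.inr hj).mul_right hmid).mul_right
      (hmem' fun j hj => Or.inl hj)).mul_right (commute_dualMat (totEmb_commute_labelEmb _) ?_)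
    refine totEmb_faceOp_commute_edgeEmb ?_ (by simp) ?_ ψ
    · simp only [ne_eq, Sum.inl.injEq]
      rw [← Fin.succ_castSucc]
      exact (Fin.succ_ne_zero _).symm
    · simp only [ne_eq, Sum.inl.injEq]
      exact (Fin.succ_ne_zero _).symm

lemma isSymmetry_of_commute {l : H} {L : Module.Dual ℂ H} {U : Module.End ℂ (Tot H m)}
    (h1 : ∀ i : Fin m, Commute U (vertexOp i l))
    (h2 : ∀ j : Fin (m + 1), Commute U (faceOp j L)) : IsSymmetry l L U where
  vertex := h1
  face := h2
  hamiltonian := (Commute.sum_right _ _ _ fun i _ => h1 i).neg_right.sub_right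
    (Commute.sum_right _ _ _ fun j _ => h2 j)

theorem isSymmetry_ribbonOp (l : H) (L : Module.Dual ℂ H) (h : H) (φ : Module.Dual ℂ H) :
    IsSymmetry l L (ribbonOp m h φ) :=
  isSymmetry_of_commute (fun i => ribbonOp_commute_vertexOp h φ i l)
    fun j => ribbonOp_commute_faceOp h φ j L

end RibbonCommute

end WeakHopfCluster

namespace WeakHopfCluster

/-! ### Convolution products of families of commuting maps -/

section ConvFamily

variable {C : Type*} [AddCommGroup C] [Module ℂ C] [Coalgebra ℂ C]
variable {A : Type*} [Ring A] [Algebra ℂ A]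

lemma conv_eq_sum (f g : C →ₗ[ℂ] A) (c : C) :
    conv Coalgebra.comul f g c = ∑ p ∈ sw c, f p.1 * g p.2 :=
  convMul_eq_sum (toConv f) (toConv g) c

lemma convAlong_cons_cons (f g : C →ₗ[ℂ] A) (l : List (C →ₗ[ℂ] A)) (c : C) :
    convAlong Coalgebra.comul (f :: g :: l) c =
      ∑ p ∈ sw c, f p.1 * convAlong Coalgebra.comul (g :: l) p.2 :=
  conv_eq_sum _ _ _

lemma commute_convAlong {a : A} {l : List (C →ₗ[ℂ] A)} (h : ∀ f ∈ l, ∀ c, Commute a (f c))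
    (c : C) : Commute a (convAlong Coalgebra.comul l c) := by
  induction l generalizing c with
  | nil => exact Commute.zero_right a
  | cons f l ih =>
    cases l with
    | nil => exact h f List.mem_cons_self c
    | cons g l =>
      rw [convAlong_cons_cons]
      exact Commute.sum_right _ _ _ fun p _ => (h f List.mem_cons_self _).mul_right
        (ih (fun f' hf' => h f' (List.mem_cons_of_mem _ hf')) _)

variable {n : Type*} {F : n → C →ₗ[ℂ] A}

/-- Comultiplying a product yields products leg by leg, and factors at different indices commute.
The operation μ is abstract so that the argument covers both the product of H and `dualMul`. -/
lemma convAlong_map_mul {μ : C → C → C}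
    (hμ : ∀ (B : C ⊗[ℂ] C →ₗ[ℂ] A) (x y : C), ∑ p ∈ sw (μ x y), B (p.1 ⊗ₜ p.2) =
      ∑ p ∈ sw x, ∑ q ∈ sw y, B (μ p.1 q.1 ⊗ₜ μ p.2 q.2))
    (hF : ∀ i x y, F i (μ x y) = F i x * F i y)
    (hc : ∀ i j, i ≠ j → ∀ x y, Commute (F i x) (F j y)) {l : List n} (hl : l.Nodup) (x y : C) :
    convAlong Coalgebra.comul (l.map F) (μ x y) =
      convAlong Coalgebra.comul (l.map F) x * convAlong Coalgebra.comul (l.map F) y := by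
  induction l generalizing x y with
  | nil => exact (mul_zero _).symm
  | cons i l ih =>
    cases l with
    | nil => exact hF i x y
    | cons j l =>
      have hi := List.nodup_cons.1 hl
      have hci (x y : C) : Commute (F i x) (convAlong Coalgebra.comul ((j :: l).map F) y) := by
        refine commute_convAlong (fun f hf c => ?_) y
        obtain ⟨k, hk, rfl⟩ := List.mem_map.1 hf
        exact hc i k (fun h => hi.1 (h ▸ hk)) _ _
      have ih' := ih hi.2
      simp only [List.map_cons] at ih' hci
      simp only [List.map_cons, convAlong_cons_cons, Finset.sum_mul, Finset.mul_sum]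
      have h1 := hμ (LinearMap.mul' ℂ A ∘ₗ TensorProduct.map (F i)
        (convAlong Coalgebra.comul (F j :: l.map F))) x y
      simp only [LinearMap.comp_apply, TensorProduct.map_tmul, LinearMap.mul'_apply] at h1
      rw [h1, Finset.sum_comm]
      refine Finset.sum_congr rfl fun p _ => Finset.sum_congr rfl fun q _ => ?_
      rw [hF, ih', mul_assoc, ← mul_assoc (F i p.1), (hci _ _).eq]
      simp only [mul_assoc]

lemma list_prod_commute {a : A} {P : n → A} {l : List n} (h : ∀ k ∈ l, Commute a (P k)) :
    Commute a (l.map P).prod := by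
  refine Commute.list_prod_right _ _ fun b hb => ?_
  obtain ⟨k, hk, rfl⟩ := List.mem_map.1 hb
  exact h k hk

/-- If `P k * F k c * Q k = ε(c) Q k`, all the factors but the first can be removed from a
convolution product by multiplication with the `P k` and `Q k`. -/
lemma prod_mul_convAlong_mul_prod {P Q : n → A}
    (hPQ : ∀ k c, P k * F k c * Q k = Coalgebra.counit (R := ℂ) c • Q k)
    (hP : ∀ i j, i ≠ j → ∀ x, Commute (P i) (F j x))
    (hQ : ∀ i j, i ≠ j → Commute (Q i) (Q j)) (i : n) {l : List n} (hl : (i :: l).Nodup) (c : C) :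
    (l.map P).prod * convAlong Coalgebra.comul ((i :: l).map F) c * (l.map Q).prod =
      F i c * (l.map Q).prod := by
  induction l generalizing i c with
  | nil =>
    simp only [List.map_nil, List.prod_nil, one_mul, mul_one]
    rfl
  | cons j l ih =>
    have hi := List.nodup_cons.1 hl
    have hj := List.nodup_cons.1 hi.2
    have hPi (x : C) : Commute (F i x) ((j :: l).map P).prod :=
      list_prod_commute fun k hk => (hP k i (fun h => hi.1 (h ▸ hk)) x).symm
    have hQj : Commute (Q j) (l.map Q).prod :=
      list_prod_commute fun k hk => hQ j k fun h => hj.1 (h ▸ hk)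
    have h1 (x : C) : ((j :: l).map P).prod * convAlong Coalgebra.comul ((j :: l).map F) x *
        ((j :: l).map Q).prod = Coalgebra.counit (R := ℂ) x • ((j :: l).map Q).prod := by
      have ih' := ih j hi.2 x
      calc ((j :: l).map P).prod * convAlong Coalgebra.comul ((j :: l).map F) x *
            ((j :: l).map Q).prod
          = P j * ((l.map P).prod * convAlong Coalgebra.comul ((j :: l).map F) x *
              (l.map Q).prod) * Q j := by
            rw [List.map_cons, List.map_cons (f := Q), List.prod_cons, List.prod_cons, hQj.eq]
            simp only [mul_assoc]
        _ = P j * F j x * Q j * (l.map Q).prod := by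
            rw [ih']
            simp only [mul_assoc, hQj.eq]
        _ = _ := by rw [hPQ, List.map_cons, List.prod_cons, smul_mul_assoc]
    have h2 : convAlong Coalgebra.comul ((i :: j :: l).map F) c =
        ∑ p ∈ sw c, F i p.1 * convAlong Coalgebra.comul ((j :: l).map F) p.2 :=
      convAlong_cons_cons _ _ _ _
    rw [h2, Finset.mul_sum, Finset.sum_mul]
    have h3 (p : C × C) : ((j :: l).map P).prod *
        (F i p.1 * convAlong Coalgebra.comul ((j :: l).map F) p.2) * ((j :: l).map Q).prod =
        F i (Coalgebra.counit (R := ℂ) p.2 • p.1) * ((j :: l).map Q).prod := by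
      rw [← mul_assoc, ← (hPi _).eq, mul_assoc, mul_assoc, ← mul_assoc (List.prod _), h1,
        mul_smul_comm, map_smul, smul_mul_assoc]
    simp only [h3]
    rw [← Finset.sum_mul, ← map_sum, sum_sw_counit_right]

end ConvFamily

/-! ### The boundary operators -/

section Boundary

variable {H : Type*} [Ring H] [Algebra ℂ H] [WeakHopfAlgebra H] {m : ℕ}

lemma onVert_apply {C : Type*} [AddCommGroup C] [Module ℂ C] (f : C →ₗ[ℂ] Module.End ℂ H)
    (i : Fin (m + 2)) (c : C) : onVert H f i c = onEdge (Sum.inl i) (f c) := rfl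

lemma onHoriz_apply {C : Type*} [AddCommGroup C] [Module ℂ C] (f : C →ₗ[ℂ] Module.End ℂ H)
    (j : Fin (m + 1)) (c : C) : onHoriz H f j c = onEdge (Sum.inr j) (f c) := rfl

lemma commute_roughOp {u : Module.End ℂ (Tot H m)}
    (hu : ∀ i x, Commute u (onEdge (Sum.inl i) (Xr H x))) (h : H) : Commute u (roughOp m h) := by
  refine commute_convAlong (fun f hf c => ?_) h
  obtain ⟨k, -, rfl⟩ := List.mem_map.1 hf
  exact hu k c

theorem roughOp_mul (g h : H) : roughOp m (g * h) = roughOp m g * roughOp m h :=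
  convAlong_map_mul (μ := fun x y : H => x * y) (fun B x y => sum_sw_mul B x y)
    (fun i x y => by rw [onVert_apply, Xr_mul, onEdge_mul]; rfl)
    (fun i j hij x y => onEdge_commute (by simpa using hij) _ _) (List.nodup_finRange _) g h

lemma onEdge_commute_of_commute (e e' : Edge m) {a b : Module.End ℂ H} (h : Commute a b) :
    Commute (onEdge e a) (onEdge e' b) := by
  by_cases he : e = e'
  · subst he
    exact h.map (edgeHom e)
  · exact onEdge_commute he _ _

/-- The two operators share only a vertical edge, where one multiplies from the left and the other
from the right. -/
theorem roughOp_commute_vertexOp (h : H) (i : Fin m) (g : H) :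
    Commute (roughOp m h) (vertexOp i g) := by
  refine commute_convAlong (fun f hf c => ?_) g
  refine (commute_roughOp (fun k x => ?_) h).symm
  simp only [List.mem_cons, List.not_mem_nil, or_false] at hf
  rcases hf with rfl | rfl | rfl
  · exact onEdge_commute (by simp) _ _
  · exact onEdge_commute_of_commute _ _ (Xr_commute_Xt _ _).symm
  · exact onEdge_commute (by simp) _ _

variable [FiniteDimensional ℂ H]

lemma commute_smoothOp {u : Module.End ℂ (Tot H m)}
    (hu : ∀ i ψ, Commute u (onEdge (Sum.inr i) (Zr H ψ))) (φ : Module.Dual ℂ H) :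
    Commute u (smoothOp m φ) := by
  refine commute_convAlong (fun f hf c => ?_) φ
  obtain ⟨k, -, rfl⟩ := List.mem_map.1 hf
  exact hu k c

lemma sum_sw_dual_apply (φ : Module.Dual ℂ H) (x y : H) :
    ∑ p ∈ sw φ, p.1 x * p.2 y = φ (x * y) := by
  have h1 := sum_sw_dual_lact (LinearMap.mul' ℂ ℂ ∘ₗ
    TensorProduct.map (Module.Dual.eval ℂ H x) (Module.Dual.eval ℂ H y)) φ
  simp only [LinearMap.comp_apply, TensorProduct.map_tmul, LinearMap.mul'_apply,
    Module.Dual.eval_apply, lact_apply] at h1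
  rw [h1]
  conv_rhs => rw [← (bas H).sum_repr x]
  simp only [Finset.sum_mul, map_sum, smul_mul_assoc, map_smul, smul_eq_mul]
  rfl

/-- The comultiplication of Ĥ is multiplicative because evaluation on x ⊗ y turns the claim into
Δ(xy) = Δ(x)Δ(y). -/
lemma sum_sw_dualMul {M : Type*} [AddCommGroup M] [Module ℂ M]
    (B : Module.Dual ℂ H ⊗[ℂ] Module.Dual ℂ H →ₗ[ℂ] M) (φ ψ : Module.Dual ℂ H) :
    ∑ p ∈ sw (dualMul φ ψ), B (p.1 ⊗ₜ p.2) =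
      ∑ p ∈ sw φ, ∑ q ∈ sw ψ, B (dualMul p.1 q.1 ⊗ₜ dualMul p.2 q.2) := by
  have h : ∑ p ∈ sw (dualMul φ ψ), p.1 ⊗ₜ[ℂ] p.2 =
      ∑ p ∈ sw φ, ∑ q ∈ sw ψ, dualMul p.1 q.1 ⊗ₜ[ℂ] dualMul p.2 q.2 := by
    apply (TensorProduct.dualDistribEquiv ℂ H H).injective
    ext x y
    have h1 (t : Module.Dual ℂ H ⊗[ℂ] Module.Dual ℂ H) :
        TensorProduct.dualDistribEquiv ℂ H H t = TensorProduct.dualDistrib ℂ H H t := rfl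
    simp only [h1, map_sum, LinearMap.sum_apply, TensorProduct.AlgebraTensorModule.curry_apply,
      LinearMap.restrictScalars_self, TensorProduct.curry_apply, TensorProduct.dualDistrib_apply,
      sum_sw_dual_apply]
    rw [dualMul_apply]
    have h2 := sum_sw_mul (LinearMap.mul' ℂ ℂ ∘ₗ TensorProduct.map φ ψ) x y
    simp only [LinearMap.comp_apply, TensorProduct.map_tmul, LinearMap.mul'_apply] at h2
    rw [h2]
    have h3 (r s : H × H) : φ (r.1 * s.1) * ψ (r.2 * s.2) =
        ∑ p ∈ sw φ, ∑ q ∈ sw ψ, (p.1 r.1 * p.2 s.1) * (q.1 r.2 * q.2 s.2) := by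
      rw [← sum_sw_dual_apply φ, ← sum_sw_dual_apply ψ, Finset.sum_mul_sum]
    simp only [h3, dualMul_apply, Finset.sum_mul_sum]
    refine (Finset.sum_congr rfl fun r _ => Finset.sum_comm).trans
      (Finset.sum_comm.trans (Finset.sum_congr rfl fun p _ => ?_))
    refine (Finset.sum_congr rfl fun r _ => Finset.sum_comm).trans
      (Finset.sum_comm.trans (Finset.sum_congr rfl fun q _ => ?_))
    exact Finset.sum_congr rfl fun r _ => Finset.sum_congr rfl fun s _ => mul_mul_mul_comm _ _ _ _
  have := congrArg B h
  simpa only [map_sum] using this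

theorem smoothOp_mul (φ ψ : Module.Dual ℂ H) :
    smoothOp m (dualMul φ ψ) = smoothOp m φ * smoothOp m ψ :=
  convAlong_map_mul (μ := fun φ ψ : Module.Dual ℂ H => dualMul φ ψ)
    (fun B x y => sum_sw_dualMul B x y)
    (fun i x y => by rw [onHoriz_apply, ← Zr_mul_Zr, onEdge_mul]; rfl)
    (fun i j hij x y => onEdge_commute (by simpa using hij) _ _)
    (List.nodup_reverse.2 (List.nodup_finRange _)) φ ψ

/-- On the common horizontal edge the two operators read opposite Sweedler legs, hence commute by
coassociativity. -/
theorem smoothOp_commute_faceOp (φ : Module.Dual ℂ H) (j : Fin (m + 1)) (ψ : Module.Dual ℂ H) :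
    Commute (smoothOp m φ) (faceOp j ψ) := by
  refine commute_convAlong (fun f hf c => ?_) ψ
  refine (commute_smoothOp (fun k x => ?_) φ).symm
  simp only [List.mem_cons, List.not_mem_nil, or_false] at hf
  rcases hf with rfl | rfl | rfl
  · exact onEdge_commute (by simp) _ _
  · exact onEdge_commute_of_commute _ _ (Zs_commute_Zr _ _)
  · exact onEdge_commute (by simp) _ _

theorem roughOp_commute_smoothOp (h : H) (φ : Module.Dual ℂ H) :
    Commute (roughOp m h) (smoothOp m φ) :=
  commute_smoothOp (fun _ _ =>
    (commute_roughOp (fun _ _ => onEdge_commute (by simp) _ _) h).symm) φ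

end Boundary

end WeakHopfCluster

namespace WeakHopfCluster

/-! ### Faithfulness of the boundary operators -/

section Faithful

variable {H : Type*} [Ring H] [Algebra ℂ H] {m : ℕ}

lemma onEdge_tprod (e : Edge m) (a : Module.End ℂ H) (w : Edge m → H) :
    onEdge e a (PiTensorProduct.tprod ℂ w) =
      PiTensorProduct.tprod ℂ (Function.update w e (a (w e))) := by
  rw [onEdge_eq_map, PiTensorProduct.map_tprod]
  congr 1
  ext i
  rcases eq_or_ne i e with rfl | h
  · simp
  · simp [h]

/-- The product functional with the factors `f e`. -/
def prodDual (f : Edge m → Module.Dual ℂ H) : Module.Dual ℂ (Tot H m) :=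
  PiTensorProduct.lift ((MultilinearMap.mkPiAlgebra ℂ (Edge m) ℂ).compLinearMap f)

lemma prodDual_tprod (f : Edge m → Module.Dual ℂ H) (w : Edge m → H) :
    prodDual f (PiTensorProduct.tprod ℂ w) = ∏ e, f e (w e) := by
  simp [prodDual]

/-- The operator `x ↦ f(x) v`. -/
def rankOne (f : Module.Dual ℂ H) (v : H) : Module.End ℂ H := f.smulRight v

lemma rankOne_apply (f : Module.Dual ℂ H) (v x : H) : rankOne f v x = f x • v := rfl

variable [WeakHopfAlgebra H]

lemma rankOne_mul_Xr_mul_rankOne (τ : Module.Dual ℂ H) (h : H) :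
    rankOne (ε H) 1 * Xr H h * rankOne τ 1 = ε H h • rankOne τ 1 := by
  ext x
  simp [rankOne_apply, Xr_apply, smul_comm (τ x)]

lemma ε_Zr (φ : Module.Dual ℂ H) (x : H) : ε H (Zr H φ x) = φ x := by
  have h1 : x = ∑ p ∈ sw x, ε H p.1 • p.2 := (sum_sw_counit_left x).symm
  conv_rhs => rw [h1]
  rw [Zr_eq_sum, map_sum, map_sum]
  simp only [map_smul, smul_eq_mul, mul_comm]

lemma rankOne_mul_Zr_mul_rankOne (τ φ : Module.Dual ℂ H) :
    rankOne (ε H) 1 * Zr H φ * rankOne τ 1 = φ 1 • rankOne τ (1 : H) := by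
  ext x
  simp only [Module.End.mul_apply, rankOne_apply, LinearMap.smul_apply, map_smul, ε_Zr]
  rw [smul_comm]

variable [FiniteDimensional ℂ H]

lemma list_prod_onEdge_tprod {n : Type*} (k : n → Edge m) (π : Module.End ℂ H) (l : List n)
    {w : Edge m → H} (hw : ∀ i ∈ l, π (w (k i)) = w (k i)) :
    (l.map fun i => onEdge (k i) π).prod (PiTensorProduct.tprod ℂ w) =
      PiTensorProduct.tprod ℂ w := by
  induction l with
  | nil => simp
  | cons i l ih =>
    rw [List.map_cons, List.prod_cons, Module.End.mul_apply,
      ih fun j hj => hw j (List.mem_cons_of_mem _ hj), onEdge_tprod, hw i List.mem_cons_self,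
      Function.update_eq_self]

lemma exists_dual_one [Nontrivial H] : ∃ τ : Module.Dual ℂ H, τ 1 = 1 := by
  have h : ¬ ∀ f : Module.Dual ℂ H, f 1 = 0 := fun h =>
    one_ne_zero ((Module.forall_dual_apply_eq_zero_iff ℂ (1 : H)).1 h)
  push Not at h
  obtain ⟨f, hf⟩ := h
  exact ⟨(f 1)⁻¹ • f, by simp [hf]⟩

/-- Between ε and the vector 1, X→_h becomes the number ε(h). Contracting every edge but r_0 in this
way removes the Sweedler legs there and leaves h entire. -/
lemma roughOp_sandwich (τ : Module.Dual ℂ H) (h : H) :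
    (((List.finRange (m + 1)).map Fin.succ).map
        fun i => onEdge (Sum.inl i : Edge m) (rankOne (ε H) 1)).prod * roughOp m h *
      (((List.finRange (m + 1)).map Fin.succ).map
        fun i => onEdge (Sum.inl i : Edge m) (rankOne τ 1)).prod =
    onEdge (Sum.inl 0) (Xr H h) * (((List.finRange (m + 1)).map Fin.succ).map
        fun i => onEdge (Sum.inl i : Edge m) (rankOne τ 1)).prod := by
  have h1 : List.finRange (m + 2) = 0 :: (List.finRange (m + 1)).map Fin.succ :=
    List.finRange_succ
  have h2 : roughOp m h = convAlong (Coalgebra.comul (R := ℂ))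
    ((0 :: (List.finRange (m + 1)).map Fin.succ).map (onVert H (Xr H))) h := by
    rw [← h1]
    rfl
  rw [h2, prod_mul_convAlong_mul_prod (F := fun i => onVert H (Xr H) i)]
  · rfl
  · intro k c
    rw [onVert_apply, ← onEdge_mul, ← onEdge_mul, rankOne_mul_Xr_mul_rankOne, map_smul]
    rfl
  · exact fun i j hij x => onEdge_commute (by simpa using hij) _ _
  · exact fun i j hij => onEdge_commute (by simpa using hij) _ _
  · rw [← h1]
    exact List.nodup_finRange _

lemma smoothOp_sandwich (τ φ : Module.Dual ℂ H) :
    (((List.finRange m).map Fin.castSucc).reverse.map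
        fun j => onEdge (Sum.inr j : Edge m) (rankOne (ε H) 1)).prod * smoothOp m φ *
      (((List.finRange m).map Fin.castSucc).reverse.map
        fun j => onEdge (Sum.inr j : Edge m) (rankOne τ 1)).prod =
    onEdge (Sum.inr (Fin.last m)) (Zr H φ) * (((List.finRange m).map Fin.castSucc).reverse.map
        fun j => onEdge (Sum.inr j : Edge m) (rankOne τ 1)).prod := by
  have h1 : (List.finRange (m + 1)).reverse =
      Fin.last m :: ((List.finRange m).map Fin.castSucc).reverse := by
    rw [List.finRange_succ_last, List.reverse_append]
    rfl
  have h2 : smoothOp m φ = convAlong (Coalgebra.comul (R := ℂ))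
    ((Fin.last m :: ((List.finRange m).map Fin.castSucc).reverse).map (onHoriz H (Zr H))) φ := by
    rw [← h1]
    rfl
  rw [h2, prod_mul_convAlong_mul_prod (F := fun j => onHoriz H (Zr H) j)]
  · rfl
  · intro k c
    rw [onHoriz_apply, ← onEdge_mul, ← onEdge_mul, rankOne_mul_Zr_mul_rankOne, map_smul]
    rfl
  · exact fun i j hij x => onEdge_commute (by simpa using hij) _ _
  · exact fun i j hij => onEdge_commute (by simpa using hij) _ _
  · rw [← h1]
    exact List.nodup_reverse.2 (List.nodup_finRange _)

lemma boundary_sandwich {A : Type*} [Monoid A] {p q p' q' s t x y : A}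
    (h1 : p * s * q = x * q) (h2 : p' * t * q' = y * q') (h3 : Commute p' s)
    (h5 : Commute q p') (h6 : Commute q t) (h7 : Commute q y) :
    p * p' * (s * t) * (q * q') = x * y * (q * q') := by
  calc p * p' * (s * t) * (q * q') = p * (p' * s) * (t * q) * q' := by simp only [mul_assoc]
    _ = p * s * (p' * q) * t * q' := by rw [h3.eq, ← h6.eq]; simp only [mul_assoc]
    _ = (p * s * q) * (p' * t * q') := by rw [← h5.eq]; simp only [mul_assoc]
    _ = x * (q * y) * q' := by rw [h1, h2]; simp only [mul_assoc]
    _ = _ := by rw [h7.eq]; simp only [mul_assoc]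

/-- Matrix elements of `S_h T_φ` recover `χ(h) φ(x)`. -/
lemma exists_functional_boundary [Nontrivial H] (χ : Module.Dual ℂ H) (x : H) :
    ∃ Ψ : Module.End ℂ (Tot H m) →ₗ[ℂ] ℂ,
      ∀ (h : H) (φ : Module.Dual ℂ H), Ψ (roughOp m h * smoothOp m φ) = χ h * φ x := by
  obtain ⟨τ, hτ⟩ := exists_dual_one (H := H)
  set p : Module.End ℂ (Tot H m) := (((List.finRange (m + 1)).map Fin.succ).map
        fun i => onEdge (Sum.inl i : Edge m) (rankOne (ε H) 1)).prod
  set q : Module.End ℂ (Tot H m) := (((List.finRange (m + 1)).map Fin.succ).map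
        fun i => onEdge (Sum.inl i : Edge m) (rankOne τ 1)).prod with hq
  set p' : Module.End ℂ (Tot H m) := (((List.finRange m).map Fin.castSucc).reverse.map
        fun j => onEdge (Sum.inr j : Edge m) (rankOne (ε H) 1)).prod
  set q' : Module.End ℂ (Tot H m) := (((List.finRange m).map Fin.castSucc).reverse.map
        fun j => onEdge (Sum.inr j : Edge m) (rankOne τ 1)).prod with hq'
  -- On r_0 the vector 1 and the functional χ give χ(h·1). On s_m the vector x and ε give ε(Z→_φ x)
  -- = φ(x). Every other edge contributes τ(1) = 1.
  let w : Edge m → H := Function.update (fun _ => 1) (Sum.inr (Fin.last m)) x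
  let f : Edge m → Module.Dual ℂ H :=
    Function.update (Function.update (fun _ => τ) (Sum.inr (Fin.last m)) (ε H)) (Sum.inl 0) χ
  refine ⟨prodDual f ∘ₗ LinearMap.applyₗ (PiTensorProduct.tprod ℂ w) ∘ₗ
    LinearMap.mulLeft ℂ (p * p') ∘ₗ LinearMap.mulRight ℂ (q * q'), fun h φ => ?_⟩
  have hc (e : Edge m) (he : ∀ j, e ≠ Sum.inl j) (b : Module.End ℂ H) :
      Commute q (onEdge e b) :=
    (list_prod_commute fun k _ => onEdge_commute (he k) _ _).symm
  have h1 : p * p' * (roughOp m h * smoothOp m φ * (q * q')) =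
      onEdge (Sum.inl 0) (Xr H h) * onEdge (Sum.inr (Fin.last m)) (Zr H φ) * (q * q') := by
    rw [← mul_assoc]
    refine boundary_sandwich (roughOp_sandwich τ h) (smoothOp_sandwich τ φ) ?_ ?_ ?_ ?_
    · exact commute_roughOp (fun i x => (list_prod_commute fun k _ =>
        onEdge_commute (by simp) _ _).symm) h
    · exact list_prod_commute fun k _ => hc _ (by simp) _
    · exact commute_smoothOp (fun i ψ => hc _ (by simp) _) φ
    · exact hc _ (by simp) _
  have hqw : q (PiTensorProduct.tprod ℂ w) = PiTensorProduct.tprod ℂ w := by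
    refine list_prod_onEdge_tprod _ _ _ fun i hi => ?_
    simp [w, rankOne_apply, hτ]
  have hqw' : q' (PiTensorProduct.tprod ℂ w) = PiTensorProduct.tprod ℂ w := by
    refine list_prod_onEdge_tprod _ _ _ fun i hi => ?_
    have hi' : i ≠ Fin.last m := by
      simp only [List.mem_reverse, List.mem_map] at hi
      obtain ⟨a, -, rfl⟩ := hi
      exact (Fin.castSucc_lt_last a).ne
    simp [w, rankOne_apply, hτ, hi']
  simp only [LinearMap.comp_apply, LinearMap.mulRight_apply, LinearMap.mulLeft_apply,
    LinearMap.applyₗ_apply_apply, h1]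
  simp only [Module.End.mul_apply, hqw, hqw', onEdge_tprod, prodDual_tprod]
  rw [Fintype.prod_eq_mul (Sum.inl 0) (Sum.inr (Fin.last m)) (by simp)]
  · simp [f, w, Xr_apply, ε_Zr]
  · rintro e ⟨he1, he2⟩
    simp [f, w, he1, he2, hτ]

theorem boundary_injective : Function.Injective (TensorProduct.lift
    ((LinearMap.mul ℂ (Module.End ℂ (Tot H m))).compl₁₂ (roughOp m) (smoothOp m))) := by
  -- A functional with value 1 at the unit exists only if H is nonzero.
  rcases subsingleton_or_nontrivial H with hs | hn
  · exact Function.injective_of_subsingleton _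
  rw [injective_iff_map_eq_zero]
  intro t ht
  refine (((bas H).tensorProduct (bas H).dualBasis).ext_elem fun ij => ?_)
  obtain ⟨Ψ, hΨ⟩ := exists_functional_boundary (m := m) ((bas H).coord ij.1) (bas H ij.2)
  have h1 : Ψ ∘ₗ TensorProduct.lift ((LinearMap.mul ℂ (Module.End ℂ (Tot H m))).compl₁₂
      (roughOp m) (smoothOp m)) =
      ((bas H).tensorProduct (bas H).dualBasis).coord ij := by
    ext h φ
    simp only [TensorProduct.AlgebraTensorModule.curry_apply, LinearMap.restrictScalars_self,
      TensorProduct.curry_apply, LinearMap.comp_apply, TensorProduct.lift.tmul,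
      LinearMap.compl₁₂_apply, LinearMap.mul_apply_apply, hΨ, Module.Basis.coord_apply]
    rw [Module.Basis.tensorProduct_repr_tmul_apply, smul_eq_mul, Module.Basis.dualBasis_repr, mul_comm]
  have h2 := LinearMap.congr_fun h1 t
  rw [LinearMap.comp_apply, ht, map_zero] at h2
  rw [map_zero]
  exact h2.symm

end Faithful

end WeakHopfCluster

namespace WeakHopfCluster

/-! ### A cocommutative Haar integral of the dual makes the antipode involutive -/

section Involutive

variable {H : Type*} [Ring H] [Algebra ℂ H] [WeakHopfAlgebra H] [FiniteDimensional ℂ H]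

lemma dualEpsL_eq (φ : Module.Dual ℂ H) : dualEpsL φ = φ ∘ₗ eL H := by
  ext x
  have h1 : dualEpsL φ = ∑ p ∈ sw (ε H), (dualMul p.1 φ) 1 • p.2 := by
    change TensorProduct.lid ℂ _ (TensorProduct.map (dualε H ∘ₗ dualMul.flip φ) LinearMap.id
      (Coalgebra.comul (R := ℂ) (ε H))) = _
    rw [comul_eq_sum]
    simp [dualε]
  rw [h1, LinearMap.comp_apply, eL_eq_sum]
  simp only [dualMul_apply, LinearMap.sum_apply, LinearMap.smul_apply, smul_eq_mul,
    Finset.sum_mul, map_sum, map_smul]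
  rw [Finset.sum_comm]
  refine Finset.sum_congr rfl fun q _ => ?_
  rw [← sum_sw_dual_apply, Finset.sum_mul]
  exact Finset.sum_congr rfl fun p _ => mul_right_comm _ _ _

variable {L : Module.Dual ℂ H}

lemma IsDualHaarIntegral.apply_eL (hL : IsDualHaarIntegral L) (x : H) : L (eL H x) = ε H x := by
  have := hL.epsL_eq
  rw [dualEpsL_eq] at this
  exact LinearMap.congr_fun this x

/-- The left integral property is x⁽¹⁾Λ(x⁽²⁾) = ε_L(x⁽¹⁾)Λ(x⁽²⁾), tested against all functionals. -/
lemma IsDualHaarIntegral.eL_Zr (hL : IsDualHaarIntegral L) (x : H) :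
    eL H (Zr H L x) = Zr H L x := by
  refine (Module.forall_dual_apply_eq_zero_iff ℂ _).1 (fun φ => ?_) |> sub_eq_zero.1
  have h := LinearMap.congr_fun (hL.left φ) x
  rw [dualEpsL_eq, dualMul_apply, dualMul_apply] at h
  simp only [LinearMap.comp_apply] at h
  rw [map_sub, Zr_eq_sum, map_sum, map_sum, map_sum, sub_eq_zero]
  simpa only [map_smul, smul_eq_mul, mul_comm (φ _)] using h.symm

lemma Zr_mul_apply (ψ : Module.Dual ℂ H) (g x : H) :
    Zr H ψ (g * x) = ∑ p ∈ sw g, p.1 * Zr H (lact ψ p.2) x := by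
  have := LinearMap.congr_fun (Zr_mul_Xr ψ g) x
  simpa [Xr_apply] using this

/-- Both sides equal S(x⁽¹⁾) · Z→_Λ(x⁽²⁾y). Expanding Δ(x⁽²⁾y) contracts S(x⁽¹⁾)x⁽²⁾ and yields
y⁽¹⁾Λ(xy⁽²⁾); replacing Z→_Λ(z) by S(1⁽¹⁾)Λ(1⁽²⁾z), which integral invariance permits, yields
S(x⁽¹⁾)Λ(x⁽²⁾y). -/
lemma IsDualHaarIntegral.Zr_lact (hL : IsDualHaarIntegral L) (x y : H) :
    Zr H (lact L x) y = S H (Zr H (ract L y) x) := by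
  let K (ψ : Module.Dual ℂ H) : H →ₗ[ℂ] H := LinearMap.applyₗ y ∘ₗ Zr H ∘ₗ lact ψ
  have hK (ψ : Module.Dual ℂ H) (z : H) : K ψ z = Zr H (lact ψ z) y := rfl
  have h1 : ∑ p ∈ sw x, S H p.1 * Zr H L (p.2 * y) = Zr H (lact L x) y := by
    have h2 := sum_sw_assoc (LinearMap.mul' ℂ H ∘ₗ TensorProduct.map (S H)
      (LinearMap.mul' ℂ H ∘ₗ (K L).lTensor H)) x
    simp only [LinearMap.comp_apply, TensorProduct.map_tmul, LinearMap.lTensor_tmul,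
      LinearMap.mul'_apply] at h2
    simp only [Zr_mul_apply, Finset.mul_sum, ← hK]
    rw [← h2]
    simp only [← mul_assoc, ← Finset.sum_mul, sum_S_mul]
    have h3 := sum_eR_head (LinearMap.mul' ℂ H ∘ₗ (K L).lTensor H) x
    simp only [LinearMap.comp_apply, LinearMap.lTensor_tmul, LinearMap.mul'_apply] at h3
    have h7 := Zr_mul_apply (lact L x) 1 y
    rw [one_mul] at h7
    rw [h3]
    simp only [hK, h7, lact_lact]
  rw [← h1]
  have h4 (z : H) : Zr H L z = ∑ q ∈ sw (1 : H), L (q.2 * z) • S H q.1 := by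
    have h5 := sum_eL_head ((TensorProduct.rid ℂ H).toLinearMap ∘ₗ L.lTensor H) z
    simp only [LinearMap.comp_apply, LinearMap.lTensor_tmul, LinearEquiv.coe_coe,
      TensorProduct.rid_tmul] at h5
    rw [← h5, ← hL.eL_Zr, Zr_eq_sum, map_sum]
    simp only [map_smul]
  have h6 := sum_sw_mul ((TensorProduct.rid ℂ H).toLinearMap ∘ₗ
    TensorProduct.map (S H) (ract L y)) 1 x
  simp only [LinearMap.comp_apply, TensorProduct.map_tmul, LinearEquiv.coe_coe,
    TensorProduct.rid_tmul, one_mul, ract_apply] at h6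
  rw [Zr_eq_sum, map_sum]
  simp only [map_smul, ract_apply]
  rw [h6, Finset.sum_comm]
  refine Finset.sum_congr rfl fun p _ => ?_
  rw [h4, Finset.mul_sum]
  refine Finset.sum_congr rfl fun q _ => ?_
  rw [mul_smul_comm, S_mul, mul_assoc]

lemma IsDualCocomm.ract_eq (ht : IsDualCocomm L) (x : H) : ract L x = lact L x := by
  ext y
  exact ht y x

/-- For a trace Λ the previous identity exchanges x and y at the cost of one S, so applying it twice
shows that S² fixes every y⁽¹⁾Λ(xy⁽²⁾). Such elements span H: with x = S(y⁽³⁾), the trace property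
and Λ∘ε_L = ε recover y. -/
theorem IsDualHaarIntegral.S_S (hL : IsDualHaarIntegral L) (ht : IsDualCocomm L) (y : H) :
    S H (S H y) = y := by
  have h1 (x y : H) : S H (S H (Zr H (lact L x) y)) = Zr H (lact L x) y := by
    conv_rhs => rw [hL.Zr_lact, ht.ract_eq, hL.Zr_lact, ht.ract_eq]
  have h2 : ∑ p ∈ sw y, Zr H (lact L (S H p.2)) p.1 = y := by
    have h3 := sum_sw_assoc ((TensorProduct.rid ℂ H).toLinearMap ∘ₗ
      (L ∘ₗ LinearMap.mul' ℂ H ∘ₗ (S H).lTensor H).lTensor H) y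
    simp only [LinearMap.comp_apply, LinearMap.lTensor_tmul, LinearEquiv.coe_coe,
      TensorProduct.rid_tmul, LinearMap.mul'_apply] at h3
    simp only [Zr_eq_sum, lact_apply, ht (S H _)]
    rw [h3]
    simp only [← Finset.sum_smul, ← map_sum, sum_mul_S, hL.apply_eL]
    exact sum_sw_counit_right y
  rw [← h2]
  simp only [map_sum, h1]

end Involutive

end WeakHopfCluster

namespace WeakHopfCluster

/-! ### Boundary operators and stabilizers of cocommutative integrals -/

section CocommDual

variable {H : Type*} [Ring H] [Algebra ℂ H] [WeakHopfAlgebra H] [FiniteDimensional ℂ H]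
variable {M : Type*} [AddCommGroup M] [Module ℂ M]

lemma dual_tensor_ext {t t' : Module.Dual ℂ H ⊗[ℂ] Module.Dual ℂ H}
    (h : ∀ x y, TensorProduct.dualDistrib ℂ H H t (x ⊗ₜ y) =
      TensorProduct.dualDistrib ℂ H H t' (x ⊗ₜ y)) : t = t' := by
  apply (TensorProduct.dualDistribEquiv ℂ H H).injective
  ext x y
  exact h x y

lemma sum_sw_lact_fst (B : Module.Dual ℂ H ⊗[ℂ] Module.Dual ℂ H →ₗ[ℂ] M) (ψ : Module.Dual ℂ H)
    (k : H) : ∑ p ∈ sw ψ, B (lact p.1 k ⊗ₜ p.2) = ∑ p ∈ sw (lact ψ k), B (p.1 ⊗ₜ p.2) := by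
  have h : ∑ p ∈ sw ψ, lact p.1 k ⊗ₜ[ℂ] p.2 = ∑ p ∈ sw (lact ψ k), p.1 ⊗ₜ[ℂ] p.2 := by
    refine dual_tensor_ext fun x y => ?_
    simp only [map_sum, LinearMap.sum_apply, TensorProduct.dualDistrib_apply, lact_apply,
      sum_sw_dual_apply, mul_assoc]
  simpa only [map_sum] using congrArg B h

lemma sum_sw_ract_snd (B : Module.Dual ℂ H ⊗[ℂ] Module.Dual ℂ H →ₗ[ℂ] M) (ψ : Module.Dual ℂ H)
    (k : H) : ∑ p ∈ sw ψ, B (p.1 ⊗ₜ ract p.2 k) = ∑ p ∈ sw (ract ψ k), B (p.1 ⊗ₜ p.2) := by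
  have h : ∑ p ∈ sw ψ, p.1 ⊗ₜ[ℂ] ract p.2 k = ∑ p ∈ sw (ract ψ k), p.1 ⊗ₜ[ℂ] p.2 := by
    refine dual_tensor_ext fun x y => ?_
    simp only [map_sum, LinearMap.sum_apply, TensorProduct.dualDistrib_apply, ract_apply,
      sum_sw_dual_apply, mul_assoc]
  simpa only [map_sum] using congrArg B h

/-- Both sides represent x ⊗ y ↦ ψ(x k l y), so a multiplier may cross between neighbouring legs. -/
lemma sum_sw_ract_lact (B : Module.Dual ℂ H ⊗[ℂ] Module.Dual ℂ H →ₗ[ℂ] M) (ψ : Module.Dual ℂ H)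
    (k l : H) :
    ∑ p ∈ sw ψ, B (ract p.1 k ⊗ₜ lact p.2 l) = ∑ p ∈ sw ψ, B (ract p.1 (k * l) ⊗ₜ p.2) := by
  have h : ∑ p ∈ sw ψ, ract p.1 k ⊗ₜ[ℂ] lact p.2 l = ∑ p ∈ sw ψ, ract p.1 (k * l) ⊗ₜ[ℂ] p.2 := by
    refine dual_tensor_ext fun x y => ?_
    simp only [map_sum, LinearMap.sum_apply, TensorProduct.dualDistrib_apply, lact_apply,
      ract_apply, sum_sw_dual_apply, mul_assoc]
  simpa only [map_sum] using congrArg B h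

end CocommDual

/-! ### Rough boundary against face operators -/

section CocommFace

variable {H : Type*} [Ring H] [Algebra ℂ H] [WeakHopfAlgebra H] [FiniteDimensional ℂ H]
variable {A : Type*} [Ring A] [Algebra ℂ A] {ι₁ ι₂ ι₃ : Module.End ℂ H →ₐ[ℂ] A}

lemma emb_Zr_mul_apply_mul_Xr {K : WithConv (Module.Dual ℂ H →ₗ[ℂ] A)}
    (hK : ∀ a ψ, Commute (ι₁ a) (K ψ)) (ψ : Module.Dual ℂ H) (g : H) :
    (emb ι₁ (Zr H) * K : WithConv (Module.Dual ℂ H →ₗ[ℂ] A)) ψ * ι₁ (Xr H g) =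
      ∑ p ∈ sw g, ι₁ (Xr H p.1) *
        (emb ι₁ (Zr H) * K : WithConv (Module.Dual ℂ H →ₗ[ℂ] A)) (lact ψ p.2) := by
  simp only [convMul_eq_sum, Finset.sum_mul, Finset.mul_sum, LinearMap.comp_apply,
    AlgHom.toLinearMap_apply]
  have h1 (k : H) := sum_sw_lact_fst (LinearMap.mul' ℂ A ∘ₗ
    TensorProduct.map (ι₁.toLinearMap ∘ₗ Zr H) K.ofConv) ψ k
  simp only [LinearMap.comp_apply, TensorProduct.map_tmul, LinearMap.mul'_apply,
    AlgHom.toLinearMap_apply] at h1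
  simp only [← Finset.mul_sum, ← h1]
  simp only [Finset.mul_sum]
  rw [Finset.sum_comm]
  refine Finset.sum_congr rfl fun s _ => ?_
  rw [mul_assoc, ← (hK _ _).eq, ← mul_assoc, ← map_mul, Zr_mul_Xr, map_sum, Finset.sum_mul]
  simp only [map_mul, mul_assoc]

lemma mul_emb_Zl_apply_mul_Xr {K : WithConv (Module.Dual ℂ H →ₗ[ℂ] A)}
    (hK : ∀ a ψ, Commute (ι₃ a) (K ψ)) (ψ : Module.Dual ℂ H) (g : H) :
    (K * emb ι₃ (Zl H) : WithConv (Module.Dual ℂ H →ₗ[ℂ] A)) ψ * ι₃ (Xr H g) =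
      ∑ p ∈ sw g, ι₃ (Xr H p.2) *
        (K * emb ι₃ (Zl H) : WithConv (Module.Dual ℂ H →ₗ[ℂ] A)) (ract ψ (S H p.1)) := by
  simp only [convMul_eq_sum, Finset.sum_mul, Finset.mul_sum, LinearMap.comp_apply,
    AlgHom.toLinearMap_apply]
  have h1 (k : H) := sum_sw_ract_snd (LinearMap.mul' ℂ A ∘ₗ
    TensorProduct.map K.ofConv (ι₃.toLinearMap ∘ₗ Zl H)) ψ k
  simp only [LinearMap.comp_apply, TensorProduct.map_tmul, LinearMap.mul'_apply,
    AlgHom.toLinearMap_apply] at h1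
  simp only [← Finset.mul_sum, ← h1]
  simp only [Finset.mul_sum]
  rw [Finset.sum_comm]
  refine Finset.sum_congr rfl fun s _ => ?_
  rw [mul_assoc, ← map_mul, Zl_mul_Xr, map_sum, Finset.mul_sum]
  refine Finset.sum_congr rfl fun p _ => ?_
  rw [map_mul, ← mul_assoc, ← mul_assoc, (hK _ _).eq]

/-- The operators of the rough boundary commute with `U^L` for a cocommutative `L` when the
antipode is involutive. -/
lemma commute_rough_of_cocomm (hSS : ∀ x : H, S H (S H x) = x)
    {L : Module.Dual ℂ H} (ht : IsDualCocomm L) {U : Module.Dual ℂ H →ₗ[ℂ] A}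
    (ha : ∀ ψ g, U ψ * ι₁ (Xr H g) = ∑ p ∈ sw g, ι₁ (Xr H p.1) * U (lact ψ p.2))
    (hb : ∀ ψ g, U ψ * ι₃ (Xr H g) = ∑ p ∈ sw g, ι₃ (Xr H p.2) * U (ract ψ (S H p.1))) (h : H) :
    Commute (U L) ((emb ι₁ (Xr H) * emb ι₃ (Xr H) : WithConv (H →ₗ[ℂ] A)) h) := by
  let Q : H →ₗ[ℂ] A := U ∘ₗ lact L ∘ₗ S H
  -- Λ(k • S(l)) = Λ(S(l)k •) by the trace property, and S(l)k = S(S(k)l) since S² = id. For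
  -- adjacent legs k, l of h the product S(k)l then contracts to ε_R.
  have h1 (k l : H) : U (ract (lact L k) (S H l)) = Q (S H k * l) := by
    have : ract (lact L k) (S H l) = lact L (S H (S H k * l)) := by
      rw [S_mul, hSS]
      ext x
      simp only [ract_apply, lact_apply]
      rw [← mul_assoc, ht, mul_assoc]
    rw [this]
    rfl
  have h2 : ∑ q ∈ sw (1 : H), ι₃ (Xr H q.2) * Q q.1 = U L := by
    have := hb L 1
    rw [Xr_one, map_one, mul_one] at this
    rw [this]
    simp only [ht.ract_eq]
    rfl
  have h3 (k x : H) : U (lact L k) * ι₃ (Xr H x) =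
      ∑ r ∈ sw x, ι₃ (Xr H r.2) * Q (S H k * r.1) := by
    simp only [hb, h1]
  have h4 (y : H) : ∑ q ∈ sw y, U (lact L q.1) * ι₃ (Xr H q.2) = ι₃ (Xr H y) * U L := by
    have h5 := sum_sw_assoc (LinearMap.mul' ℂ A ∘ₗ (TensorProduct.comm ℂ A A).toLinearMap ∘ₗ
      TensorProduct.map (Q ∘ₗ LinearMap.mul' ℂ H ∘ₗ (S H).rTensor H) (ι₃.toLinearMap ∘ₗ Xr H) ∘ₗ
      (TensorProduct.assoc ℂ H H H).symm.toLinearMap) y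
    simp only [LinearMap.comp_apply, TensorProduct.map_tmul, LinearMap.mul'_apply,
      AlgHom.toLinearMap_apply, LinearEquiv.coe_coe, LinearMap.rTensor_tmul,
      TensorProduct.assoc_symm_tmul, TensorProduct.comm_tmul] at h5
    simp only [h3]
    rw [← h5]
    simp only [← Finset.mul_sum, ← map_sum, sum_S_mul]
    have h6 := sum_eR_head (LinearMap.mul' ℂ A ∘ₗ (TensorProduct.comm ℂ A A).toLinearMap ∘ₗ
      TensorProduct.map Q (ι₃.toLinearMap ∘ₗ Xr H)) y
    simp only [LinearMap.comp_apply, TensorProduct.map_tmul, LinearMap.mul'_apply,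
      AlgHom.toLinearMap_apply, LinearEquiv.coe_coe, TensorProduct.comm_tmul] at h6
    rw [h6, ← h2, Finset.mul_sum]
    simp only [Xr_mul, map_mul, mul_assoc]
  change _ * _ = _ * _
  rw [convMul_eq_sum, Finset.mul_sum, Finset.sum_mul]
  simp only [LinearMap.comp_apply, AlgHom.toLinearMap_apply, ← mul_assoc, ha, Finset.sum_mul]
  have h7 := sum_sw_assoc (LinearMap.mul' ℂ A ∘ₗ TensorProduct.map (ι₁.toLinearMap ∘ₗ Xr H)
    (LinearMap.mul' ℂ A ∘ₗ TensorProduct.map (U ∘ₗ lact L) (ι₃.toLinearMap ∘ₗ Xr H))) h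
  simp only [LinearMap.comp_apply, TensorProduct.map_tmul, LinearMap.mul'_apply,
    AlgHom.toLinearMap_apply, ← mul_assoc] at h7
  rw [h7]
  simp only [mul_assoc, ← Finset.mul_sum, h4]

end CocommFace

/-! ### Smooth boundary against vertex operators -/

section CocommVertex

variable {H : Type*} [Ring H] [Algebra ℂ H] [WeakHopfAlgebra H]

lemma IsCocomm.sum_sw_swap {M : Type*} [AddCommGroup M] [Module ℂ M] {l : H} (hl : IsCocomm l)
    (B : H ⊗[ℂ] H →ₗ[ℂ] M) : ∑ p ∈ sw l, B (p.2 ⊗ₜ p.1) = ∑ p ∈ sw l, B (p.1 ⊗ₜ p.2) := by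
  have h := congrArg B hl
  rw [Δ_eq_sum] at h
  simpa using h

variable {A : Type*} [Ring A] [Algebra ℂ A] {ι₁ ι₃ : Module.End ℂ H →ₐ[ℂ] A}

lemma sum_sw_rotate (E W N : H →ₗ[ℂ] A) (g : H) :
    ∑ p ∈ sw g, ∑ q ∈ sw p.1, E q.2 * W p.2 * N q.1 =
      ∑ p ∈ sw g, (toConv E * toConv W : WithConv (H →ₗ[ℂ] A)) p.2 * N p.1 := by
  have h1 := sum_sw_assoc (LinearMap.mul' ℂ A ∘ₗ (TensorProduct.comm ℂ A A).toLinearMap ∘ₗ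
    TensorProduct.map N (LinearMap.mul' ℂ A ∘ₗ TensorProduct.map E W)) g
  simp only [LinearMap.comp_apply, TensorProduct.map_tmul, LinearMap.mul'_apply,
    LinearEquiv.coe_coe, TensorProduct.comm_tmul] at h1
  rw [h1]
  simp only [convMul_eq_sum, Finset.sum_mul]

variable [FiniteDimensional ℂ H]

/-- The operators of the smooth boundary commute with `A^l` for a cocommutative `l` when the
antipode is involutive. -/
lemma commute_smooth_of_cocomm (hSS : ∀ x : H, S H (S H x) = x) {l : H} (hl : IsCocomm l)
    (h13 : ∀ a b, Commute (ι₁ a) (ι₃ b)) {E : WithConv (H →ₗ[ℂ] A)}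
    (hE1 : ∀ a x, Commute (ι₁ a) (E x)) (hE3 : ∀ a x, Commute (ι₃ a) (E x))
    (φ : Module.Dual ℂ H) :
    Commute ((emb ι₃ (Zr H) * emb ι₁ (Zr H) : WithConv (Module.Dual ℂ H →ₗ[ℂ] A)) φ)
      ((emb ι₃ (Xl H) * (E * emb ι₁ (Xr H)) : WithConv (H →ₗ[ℂ] A)) l) := by
  set W : WithConv (H →ₗ[ℂ] A) := E * emb ι₁ (Xr H) with hW
  have hW3 (a x) : Commute (ι₃ a) (W x) :=
    commute_convMul_apply (hE3 a) (fun y => (h13 _ _).symm) x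
  set V : WithConv (H →ₗ[ℂ] A) := emb ι₃ (Xl H) * W with hV
  have hVa (ψ : Module.Dual ℂ H) (g : H) :
      ι₁ (Zr H ψ) * V g = ∑ p ∈ sw g, V p.1 * ι₁ (Zr H (lact ψ p.2)) := by
    let N : H →ₗ[ℂ] A := ι₁.toLinearMap ∘ₗ Zr H ∘ₗ lact ψ
    have h1 : cst (ι₁ (Zr H ψ)) * emb ι₁ (Xr H) = emb ι₁ (Xr H) * toConv N := by
      ext x
      rw [cst_mul_apply, convMul_eq_sum, emb_apply, ← map_mul, Zr_mul_Xr, map_sum]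
      simp only [map_mul]
      rfl
    have h2 : cst (ι₁ (Zr H ψ)) * V = V * toConv N := by
      have c1 : Commute (cst (ι₁ (Zr H ψ))) E := commute_cst fun _ => hE1 _ _
      have c2 : Commute (cst (ι₁ (Zr H ψ))) (emb ι₃ (Xl H)) := commute_cst fun _ => h13 _ _
      rw [hV, hW, ← mul_assoc, c2.eq, mul_assoc, ← mul_assoc (cst _), c1.eq, mul_assoc E, h1]
      simp only [mul_assoc]
    have h3 := congrArg (fun F : WithConv (H →ₗ[ℂ] A) => F g) h2
    simp only [cst_mul_apply, convMul_eq_sum (f := V)] at h3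
    exact h3
  have hVb (ψ : Module.Dual ℂ H) (g : H) :
      ι₃ (Zr H ψ) * V g = ∑ p ∈ sw g, V p.2 * ι₃ (Zr H (ract ψ (S H p.1))) := by
    have h1 := sum_sw_rotate (ι₃.toLinearMap ∘ₗ Xl H) W.ofConv
      (ι₃.toLinearMap ∘ₗ Zr H ∘ₗ ract ψ ∘ₗ S H) g
    simp only [LinearMap.comp_apply, AlgHom.toLinearMap_apply] at h1
    refine Eq.trans ?_ h1
    rw [hV, convMul_eq_sum, Finset.mul_sum]
    refine Finset.sum_congr rfl fun p _ => ?_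
    rw [← mul_assoc, emb_apply, ← map_mul, Zr_mul_Xl, map_sum, Finset.sum_mul]
    refine Finset.sum_congr rfl fun q _ => ?_
    rw [map_mul, mul_assoc, (hW3 _ _).eq, mul_assoc]
  -- Θ(z) is T with z inserted between the two legs of φ. Pulling T through V(g) inserts S(g⁽¹⁾)g⁽³⁾
  -- and leaves V(g⁽²⁾).
  let Θ : H →ₗ[ℂ] A := ∑ s ∈ sw φ,
    LinearMap.mulRight ℂ (ι₁ (Zr H s.2)) ∘ₗ ι₃.toLinearMap ∘ₗ Zr H ∘ₗ ract s.1
  have hΘ (z : H) : Θ z = ∑ s ∈ sw φ, ι₃ (Zr H (ract s.1 z)) * ι₁ (Zr H s.2) := by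
    simp [Θ]
  set T : A := (emb ι₃ (Zr H) * emb ι₁ (Zr H) : WithConv (Module.Dual ℂ H →ₗ[ℂ] A)) φ with hT
  have hT' : T = ∑ s ∈ sw φ, ι₃ (Zr H s.1) * ι₁ (Zr H s.2) := by
    rw [hT, convMul_eq_sum]
    rfl
  have hΘ' (k z : H) :
      ∑ s ∈ sw φ, ι₃ (Zr H (ract s.1 k)) * ι₁ (Zr H (lact s.2 z)) = Θ (k * z) := by
    have h1 := sum_sw_ract_lact (LinearMap.mul' ℂ A ∘ₗ
      TensorProduct.map (ι₃.toLinearMap ∘ₗ Zr H) (ι₁.toLinearMap ∘ₗ Zr H)) φ k z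
    simp only [LinearMap.comp_apply, TensorProduct.map_tmul, LinearMap.mul'_apply,
      AlgHom.toLinearMap_apply] at h1
    rw [h1, hΘ]
  have h1 (g : H) : T * V g = ∑ p ∈ sw g, ∑ q ∈ sw p.1, V q.2 * Θ (S H q.1 * p.2) := by
    have h2 (s : Module.Dual ℂ H × Module.Dual ℂ H) : ι₃ (Zr H s.1) * ι₁ (Zr H s.2) * V g =
        ∑ p ∈ sw g, ∑ q ∈ sw p.1,
          V q.2 * (ι₃ (Zr H (ract s.1 (S H q.1))) * ι₁ (Zr H (lact s.2 p.2))) := by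
      rw [mul_assoc, hVa, Finset.mul_sum]
      refine Finset.sum_congr rfl fun p _ => ?_
      rw [← mul_assoc, hVb, Finset.sum_mul]
      simp only [mul_assoc]
    rw [hT', Finset.sum_mul]
    simp only [h2]
    rw [Finset.sum_comm]
    refine Finset.sum_congr rfl fun p _ => ?_
    rw [Finset.sum_comm]
    refine Finset.sum_congr rfl fun q _ => ?_
    rw [← Finset.mul_sum, hΘ']
  let R : H ⊗[ℂ] (H ⊗[ℂ] H) →ₗ[ℂ] A := LinearMap.mul' ℂ A ∘ₗ
    (TensorProduct.comm ℂ A A).toLinearMap ∘ₗ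
      TensorProduct.map (Θ ∘ₗ LinearMap.mul' ℂ H ∘ₗ (S H).rTensor H ∘ₗ
        (TensorProduct.comm ℂ H H).toLinearMap) V.ofConv ∘ₗ
      (TensorProduct.assoc ℂ H H H).symm.toLinearMap
  have hR (x y z : H) : R (x ⊗ₜ (y ⊗ₜ z)) = V z * Θ (S H y * x) := rfl
  have h2 : T * V l = ∑ p ∈ sw l, V p.2 * Θ (S H (eR H p.1)) := by
    -- Cocommutativity permits a cyclic rotation of three legs, so the nonadjacent product
    -- S(l⁽¹⁾)l⁽³⁾ becomes S(l⁽²⁾)l⁽¹⁾, which S² = id identifies with S(S(l⁽¹⁾)l⁽²⁾).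
    have h3 := hl.sum_sw_swap (R ∘ₗ (Δ H).lTensor H)
    simp only [LinearMap.comp_apply, LinearMap.lTensor_tmul, Δ_eq_sum, TensorProduct.tmul_sum,
      map_sum, hR] at h3
    rw [h1, h3]
    have h4 := sum_sw_assoc R l
    simp only [hR] at h4
    rw [← h4]
    refine Finset.sum_congr rfl fun p _ => ?_
    rw [← sum_S_mul, map_sum, map_sum, Finset.mul_sum]
    simp only [S_mul, hSS]
  -- The exchange relation at g = 1, which reabsorbs the legs of Δ(1) that ε_R leaves behind.
  have h5 : ∑ q ∈ sw (1 : H), ι₃ (Xl H q.2) * Θ (S H q.1) = T := by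
    simp only [hΘ, Finset.mul_sum]
    rw [Finset.sum_comm, hT']
    refine Finset.sum_congr rfl fun s _ => ?_
    simp only [← mul_assoc, ← Finset.sum_mul, ← map_mul, ← map_sum]
    rw [← Zr_mul_Xl, Xl_one, mul_one]
  change T * V l = V l * T
  rw [h2]
  have h6 := sum_sw_rotate (ι₃.toLinearMap ∘ₗ Xl H) W.ofConv (Θ ∘ₗ S H ∘ₗ eR H) l
  simp only [LinearMap.comp_apply, AlgHom.toLinearMap_apply] at h6
  refine h6.symm.trans ?_
  rw [hV, convMul_eq_sum, Finset.sum_mul]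
  refine Finset.sum_congr rfl fun p _ => ?_
  have h7 := sum_eR_head (LinearMap.mul' ℂ A ∘ₗ (TensorProduct.comm ℂ A A).toLinearMap ∘ₗ
    TensorProduct.map (Θ ∘ₗ S H) (LinearMap.mulRight ℂ (W p.2) ∘ₗ ι₃.toLinearMap ∘ₗ Xl H)) p.1
  simp only [LinearMap.comp_apply, TensorProduct.map_tmul, LinearMap.mul'_apply,
    LinearEquiv.coe_coe, TensorProduct.comm_tmul, LinearMap.mulRight_apply,
    AlgHom.toLinearMap_apply] at h7
  rw [h7, ← h5, Finset.mul_sum]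
  refine Finset.sum_congr rfl fun q _ => ?_
  rw [emb_apply, Xl_mul, map_mul, mul_assoc (ι₃ _), (hW3 _ _).eq]
  simp only [mul_assoc]

end CocommVertex

end WeakHopfCluster

namespace WeakHopfCluster

/-! ### Symmetries of the model with cocommutative integrals -/

section CocommSymmetry

/-- Nonemptiness matters: the empty convolution list is 0 by convention, whereas the empty product
is the unit of the convolution ring. -/
lemma toConv_convAlong {C A : Type*} [AddCommGroup C] [Module ℂ C] [Coalgebra ℂ C] [Ring A]
    [Algebra ℂ A] {l : List (C →ₗ[ℂ] A)} (hl : l ≠ []) :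
    (toConv (convAlong Coalgebra.comul l) : WithConv (C →ₗ[ℂ] A)) = (l.map toConv).prod := by
  induction l with
  | nil => exact absurd rfl hl
  | cons f l ih =>
    cases l with
    | nil => simp [convAlong]
    | cons g l =>
      rw [List.map_cons, List.prod_cons, ← ih (List.cons_ne_nil _ _)]
      rfl

lemma commute_convAlong_append {C A : Type*} [AddCommGroup C] [Module ℂ C] [Coalgebra ℂ C]
    [Ring A] [Algebra ℂ A] {u : A} {f g : C →ₗ[ℂ] A} {l₁ l₂ : List (C →ₗ[ℂ] A)}
    (h1 : ∀ k ∈ l₁, ∀ c, Commute u (k c)) (h2 : ∀ k ∈ l₂, ∀ c, Commute u (k c))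
    (hfg : ∀ c, Commute u ((toConv f * toConv g : WithConv (C →ₗ[ℂ] A)) c)) (c : C) :
    Commute u (convAlong Coalgebra.comul (l₁ ++ ([f, g] ++ l₂)) c) := by
  have hc {l : List (C →ₗ[ℂ] A)} (h : ∀ k ∈ l, ∀ c, Commute u (k c)) :
      Commute (cst u) (l.map toConv : List (WithConv (C →ₗ[ℂ] A))).prod :=
    list_prod_commute fun k hk => commute_cst (h k hk)
  refine commute_apply (f := toConv (convAlong Coalgebra.comul (l₁ ++ ([f, g] ++ l₂)))) ?_ c
  rw [toConv_convAlong (by simp), List.map_append, List.prod_append, List.map_append,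
    List.prod_append]
  refine (hc h1).mul_right (Commute.mul_right ?_ (hc h2))
  simpa using commute_cst hfg

variable {H : Type*} [Ring H] [Algebra ℂ H] [WeakHopfAlgebra H] [FiniteDimensional ℂ H] {m : ℕ}
  {L : Module.Dual ℂ H}

lemma edgeHom_commute {e e' : Edge m} (h : e ≠ e') (a b : Module.End ℂ H) :
    Commute (edgeHom e a) (edgeHom e' b) := onEdge_commute h a b

theorem roughOp_commute_faceOp (hSS : ∀ x : H, S H (S H x) = x) (ht : IsDualCocomm L) (h : H)
    (j : Fin (m + 1)) : Commute (roughOp m h) (faceOp j L) := by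
  obtain ⟨l₁, l₂, hl⟩ := exists_finRange_eq_append j
  have hk (k) (hk : k ∈ l₁ ∨ k ∈ l₂) (c : H) :
      Commute (faceOp j L) (onVert H (Xr H) k c) := by
    have := notMem_of_finRange_eq hl hk
    refine (commute_faceOp (fun a => ?_) (fun a => ?_) (fun a => ?_) L).symm
    · exact onEdge_commute (by simpa using this.1) _ _
    · exact onEdge_commute (by simp) _ _
    · exact onEdge_commute (by simpa using this.2) _ _
  have hne : (Sum.inl j.castSucc : Edge m) ≠ Sum.inl j.succ := by
    simp only [ne_eq, Sum.inl.injEq]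
    exact (Fin.castSucc_lt_succ).ne
  have hmid (c : H) : Commute (faceOp j L) ((toConv (onVert H (Xr H) j.castSucc) *
      toConv (onVert H (Xr H) j.succ) : WithConv (H →ₗ[ℂ] Module.End ℂ (Tot H m))) c) := by
    have h1 := commute_rough_of_cocomm (ι₁ := edgeHom (Sum.inl j.castSucc))
      (ι₃ := edgeHom (Sum.inl j.succ)) hSS ht (U := (emb (edgeHom (Sum.inl j.castSucc)) (Zr H) *
        (emb (edgeHom (Sum.inr j)) (Zl H) * emb (edgeHom (Sum.inl j.succ)) (Zl H)) :
          WithConv (Module.Dual ℂ H →ₗ[ℂ] Module.End ℂ (Tot H m))).ofConv)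
      (emb_Zr_mul_apply_mul_Xr fun a χ => commute_convMul_apply
          (fun χ => edgeHom_commute (by simp) a (Zl H χ))
          (fun χ => edgeHom_commute hne a (Zl H χ)) χ) ?_ c
    · rw [faceOp_apply]
      exact h1
    · rw [← mul_assoc]
      exact mul_emb_Zl_apply_mul_Xr fun a χ => commute_convMul_apply
          (fun χ => edgeHom_commute hne.symm a (Zr H χ))
          (fun χ => edgeHom_commute (by simp) a (Zl H χ)) χ
  have h1 := commute_convAlong_append (u := faceOp j L) (l₁ := l₁.map (onVert H (Xr H)))
    (l₂ := l₂.map (onVert H (Xr H))) (f := onVert H (Xr H) j.castSucc)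
    (g := onVert H (Xr H) j.succ) ?_ ?_ hmid h
  · have h2 : roughOp m h = convAlong Coalgebra.comul (l₁.map (onVert H (Xr H)) ++
        ([onVert H (Xr H) j.castSucc, onVert H (Xr H) j.succ] ++ l₂.map (onVert H (Xr H)))) h := by
      rw [roughOp, hl, List.map_append, List.map_append]
      rfl
    rw [h2]
    exact h1.symm
  · intro k hk'
    obtain ⟨i, hi, rfl⟩ := List.mem_map.1 hk'
    exact hk i (Or.inl hi)
  · intro k hk'
    obtain ⟨i, hi, rfl⟩ := List.mem_map.1 hk'
    exact hk i (Or.inr hi)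

theorem smoothOp_commute_vertexOp (hSS : ∀ x : H, S H (S H x) = x) {l : H} (hl : IsCocomm l)
    (φ : Module.Dual ℂ H) (i : Fin m) : Commute (smoothOp m φ) (vertexOp i l) := by
  obtain ⟨l₁, l₂, hl'⟩ := exists_finRange_eq_append i
  have hk (k) (hk : k ∈ l₁ ∨ k ∈ l₂) (c : Module.Dual ℂ H) :
      Commute (vertexOp i l) (onHoriz H (Zr H) k c) := by
    have := notMem_of_finRange_eq hl' hk
    refine (commute_vertexOp (fun a => ?_) (fun a => ?_) (fun a => ?_) l).symm
    · exact onEdge_commute (by simpa using this.2) _ _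
    · exact onEdge_commute (by simp) _ _
    · exact onEdge_commute (by simpa using this.1) _ _
  have hne : (Sum.inr i.castSucc : Edge m) ≠ Sum.inr i.succ := by
    simp only [ne_eq, Sum.inr.injEq]
    exact (Fin.castSucc_lt_succ).ne
  have hmid (c : Module.Dual ℂ H) : Commute (vertexOp i l) ((toConv (onHoriz H (Zr H) i.succ) *
      toConv (onHoriz H (Zr H) i.castSucc) :
        WithConv (Module.Dual ℂ H →ₗ[ℂ] Module.End ℂ (Tot H m))) c) :=
    (commute_smooth_of_cocomm (ι₁ := edgeHom (Sum.inr i.castSucc))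
      (ι₃ := edgeHom (Sum.inr i.succ)) hSS hl (edgeHom_commute hne)
      (E := emb (edgeHom (Sum.inl i.succ.castSucc)) (Xl H))
      (fun a x => edgeHom_commute (by simp) a (Xl H x))
      (fun a x => edgeHom_commute (by simp) a (Xl H x)) c).symm
  have h1 := commute_convAlong_append (u := vertexOp i l)
    (l₁ := l₂.reverse.map (onHoriz H (Zr H)))
    (l₂ := l₁.reverse.map (onHoriz H (Zr H))) (f := onHoriz H (Zr H) i.succ)
    (g := onHoriz H (Zr H) i.castSucc) ?_ ?_ hmid φ
  · have h2 : smoothOp m φ = convAlong Coalgebra.comul (l₂.reverse.map (onHoriz H (Zr H)) ++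
        ([onHoriz H (Zr H) i.succ, onHoriz H (Zr H) i.castSucc] ++
          l₁.reverse.map (onHoriz H (Zr H)))) φ := by
      rw [smoothOp, hl']
      simp only [List.reverse_append, List.map_append, List.append_assoc]
      rfl
    rw [h2]
    exact h1.symm
  · intro k hk'
    obtain ⟨i, hi, rfl⟩ := List.mem_map.1 hk'
    exact hk i (Or.inr (List.mem_reverse.1 hi))
  · intro k hk'
    obtain ⟨i, hi, rfl⟩ := List.mem_map.1 hk'
    exact hk i (Or.inl (List.mem_reverse.1 hi))

/-- With S² = id the two versions of X← coincide, and the two starting points around the vertex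
differ by a cyclic rotation of legs, which cocommutativity of l and commutation of distinct edges
allow. -/
theorem vertexOp_eq_vertexOpAbove (hSS : ∀ x : H, S H (S H x) = x) {l : H} (hl : IsCocomm l)
    (i : Fin m) : vertexOp i l = vertexOpAbove i l := by
  have h1 : XlInv H = Xl H := by
    ext x y
    change y * Sinv H x = y * S H x
    rw [← hSS x, Sinv_S, hSS]
  let E₃ : WithConv (H →ₗ[ℂ] Module.End ℂ (Tot H m)) := toConv (onHoriz H (Xl H) i.succ)
  let E₂ : WithConv (H →ₗ[ℂ] Module.End ℂ (Tot H m)) := toConv (onVert H (Xl H) i.succ.castSucc)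
  let E₁ : WithConv (H →ₗ[ℂ] Module.End ℂ (Tot H m)) := toConv (onHoriz H (Xr H) i.castSucc)
  have h2 : vertexOpAbove i l = (E₁ * (E₃ * E₂)) l := by
    rw [vertexOpAbove, h1]
    rfl
  have h3 : vertexOp i l = (E₃ * E₂ * E₁) l := by
    rw [mul_assoc]
    rfl
  have hne : (Sum.inr i.castSucc : Edge m) ≠ Sum.inr i.succ := by
    simp only [ne_eq, Sum.inr.injEq]
    exact (Fin.castSucc_lt_succ).ne
  have hc (x y : H) : Commute (E₁ x) ((E₃ * E₂) y) :=
    commute_convMul_apply (fun z => onEdge_commute hne (Xr H x) (Xl H z))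
      (fun z => onEdge_commute (by simp) (Xr H x) (Xl H z)) y
  rw [h2, h3, convMul_eq_sum, convMul_eq_sum]
  have h4 := hl.sum_sw_swap (LinearMap.mul' ℂ _ ∘ₗ TensorProduct.map E₁.ofConv (E₃ * E₂).ofConv)
  simp only [LinearMap.comp_apply, TensorProduct.map_tmul, LinearMap.mul'_apply] at h4
  rw [← h4]
  exact Finset.sum_congr rfl fun p _ => (hc _ _).eq.symm

theorem isSymmetry_boundary (hL : IsDualHaarIntegral L) (ht : IsDualCocomm L) {l : H}
    (hl : IsCocomm l) (h : H) (φ : Module.Dual ℂ H) :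
    IsSymmetry l L (roughOp m h) ∧ IsSymmetry l L (smoothOp m φ) :=
  ⟨isSymmetry_of_commute (fun i => roughOp_commute_vertexOp h i l)
      fun j => roughOp_commute_faceOp (hL.S_S ht) ht h j,
    isSymmetry_of_commute (fun i => smoothOp_commute_vertexOp (hL.S_S ht) hl φ i)
      fun j => smoothOp_commute_faceOp φ j L⟩

end CocommSymmetry

/-! ### Tensor products of representations -/

section TensorRep

variable {H : Type*} [Ring H] [Algebra ℂ H] [WeakHopfAlgebra H]
variable {V W : Type*} [AddCommGroup V] [Module ℂ V] [AddCommGroup W] [Module ℂ W]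
variable (ρ : H →ₐ[ℂ] Module.End ℂ V) (σ : H →ₐ[ℂ] Module.End ℂ W)

lemma tensorAction_eq_sum (h : H) :
    tensorAction ρ σ h = ∑ p ∈ sw h, TensorProduct.map (ρ p.1) (σ p.2) := by
  rw [tensorAction, LinearMap.comp_apply, LinearMap.comp_apply, Δ_eq_sum, map_sum, map_sum]
  rfl

lemma tensorAction_mul (g h : H) :
    tensorAction ρ σ (g * h) = tensorAction ρ σ g * tensorAction ρ σ h := by
  have h1 := sum_sw_mul (TensorProduct.homTensorHomMap (RingHom.id ℂ) V W V W ∘ₗ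
    TensorProduct.map ρ.toLinearMap σ.toLinearMap) g h
  simp only [LinearMap.comp_apply, TensorProduct.map_tmul, AlgHom.toLinearMap_apply,
    TensorProduct.homTensorHomMap_apply, map_mul] at h1
  rw [tensorAction_eq_sum, tensorAction_eq_sum, tensorAction_eq_sum, h1, Finset.sum_mul_sum]
  simp only [TensorProduct.map_mul]

lemma tensorAction_mem (h : H) (v : V ⊗[ℂ] W) : tensorAction ρ σ h v ∈ tensorRep ρ σ := by
  change tensorAction ρ σ 1 (tensorAction ρ σ h v) = tensorAction ρ σ h v
  rw [← Module.End.mul_apply, ← tensorAction_mul, one_mul]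

/-- The representation of `H` on the tensor product of representations. -/
def tensorRepHom : H →ₐ[ℂ] Module.End ℂ (tensorRep ρ σ) :=
  AlgHom.ofLinearMap
    { toFun := fun h => (tensorAction ρ σ h).restrict fun v _ => tensorAction_mem ρ σ h v
      map_add' := fun g h => by ext v; simp [LinearMap.restrict_apply]
      map_smul' := fun c h => by ext v; simp [LinearMap.restrict_apply] }
    (by ext v; exact v.2)
    (fun g h => by
      ext v
      change tensorAction ρ σ (g * h) v = _
      rw [tensorAction_mul]
      rfl)

lemma tensorRepHom_apply (h : H) (v : tensorRep ρ σ) :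
    ((tensorRepHom ρ σ h v : tensorRep ρ σ) : V ⊗[ℂ] W) = tensorAction ρ σ h v := rfl

/-- All operators of the action take values in the fixed space of Δ(1), so restricting to it does
not change the trace; on V ⊗ W the trace factorizes along Δ(h). -/
lemma character_tensorRepHom [FiniteDimensional ℂ V] [FiniteDimensional ℂ W] :
    character (tensorRepHom ρ σ) = dualMul (character ρ) (character σ) := by
  ext h
  have h1 : LinearMap.trace ℂ (tensorRep ρ σ) (tensorRepHom ρ σ h) =
      LinearMap.trace ℂ (V ⊗[ℂ] W) (tensorAction ρ σ h) :=
    LinearMap.trace_restrict_eq_of_forall_mem _ _ (fun v => tensorAction_mem ρ σ h v)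
  change LinearMap.trace ℂ (tensorRep ρ σ) (tensorRepHom ρ σ h) = _
  rw [h1, dualMul_apply, tensorAction_eq_sum, map_sum]
  exact Finset.sum_congr rfl fun p _ => LinearMap.trace_tensorProduct' _ _

end TensorRep

end WeakHopfCluster

end

theorem mainTheorem2 {H : Type*} [Ring H] [Algebra ℂ H] [WeakHopfCluster.WeakHopfAlgebra H]
    [FiniteDimensional ℂ H]
    (l : H) (hl : WeakHopfCluster.IsHaarIntegral l)
    (L : Module.Dual ℂ H) (hL : WeakHopfCluster.IsDualHaarIntegral L) (m : ℕ) :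
    -- the ribbon operators `F^{h,φ}`
    (∀ (h : H) (φ : Module.Dual ℂ H),
      (∀ (i : Fin m) (g : H),
        Commute (WeakHopfCluster.ribbonOp m h φ) (WeakHopfCluster.vertexOp i g)) ∧
      (∀ (j : Fin (m + 1)) (ψ : Module.Dual ℂ H),
        Commute (WeakHopfCluster.ribbonOp m h φ) (WeakHopfCluster.faceOp j ψ)) ∧
      WeakHopfCluster.IsSymmetry l L (WeakHopfCluster.ribbonOp m h φ)) ∧
    -- the algebra `H × Ĥ` of rough and smooth boundary operators
    ((∀ g h : H, WeakHopfCluster.roughOp m (g * h) =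
        WeakHopfCluster.roughOp m g * WeakHopfCluster.roughOp m h) ∧
      (∀ φ ψ : Module.Dual ℂ H, WeakHopfCluster.smoothOp m (WeakHopfCluster.dualMul φ ψ) =
        WeakHopfCluster.smoothOp m φ * WeakHopfCluster.smoothOp m ψ) ∧
      (∀ (h : H) (φ : Module.Dual ℂ H),
        Commute (WeakHopfCluster.roughOp m h) (WeakHopfCluster.smoothOp m φ)) ∧
      Function.Injective (TensorProduct.lift
        ((LinearMap.mul ℂ (Module.End ℂ (WeakHopfCluster.Tot H m))).compl₁₂
          (WeakHopfCluster.roughOp m) (WeakHopfCluster.smoothOp m))) ∧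
      (∀ (h : H) (i : Fin m) (g : H),
        Commute (WeakHopfCluster.roughOp m h) (WeakHopfCluster.vertexOp i g)) ∧
      (∀ (φ : Module.Dual ℂ H) (j : Fin (m + 1)) (ψ : Module.Dual ℂ H),
        Commute (WeakHopfCluster.smoothOp m φ) (WeakHopfCluster.faceOp j ψ))) ∧
    -- cocommutative Haar integrals
    (WeakHopfCluster.IsCocomm l → WeakHopfCluster.IsDualCocomm L →
      (∀ (h : H) (φ : Module.Dual ℂ H),
        WeakHopfCluster.IsSymmetry l L (WeakHopfCluster.roughOp m h) ∧
        WeakHopfCluster.IsSymmetry l L (WeakHopfCluster.smoothOp m φ)) ∧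
      ∀ i : Fin m, WeakHopfCluster.vertexOp i l = WeakHopfCluster.vertexOpAbove i l) ∧
    -- the sub-symmetry `H × Rep(H)`
    (∀ (V : Type*) [AddCommGroup V] [Module ℂ V] [FiniteDimensional ℂ V]
      (W : Type*) [AddCommGroup W] [Module ℂ W] [FiniteDimensional ℂ W]
      (ρ : H →ₐ[ℂ] Module.End ℂ V) (σ : H →ₐ[ℂ] Module.End ℂ W),
      (∀ h : H, WeakHopfCluster.IsSymmetry l L
        (WeakHopfCluster.ribbonOp m h (WeakHopfCluster.character ρ))) ∧
      ∃ τ : H →ₐ[ℂ] Module.End ℂ (WeakHopfCluster.tensorRep ρ σ),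
        (∀ (h : H) (v : WeakHopfCluster.tensorRep ρ σ),
          ((τ h v : WeakHopfCluster.tensorRep ρ σ) : V ⊗[ℂ] W) =
            WeakHopfCluster.tensorAction ρ σ h v) ∧
        WeakHopfCluster.smoothOp m (WeakHopfCluster.character τ) =
          WeakHopfCluster.smoothOp m (WeakHopfCluster.character ρ) *
            WeakHopfCluster.smoothOp m (WeakHopfCluster.character σ)) := by
  open WeakHopfCluster in
  refine ⟨fun h φ => ⟨ribbonOp_commute_vertexOp h φ, ribbonOp_commute_faceOp h φ,
      isSymmetry_ribbonOp l L h φ⟩,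
    ⟨roughOp_mul, smoothOp_mul, roughOp_commute_smoothOp, boundary_injective,
      roughOp_commute_vertexOp, smoothOp_commute_faceOp⟩,
    fun hlc hLc => ⟨isSymmetry_boundary hL hLc hlc,
      vertexOp_eq_vertexOpAbove (hL.S_S hLc) hlc⟩,
    fun V _ _ _ W _ _ _ ρ σ => ⟨fun h => isSymmetry_ribbonOp l L h (character ρ),
      tensorRepHom ρ σ, tensorRepHom_apply ρ σ, ?_⟩⟩
  rw [character_tensorRepHom, smoothOp_mul]
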